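/- For integers $p, m \ge 1$ let $N_{p,m} = F(m)/F(m)_{p+1}$ be the free nilpotent group of rank $m$ and class $p$, where $F(m)$ is the free group on $m$ generators and $F(m)_1 = F(m)$, $F(m)_{k+1} = [F(m)_k, F(m)]$ is its lower central series. Let $\varphi_0, \varphi_1, \ldots$ be the standard enumeration of the unary partial computable functions. The atomic diagram of a group $B$ with universe a subset of $\mathbb{N}$ is the set of (Gödel numbers of) all atomic sentences and negations of atomic sentences in the signature $\{\cdot, {}^{-1}, 1\}$, with constants for the elements of $B$, that are true in $B$. The index set $I(G)$ of a group $G$ is the set of all $e \in \mathbb{N}$ such that $\varphi_e$ is the characteristic function of the atomic diagram of a group $B$ with universe a subset of $\mathbb{N}$ and $B \cong G$. A set of natural numbers is d-$\Sigma_2$ if it is the intersection of a $\Sigma_2$ set and a $\Pi_2$ set. Then for all $p, m \ge 1$ the index set $I(N_{p,m})$ is $m$-complete d-$\Sigma_2$: it is d-$\Sigma_2$, and every d-$\Sigma_2$ set $T \subseteq \mathbb{N}$ is many-one reducible to it, i.e. there is a total computable $f : \mathbb{N} \to \mathbb{N}$ with $n \in T \iff f(n) \in I(N_{p,m})$ for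 all $n$. -/

import Mathlib

/-! ### Free nilpotent groups -/

/-- The free nilpotent group of rank `m` and class `p`: the quotient of the free group `F(m)` by the
term `F(m)_{p+1}` of its lower central series.  Mathlib counts the lower central series from `0`
(`lowerCentralSeries 0 = F(m)`, `lowerCentralSeries (k+1) = [lowerCentralSeries k, F(m)]`), so that
`F(m)_{p+1}` is its term number `p`. -/
abbrev FreeNilpotentGroup (p m : ℕ) : Type :=
  FreeGroup (Fin m) ⧸ (⊤ : Subgroup (FreeGroup (Fin m))).lowerCentralSeries p

/-! ### Atomic diagrams and index sets -/

/-- Closed terms in the signature `{·, ⁻¹, 1}` of groups, expanded by a constant for every element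
of `X`. -/
inductive GroupTerm (X : Type) : Type
  | const : X → GroupTerm X
  | one : GroupTerm X
  | inv : GroupTerm X → GroupTerm X
  | mul : GroupTerm X → GroupTerm X → GroupTerm X

namespace GroupTerm

/-- The value of a closed term in a group with universe `X`. -/
def eval {X : Type} [Group X] : GroupTerm X → X
  | const x => x
  | one => 1
  | inv t => (t.eval)⁻¹
  | mul t s => t.eval * s.eval

/-- The Gödel number of a closed term, for a universe `D` that is a set of natural numbers. -/
def code {D : Set ℕ} : GroupTerm D → ℕ
  | const x => 3 * (x : ℕ) + 1
  | one => 0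
  | inv t => 3 * t.code + 2
  | mul t s => 3 * Nat.pair t.code s.code + 3

end GroupTerm

/-- The Gödel number of the atomic sentence `t = s`. -/
def codeEq {D : Set ℕ} (t s : GroupTerm D) : ℕ := 2 * Nat.pair t.code s.code

/-- The Gödel number of the negated atomic sentence `t ≠ s`. -/
def codeNe {D : Set ℕ} (t s : GroupTerm D) : ℕ := 2 * Nat.pair t.code s.code + 1

/-- The atomic diagram of a group with universe `D ⊆ ℕ`: the set of all (Gödel numbers of) atomic
sentences and negated atomic sentences, with constants for the elements of `D`, that are true in
the group. -/
def atomicDiagram (D : Set ℕ) [Group D] : Set ℕ :=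
  {n | ∃ t s : GroupTerm D,
    (t.eval = s.eval ∧ n = codeEq t s) ∨ (t.eval ≠ s.eval ∧ n = codeNe t s)}

/-- The partial computable function `φ_e` with index `e`. -/
def phi (e : ℕ) : ℕ →. ℕ := Nat.Partrec.Code.eval (Denumerable.ofNat Nat.Partrec.Code e)

/-- `φ_e` is (total and equal to) the characteristic function of `S`. -/
def IsCharIndex (e : ℕ) (S : Set ℕ) : Prop :=
  ∀ n, (n ∈ S → 1 ∈ phi e n) ∧ (n ∉ S → 0 ∈ phi e n)

/-- The index set `I(G)` of a group `G`: the set of all `e` such that `φ_e` gives the atomic diagram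
of a structure with universe a set of natural numbers that is isomorphic to `G`.  (A structure in
the signature of groups that is isomorphic to a group is a group.) -/
def indexSet (G : Type*) [Group G] : Set ℕ :=
  {e | ∃ (D : Set ℕ) (_ : Group D), Nonempty (D ≃* G) ∧ IsCharIndex e (atomicDiagram D)}

/-! ### Complexity classes and completeness -/

/-- `Σ₂` sets of natural numbers. -/
def IsSigma2 (S : Set ℕ) : Prop :=
  ∃ R : ℕ × ℕ × ℕ → Prop, ComputablePred R ∧ ∀ n, n ∈ S ↔ ∃ x, ∀ y, R (n, x, y)

/-- `Π₂` sets of natural numbers. -/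
def IsPi2 (S : Set ℕ) : Prop := IsSigma2 Sᶜ

/-- d-`Σ₂` sets of natural numbers: the intersections of a `Σ₂` set and a `Π₂` set, that is, the
differences of two `Σ₂` sets. -/
def IsDSigma2 (S : Set ℕ) : Prop :=
  ∃ A B : Set ℕ, IsSigma2 A ∧ IsPi2 B ∧ S = A ∩ B

/-- `S` is `m`-complete for the class `Γ`: it belongs to `Γ`, and every set in `Γ` is many-one
reducible to it by a total computable function. -/
def IsMComplete (Γ : Set ℕ → Prop) (S : Set ℕ) : Prop :=
  Γ S ∧ ∀ T : Set ℕ, Γ T → ManyOneReducible (fun n => n ∈ T) (fun n => n ∈ S)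

/-! Write `N` for the free nilpotent group of class `p` and rank `m`.

Upper bound. A group `B` is isomorphic to `N` if and only if it has class at most `p`, every finite
subset lies in a subgroup generated by at most `m` elements, and some `m`-tuple is independent: it
satisfies no relation that fails in `N`, and it is linearly independent modulo commutators and
`q`-th powers for every `q` (`nonempty_mulEquiv_freeNilpotentGroup_iff`). An independent tuple
generates: if it is expressed in `m` elements `zs`, the matrix of exponent sums is invertible modulo
every prime, hence over `ℤ`, so substituting these expressions is a surjection of `N`, and the tuple
generates everything that `zs` generates. Asking for generation of finite sets only, and putting the
rest into the tuple, keeps the quantifiers low. Being the index of the diagram of a group, having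
class at most `p` and local generation are `Π₂`; the existence of an independent tuple is `Σ₂`,
because `N` has a decidable word problem (`exists_computable_evalN`).

Hardness. For `T = A ∩ B`, two computable sequences of events are attached to `n`: the first is
finite iff `n ∈ A`, the second is infinite iff `n ∈ B`. A direct limit of copies of `N × ℤ` is
built. At an event of the second kind the factor `ℤ` is collapsed into `N` by sending its generator
to `c ^ K`, where `c` is central of infinite order; at an event of the first kind the generators are
raised to the `k`-th power by an injective endomorphism, `k ≥ 2`; otherwise the map is the identity.
Infinitely many power maps force every homomorphism from the limit to `ℤ` into `kℤ`, which is
impossible for `N`. With finitely many power maps the limit is `N` if there are infinitely many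
collapses, and `N × ℤ ≇ N` if there are finitely many (`nonempty_limit_mulEquiv_iff`). Collapses are
not injective, but a large `K` preserves any finite set of inequalities; choosing `K` so at every
step makes the word problem of the limit decidable uniformly in `n`, which yields an index
computably (`exists_computable_index`).

The group theory needed is that subgroups of finitely generated nilpotent groups are finitely
generated, that `N` has a central element of infinite order, and that some power map is injective.
All three come from the central series and finite torsion exponents, without a basis theorem for
`N`. -/

/-! ### Automation for computability -/

section Automation

attribute [fun_prop] Primrec Computable
attribute [fun_prop] Primrec.id Primrec.const Primrec.comp Primrec.pair
attribute [fun_prop] Computable.id Computable.const Computable.comp Computable.pair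

variable {α β γ σ : Type*} [Primcodable α] [Primcodable β] [Primcodable γ] [Primcodable σ]

namespace Primrec

@[fun_prop] theorem fst_comp {f : γ → α × β} (hf : Primrec f) : Primrec fun x => (f x).1 :=
  Primrec.fst.comp hf

@[fun_prop] theorem snd_comp {f : γ → α × β} (hf : Primrec f) : Primrec fun x => (f x).2 :=
  Primrec.snd.comp hf

@[fun_prop] theorem append_comp {f g : γ → List α} (hf : Primrec f) (hg : Primrec g) :
    Primrec fun x => f x ++ g x := Primrec.list_append.comp hf hg

@[fun_prop] theorem cons_comp {f : γ → α} {g : γ → List α} (hf : Primrec f) (hg : Primrec g) :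
    Primrec fun x => f x :: g x := Primrec.list_cons.comp hf hg

@[fun_prop] theorem length_comp {f : γ → List α} (hf : Primrec f) :
    Primrec fun x => (f x).length := Primrec.list_length.comp hf

@[fun_prop] theorem natPair_comp {f g : γ → ℕ} (hf : Primrec f) (hg : Primrec g) :
    Primrec fun x => Nat.pair (f x) (g x) := Primrec₂.natPair.comp hf hg

@[fun_prop] theorem unpair_comp {f : γ → ℕ} (hf : Primrec f) :
    Primrec fun x => Nat.unpair (f x) := Primrec.unpair.comp hf

@[fun_prop] theorem add_comp {f g : γ → ℕ} (hf : Primrec f) (hg : Primrec g) :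
    Primrec fun x => f x + g x := Primrec.nat_add.comp hf hg

@[fun_prop] theorem sub_comp {f g : γ → ℕ} (hf : Primrec f) (hg : Primrec g) :
    Primrec fun x => f x - g x := Primrec.nat_sub.comp hf hg

@[fun_prop] theorem mul_comp {f g : γ → ℕ} (hf : Primrec f) (hg : Primrec g) :
    Primrec fun x => f x * g x := Primrec.nat_mul.comp hf hg

@[fun_prop] theorem div_comp {f g : γ → ℕ} (hf : Primrec f) (hg : Primrec g) :
    Primrec fun x => f x / g x := Primrec.nat_div.comp hf hg

@[fun_prop] theorem mod_comp {f g : γ → ℕ} (hf : Primrec f) (hg : Primrec g) :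
    Primrec fun x => f x % g x := Primrec.nat_mod.comp hf hg

@[fun_prop] theorem encode_comp {f : γ → α} (hf : Primrec f) :
    Primrec fun x => Encodable.encode (f x) := Primrec.encode.comp hf

@[fun_prop] theorem decode_comp {f : γ → ℕ} (hf : Primrec f) :
    Primrec fun x => (Encodable.decode (f x) : Option α) := Primrec.decode.comp hf

@[fun_prop] theorem isSome_comp {f : γ → Option α} (hf : Primrec f) :
    Primrec fun x => (f x).isSome := Primrec.option_isSome.comp hf

@[fun_prop] theorem some_comp {f : γ → α} (hf : Primrec f) :
    Primrec fun x => some (f x) := Primrec.option_some.comp hf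

@[fun_prop] theorem and_comp {f g : γ → Bool} (hf : Primrec f) (hg : Primrec g) :
    Primrec fun x => f x && g x := Primrec.and.comp hf hg

@[fun_prop] theorem or_comp {f g : γ → Bool} (hf : Primrec f) (hg : Primrec g) :
    Primrec fun x => f x || g x := Primrec.or.comp hf hg

@[fun_prop] theorem not_comp {f : γ → Bool} (hf : Primrec f) :
    Primrec fun x => !f x := Primrec.not.comp hf

@[fun_prop] theorem cond_comp {c : γ → Bool} {f g : γ → α} (hc : Primrec c) (hf : Primrec f)
    (hg : Primrec g) : Primrec fun x => bif c x then f x else g x := Primrec.cond hc hf hg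

@[fun_prop] theorem beq_comp [BEq α] [LawfulBEq α] {f g : γ → α} (hf : Primrec f)
    (hg : Primrec g) : Primrec fun x => f x == g x := by
  classical
  exact (Primrec.eq.decide.comp hf hg).of_eq fun x => by rw [Bool.eq_iff_iff]; simp

@[fun_prop] theorem getD_comp (d : α) {f : γ → List α} {g : γ → ℕ} (hf : Primrec f)
    (hg : Primrec g) : Primrec fun x => (f x).getD (g x) d :=
  (Primrec.list_getD d).comp hf hg

@[fun_prop] theorem range_comp {f : γ → ℕ} (hf : Primrec f) :
    Primrec fun x => List.range (f x) := Primrec.list_range.comp hf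

theorem ble_comp {f g : γ → ℕ} (hf : Primrec f) (hg : Primrec g) :
    Primrec fun x => decide (f x ≤ g x) := (Primrec.nat_le.comp hf hg).decide

theorem blt_comp {f g : γ → ℕ} (hf : Primrec f) (hg : Primrec g) :
    Primrec fun x => decide (f x < g x) := (Primrec.nat_lt.comp hf hg).decide

theorem list_all {f : α → List β} {g : α → β → Bool} (hf : Primrec f)
    (hg : Primrec fun x : α × β => g x.1 x.2) : Primrec fun a => (f a).all (g a) := by
  have : Primrec fun a => (f a).foldr (fun b acc => g a b && acc) true :=
    Primrec.list_foldr hf (Primrec.const true)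
      (h := fun a x => g a x.1 && x.2) (by
        change Primrec fun x : α × β × Bool => g x.1 x.2.1 && x.2.2
        have h1 : Primrec fun x : α × β × Bool => g x.1 x.2.1 :=
          hg.comp (f := fun x : α × β => g x.1 x.2) (g := fun x : α × β × Bool => (x.1, x.2.1))
            (by fun_prop)
        fun_prop)
  refine this.of_eq fun a => ?_
  induction f a with
  | nil => rfl
  | cons b l ih => simp [ih]

end Primrec

namespace Computable

@[fun_prop] theorem fst_comp {f : γ → α × β} (hf : Computable f) : Computable fun x => (f x).1 :=
  Computable.fst.comp hf

@[fun_prop] theorem snd_comp {f : γ → α × β} (hf : Computable f) : Computable fun x => (f x).2 :=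
  Computable.snd.comp hf

@[fun_prop] theorem append_comp {f g : γ → List α} (hf : Computable f) (hg : Computable g) :
    Computable fun x => f x ++ g x := Computable.list_append.comp hf hg

@[fun_prop] theorem natPair_comp {f g : γ → ℕ} (hf : Computable f) (hg : Computable g) :
    Computable fun x => Nat.pair (f x) (g x) := Primrec₂.natPair.to_comp.comp hf hg

@[fun_prop] theorem unpair_comp {f : γ → ℕ} (hf : Computable f) :
    Computable fun x => Nat.unpair (f x) := Computable.unpair.comp hf

@[fun_prop] theorem add_comp {f g : γ → ℕ} (hf : Computable f) (hg : Computable g) :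
    Computable fun x => f x + g x := Primrec.nat_add.to_comp.comp hf hg

@[fun_prop] theorem mul_comp {f g : γ → ℕ} (hf : Computable f) (hg : Computable g) :
    Computable fun x => f x * g x := Primrec.nat_mul.to_comp.comp hf hg

@[fun_prop] theorem div_comp {f g : γ → ℕ} (hf : Computable f) (hg : Computable g) :
    Computable fun x => f x / g x := Primrec.nat_div.to_comp.comp hf hg

@[fun_prop] theorem encode_comp {f : γ → α} (hf : Computable f) :
    Computable fun x => Encodable.encode (f x) := Computable.encode.comp hf

@[fun_prop] theorem and_comp {f g : γ → Bool} (hf : Computable f) (hg : Computable g) :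
    Computable fun x => f x && g x := Primrec.and.to_comp.comp hf hg

@[fun_prop] theorem or_comp {f g : γ → Bool} (hf : Computable f) (hg : Computable g) :
    Computable fun x => f x || g x := Primrec.or.to_comp.comp hf hg

@[fun_prop] theorem not_comp {f : γ → Bool} (hf : Computable f) :
    Computable fun x => !f x := Primrec.not.to_comp.comp hf

@[fun_prop] theorem cond_comp {c : γ → Bool} {f g : γ → α} (hc : Computable c)
    (hf : Computable f) (hg : Computable g) : Computable fun x => bif c x then f x else g x :=
  Computable.cond hc hf hg

@[fun_prop] theorem beq_comp [BEq α] [LawfulBEq α] {f g : γ → α} (hf : Computable f)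
    (hg : Computable g) : Computable fun x => f x == g x :=
  (Primrec.beq_comp (γ := α × α) Primrec.fst Primrec.snd).to_comp.comp (hf.pair hg)

@[fun_prop] theorem getD_comp (d : α) {f : γ → List α} {g : γ → ℕ} (hf : Computable f)
    (hg : Computable g) : Computable fun x => (f x).getD (g x) d :=
  (Primrec.list_getD d).to_comp.comp hf hg

/-- Bounded universal quantification of a computable property. -/
theorem forall_lt {f : α → ℕ} {g : α × ℕ → Bool} (hf : Computable f) (hg : Computable g) :
    Computable fun a => decide (∀ k < f a, g (a, k) = true) := by
  have : Computable fun a => Nat.rec (motive := fun _ => Bool) true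
      (fun k acc => g (a, k) && acc) (f a) :=
    Computable.nat_rec hf (Computable.const true) (h := fun a x => g (a, x.1) && x.2) (by
      change Computable fun x : α × ℕ × Bool => g (x.1, x.2.1) && x.2.2
      fun_prop)
  refine this.of_eq fun a => ?_
  induction f a with
  | zero => simp
  | succ n ih =>
    rw [Bool.eq_iff_iff]
    simp only [ih, Bool.and_eq_true, decide_eq_true_eq]
    constructor
    · rintro ⟨h, h'⟩ k hk
      rcases Nat.lt_succ_iff_lt_or_eq.1 hk with hk | rfl
      exacts [h' k hk, h]
    · exact fun h => ⟨h n (Nat.lt_succ_self n), fun k hk => h k (Nat.lt_succ_of_lt hk)⟩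

/-- Bounded universal quantification over the elements of a list. -/
theorem list_all [Inhabited β] {f : α → List β} {g : α × β → Bool} (hf : Computable f)
    (hg : Computable g) : Computable fun a => (f a).all fun b => g (a, b) := by
  have hl : Computable fun a => (f a).length := Computable.list_length.comp hf
  have := forall_lt (g := fun x : α × ℕ => g (x.1, (f x.1).getD x.2 default)) hl (by fun_prop)
  refine this.of_eq fun a => ?_
  rw [Bool.eq_iff_iff, decide_eq_true_eq, List.all_eq_true]
  constructor
  · intro h b hb
    obtain ⟨i, hi, rfl⟩ := List.mem_iff_getElem.1 hb
    simpa [hi] using h i hi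
  · intro h i hi
    have := h _ (List.getElem_mem hi)
    simpa [hi] using this

/-- The least witness of a computable property, when one always exists. -/
theorem nat_find {g : α × ℕ → Bool} (hg : Computable g) (h : ∀ a, ∃ k, g (a, k) = true) :
    Computable fun a => Nat.find (h a) := by
  refine Partrec.of_eq_tot (Partrec.rfind (p := fun a k => Part.some (g (a, k)))
    (by exact hg.partrec)) fun a => ?_
  refine Nat.mem_rfind.2 ⟨by simpa using (Nat.find_spec (h a)).symm, fun {k} hk => ?_⟩
  simpa using (Nat.find_min (h a) hk)

end Computable

end Automation

/-! ### Recursively enumerable predicates -/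

section RecursivelyEnumerable

variable {α β γ : Type*} [Primcodable α] [Primcodable β] [Primcodable γ]

/-- Evaluation with bounded fuel `k` is primitive recursive. Its monotonicity in `k` lets several
searches share one bound. -/
theorem REPred.exists_primrec {P : α → Prop} (h : REPred P) :
    ∃ g : ℕ × α → Bool, Primrec g ∧ (∀ k k' a, k ≤ k' → g (k, a) = true → g (k', a) = true) ∧
      ∀ a, P a ↔ ∃ k, g (k, a) = true := by
  obtain ⟨c, hc⟩ := Nat.Partrec.Code.exists_code.1 h
  refine ⟨fun x => (Nat.Partrec.Code.evaln x.1 c (Encodable.encode x.2)).isSome, ?_, ?_, ?_⟩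
  · have h1 := Nat.Partrec.Code.primrec_evaln
    have : Primrec fun x : ℕ × α => Nat.Partrec.Code.evaln x.1 c (Encodable.encode x.2) :=
      h1.comp (g := fun x : ℕ × α => ((x.1, c), Encodable.encode x.2)) (by fun_prop)
    fun_prop
  · intro k k' a hk h1
    obtain ⟨x, hx⟩ := Option.isSome_iff_exists.1 h1
    exact Option.isSome_iff_exists.2 ⟨x, Nat.Partrec.Code.evaln_mono hk hx⟩
  · intro a
    have h1 : P a ↔ ∃ x, x ∈ Nat.Partrec.Code.eval c (Encodable.encode a) := by
      rw [hc]; simp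
    rw [h1]
    simp only [Nat.Partrec.Code.evaln_complete, Option.isSome_iff_exists]
    exact exists_comm

theorem REPred.of_exists {P : α → Prop} {g : ℕ × α → Bool} (hg : Computable g)
    (h : ∀ a, P a ↔ ∃ k, g (k, a) = true) : REPred P := by
  have h1 : Partrec fun a => Nat.rfind fun k => (Part.some (g (k, a)) : Part Bool) := by
    refine Partrec.rfind (p := fun a k => Part.some (g (k, a))) ?_
    have : Computable fun x : α × ℕ => g (x.2, x.1) := by fun_prop
    exact this.partrec
  refine h1.dom_re.of_eq fun a => ?_
  refine Nat.rfind_dom'.trans ?_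
  rw [h]
  exact exists_congr fun k => ⟨fun h => (Part.mem_some_iff.1 h.1).symm,
    fun h => ⟨Part.mem_some_iff.2 h.symm, fun _ => trivial⟩⟩

theorem REPred.comp {P : β → Prop} (h : REPred P) {f : α → β} (hf : Computable f) :
    REPred fun a => P (f a) :=
  Partrec.comp h hf

theorem REPred.of_bool {f : α → Bool} (hf : Computable f) : REPred fun a => f a = true :=
  (Computable.computablePred (p := fun a => f a = true) (by simpa using hf)).to_re

theorem REPred.exists_comp {P : α × β → Prop} (h : REPred P) : REPred fun a => ∃ b, P (a, b) := by
  obtain ⟨g, hg, -, hP⟩ := h.exists_primrec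
  -- The search runs over pairs of a code for `b` and a fuel bound; numbers that code no element are
  -- rejected by the default `false`.
  refine REPred.of_exists (g := fun x : ℕ × α =>
    ((Encodable.decode (α := β) x.1.unpair.1).map fun b => g (x.1.unpair.2, x.2, b)).getD false)
    ?_ fun a => ?_
  · have h1 : Primrec fun x : ℕ × α =>
        (Encodable.decode (α := β) x.1.unpair.1).map fun b => g (x.1.unpair.2, x.2, b) :=
      Primrec.option_map (g := fun (x : ℕ × α) b => g (x.1.unpair.2, x.2, b)) (by fun_prop)
        (show Primrec fun x : (ℕ × α) × β => g (x.1.1.unpair.2, x.1.2, x.2) by fun_prop)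
    exact (Primrec.option_getD.comp h1 (Primrec.const false)).to_comp
  · simp only [hP]
    constructor
    · rintro ⟨b, k, hk⟩
      exact ⟨Nat.pair (Encodable.encode b) k, by simpa using hk⟩
    · rintro ⟨k, hk⟩
      cases hb : (Encodable.decode (α := β) k.unpair.1) with
      | none => simp [hb] at hk
      | some b => exact ⟨b, k.unpair.2, by simpa [hb] using hk⟩

theorem REPred.and {P Q : α → Prop} (hP : REPred P) (hQ : REPred Q) :
    REPred fun a => P a ∧ Q a := by
  obtain ⟨f, hf, hfm, hf'⟩ := hP.exists_primrec
  obtain ⟨g, hg, hgm, hg'⟩ := hQ.exists_primrec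
  refine REPred.of_exists (g := fun x => f x && g x) (by fun_prop : Primrec _).to_comp
    fun a => ?_
  simp only [hf', hg', Bool.and_eq_true]
  constructor
  · rintro ⟨⟨k, hk⟩, l, hl⟩
    exact ⟨max k l, hfm _ _ _ (le_max_left _ _) hk, hgm _ _ _ (le_max_right _ _) hl⟩
  · rintro ⟨k, h1, h2⟩
    exact ⟨⟨k, h1⟩, k, h2⟩

theorem REPred.or {P Q : α → Prop} (hP : REPred P) (hQ : REPred Q) :
    REPred fun a => P a ∨ Q a := by
  obtain ⟨f, hf, -, hf'⟩ := hP.exists_primrec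
  obtain ⟨g, hg, -, hg'⟩ := hQ.exists_primrec
  refine REPred.of_exists (g := fun x => f x || g x) (by fun_prop : Primrec _).to_comp
    fun a => ?_
  simp only [hf', hg', Bool.or_eq_true, exists_or]

theorem REPred.forall_mem_list {P : α × β → Prop} (h : REPred P) :
    REPred fun x : α × List β => ∀ b ∈ x.2, P (x.1, b) := by
  obtain ⟨g, hg, hm, hP⟩ := h.exists_primrec
  refine REPred.of_exists (g := fun x : ℕ × α × List β => x.2.2.all fun b => g (x.1, x.2.1, b))
    (Primrec.list_all (g := fun (x : ℕ × α × List β) b => g (x.1, x.2.1, b))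
      (by fun_prop) (by fun_prop)).to_comp ?_
  rintro ⟨a, l⟩
  simp only [hP, List.all_eq_true]
  constructor
  · intro H
    induction l with
    | nil => exact ⟨0, by simp⟩
    | cons b l ih =>
      obtain ⟨k, hk⟩ := H b (by simp)
      obtain ⟨k', hk'⟩ := ih fun b hb => H b (by simp [hb])
      refine ⟨max k k', fun c hc => ?_⟩
      rcases List.mem_cons.1 hc with rfl | hc
      · exact hm _ _ _ (le_max_left _ _) hk
      · exact hm _ _ _ (le_max_right _ _) (hk' c hc)
  · rintro ⟨k, hk⟩ b hb
    exact ⟨k, hk b hb⟩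

end RecursivelyEnumerable

/-! ### The second level of the arithmetical hierarchy -/

section Arithmetical

variable {α β : Type*} [Primcodable α] [Primcodable β]

/-- The negation of an r.e. predicate says that no stage of the enumeration succeeds, which supplies
the inner universal quantifier. A number that codes no element of `β` cannot serve as a witness
because of the default `false`. -/
theorem isSigma2_of_exists_not_re {S : Set ℕ} {P : ℕ × β → Prop} (hP : REPred P)
    (h : ∀ n, n ∈ S ↔ ∃ b, ¬ P (n, b)) : IsSigma2 S := by
  obtain ⟨g, hg, -, hg'⟩ := hP.exists_primrec
  have h2 : Primrec fun x : ℕ × ℕ × ℕ =>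
      ((Encodable.decode (α := β) x.2.1).map fun b => !g (x.2.2, x.1, b)).getD false :=
    Primrec.option_getD.comp (Primrec.option_map
      (g := fun (x : ℕ × ℕ × ℕ) b => !g (x.2.2, x.1, b)) (by fun_prop)
      (show Primrec fun x : (ℕ × ℕ × ℕ) × β => !g (x.1.2.2, x.1.1, x.2) by fun_prop))
      (Primrec.const false)
  refine ⟨_, Computable.computablePred (p := fun x : ℕ × ℕ × ℕ =>
      ((Encodable.decode (α := β) x.2.1).map fun b => !g (x.2.2, x.1, b)).getD false = true)
    (by simpa using h2.to_comp), fun n => ?_⟩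
  simp only [h, hg']
  constructor
  · rintro ⟨b, hb⟩
    refine ⟨Encodable.encode b, fun y => ?_⟩
    simpa using fun h => hb ⟨y, h⟩
  · rintro ⟨x, hx⟩
    cases hb : (Encodable.decode (α := β) x) with
    | none => simp [hb] at hx
    | some b => exact ⟨b, by simpa [hb] using hx⟩

theorem isPi2_of_forall_re {S : Set ℕ} {P : ℕ × β → Prop} (hP : REPred P)
    (h : ∀ n, n ∈ S ↔ ∀ b, P (n, b)) : IsPi2 S :=
  isSigma2_of_exists_not_re hP fun n => by simp [h]

/-- The property `∃ z, ¬ R (n, x, z)` is r.e.; its primitive recursive approximations, indexed by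
fuel, replace the merely computable matrix and absorb the inner quantifier. -/
theorem IsSigma2.exists_primrec {S : Set ℕ} (hS : IsSigma2 S) :
    ∃ g : ℕ × ℕ × ℕ → Bool, Primrec g ∧ ∀ n, n ∈ S ↔ ∃ x, ∀ y, g (n, x, y) = false := by
  obtain ⟨R, hR, h⟩ := hS
  have h1 : REPred fun z : (ℕ × ℕ) × ℕ => ¬ R (z.1.1, z.1.2, z.2) :=
    hR.not.to_re.comp (f := fun z : (ℕ × ℕ) × ℕ => (z.1.1, z.1.2, z.2)) (by fun_prop)
  obtain ⟨g, hg, -, hg'⟩ := h1.exists_comp.exists_primrec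
  refine ⟨fun z => g (z.2.2, z.1, z.2.1), by fun_prop, fun n => ?_⟩
  rw [h]
  refine exists_congr fun x => ?_
  have := hg' (n, x)
  rw [← not_iff_not]
  simpa using this

theorem IsPi2.inter {S T : Set ℕ} (hS : IsPi2 S) (hT : IsPi2 T) : IsPi2 (S ∩ T) := by
  obtain ⟨f, hf, hf'⟩ := IsSigma2.exists_primrec hS
  obtain ⟨g, hg, hg'⟩ := IsSigma2.exists_primrec hT
  have key : ∀ (U : Set ℕ) (u : ℕ × ℕ × ℕ → Bool), (∀ n, n ∈ Uᶜ ↔ ∃ x, ∀ y, u (n, x, y) = false) →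
      ∀ n, n ∈ U ↔ ∀ x, ∃ y, u (n, x, y) = true := by
    intro U u h n
    rw [← not_iff_not, ← Set.mem_compl_iff, h]
    simp
  have h1 : ∀ u : ℕ × ℕ × ℕ → Bool, Primrec u → REPred fun z : ℕ × ℕ => ∃ y, u (z.1, z.2, y) = true :=
    fun u hu => (REPred.of_bool (f := fun z : (ℕ × ℕ) × ℕ => u (z.1.1, z.1.2, z.2))
      (by fun_prop : Primrec _).to_comp).exists_comp
  refine isPi2_of_forall_re ((h1 f hf).and (h1 g hg)) fun n => ?_
  simp only [Set.mem_inter_iff, key S f hf', key T g hg', forall_and]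

end Arithmetical

/-! ### Words in countably many letters -/

section Words

/-- Words in the letters indexed by `ℕ` and their inverses. -/
abbrev Word : Type := List (ℕ × Bool)

open FreeGroup (mk invRev)

variable {α β : Type*} [Primcodable α] [Primcodable β]

@[fun_prop] theorem Primrec.invRev_comp {f : β → List (α × Bool)} (hf : Primrec f) :
    Primrec fun x => invRev (f x) :=
  Primrec.list_reverse.comp (Primrec.list_map hf
    (g := fun _ (y : α × Bool) => (y.1, !y.2))
    (show Primrec fun x : β × α × Bool => (x.2.1, !x.2.2) by fun_prop))

@[fun_prop] theorem Computable.invRev_comp {f : β → List (α × Bool)} (hf : Computable f) :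
    Computable fun x => invRev (f x) :=
  (Primrec.invRev_comp Primrec.id).to_comp.comp hf

/-- One step of free reduction: put a letter in front of a reduced word. -/
def consReduce (x : ℕ × Bool) (l : Word) : Word :=
  List.casesOn l [x] fun y t => bif x.1 == y.1 && x.2 == !y.2 then t else x :: y :: t

theorem primrec_reduce : Primrec (FreeGroup.reduce : Word → Word) := by
  have h1 : Primrec₂ consReduce := by
    refine Primrec.list_casesOn (f := fun p : (ℕ × Bool) × Word => p.2) (g := fun p => [p.1])
      (h := fun p y => bif p.1.1 == y.1.1 && p.1.2 == !y.1.2 then y.2 else p.1 :: y.1 :: y.2)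
      (by fun_prop) (by fun_prop) ?_
    change Primrec fun z : ((ℕ × Bool) × Word) × (ℕ × Bool) × Word =>
      bif z.1.1.1 == z.2.1.1 && z.1.1.2 == !z.2.1.2 then z.2.2 else z.1.1 :: z.2.1 :: z.2.2
    fun_prop
  have h2 : Primrec fun l : Word => l.foldr consReduce [] :=
    Primrec.list_foldr (h := fun _ x => consReduce x.1 x.2) Primrec.id (Primrec.const [])
      (show Primrec fun z : Word × (ℕ × Bool) × Word => consReduce z.2.1 z.2.2 from
        Primrec₂.comp h1 (by fun_prop) (by fun_prop))
  refine h2.of_eq fun l => ?_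
  induction l with
  | nil => rfl
  | cons x l ih =>
    rw [List.foldr_cons, ih, FreeGroup.reduce.cons]
    unfold consReduce
    cases FreeGroup.reduce l with
    | nil => rfl
    | cons y t => by_cases h : x.1 = y.1 ∧ x.2 = !y.2 <;> simp_all

/-- Equality in the free group. -/
def freeEq (l l' : Word) : Bool := FreeGroup.reduce l == FreeGroup.reduce l'

theorem freeEq_iff {l l' : Word} : freeEq l l' = true ↔ mk l = mk l' := by
  rw [freeEq, beq_iff_eq]
  exact ⟨fun h => FreeGroup.reduce.exact h, fun h => FreeGroup.reduce.sound h⟩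

@[fun_prop] theorem Primrec.freeEq_comp {f g : β → Word} (hf : Primrec f) (hg : Primrec g) :
    Primrec fun x => freeEq (f x) (g x) :=
  Primrec.beq_comp (primrec_reduce.comp hf) (primrec_reduce.comp hg)

/-- The word obtained by replacing every letter by a word. -/
def expand (s : ℕ → Word) (l : Word) : Word :=
  l.flatMap fun x => bif x.2 then s x.1 else invRev (s x.1)

theorem mk_expand (s : ℕ → Word) (l : Word) :
    mk (expand s l) = FreeGroup.lift (fun j => mk (s j)) (mk l) := by
  rw [FreeGroup.lift_mk]
  induction l with
  | nil => rfl
  | cons x l ih =>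
    have : expand s (x :: l) = (bif x.2 then s x.1 else invRev (s x.1)) ++ expand s l := rfl
    rw [this, ← FreeGroup.mul_mk, ih]
    rcases x with ⟨i, _ | _⟩ <;> simp [FreeGroup.inv_mk]

theorem hom_mk_expand {G : Type*} [Group G] (φ : FreeGroup ℕ →* G) (s : ℕ → Word) (l : Word) :
    φ (mk (expand s l)) = FreeGroup.lift (fun j => φ (mk (s j))) (mk l) := by
  rw [mk_expand, ← MonoidHom.comp_apply]
  congr 1
  ext j
  simp

@[fun_prop] theorem Primrec.expand_comp {s : β → ℕ → Word} {f : β → Word}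
    (hs : Primrec fun x : β × ℕ => s x.1 x.2) (hf : Primrec f) :
    Primrec fun x => expand (s x) (f x) := by
  refine Primrec.list_flatMap hf (g := fun b x => bif x.2 then s b x.1 else invRev (s b x.1)) ?_
  change Primrec fun z : β × ℕ × Bool =>
    bif z.2.2 then s z.1 z.2.1 else invRev (s z.1 z.2.1)
  have : Primrec fun z : β × ℕ × Bool => s z.1 z.2.1 :=
    hs.comp (g := fun z : β × ℕ × Bool => (z.1, z.2.1)) (by fun_prop)
  fun_prop

/-- The word obtained by replacing the letters by the entries of a list of words; letters beyond
the length of the list are deleted. -/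
def substList (P : List Word) (l : Word) : Word := expand (fun j => P.getD j []) l

@[fun_prop] theorem Primrec.substList_comp {P : β → List Word} {f : β → Word}
    (hP : Primrec P) (hf : Primrec f) : Primrec fun x => substList (P x) (f x) :=
  Primrec.expand_comp (s := fun x j => (P x).getD j []) (by fun_prop) hf

@[fun_prop] theorem Computable.substList_comp {P : β → List Word} {f : β → Word}
    (hP : Computable P) (hf : Computable f) : Computable fun x => substList (P x) (f x) :=
  (Primrec.substList_comp Primrec.fst Primrec.snd).to_comp.comp (hP.pair hf)

/-- The exponent sum of a letter. -/
def expSum (i : ℕ) : FreeGroup ℕ →* Multiplicative ℤ :=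
  FreeGroup.lift fun j => if j = i then Multiplicative.ofAdd 1 else 1

theorem expSum_mk (i : ℕ) (l : Word) :
    (expSum i (mk l)).toAdd = (l.count (i, true) : ℤ) - l.count (i, false) := by
  rw [expSum, FreeGroup.lift_mk]
  induction l with
  | nil => rfl
  | cons x l ih =>
    rw [List.map_cons, List.prod_cons, toAdd_mul, ih]
    rcases x with ⟨j, _ | _⟩ <;> by_cases h : j = i <;> simp [h] <;> ring

/-- The test whether an exponent sum is divisible by `q`. -/
def dvdExpSum (q i : ℕ) (l : Word) : Bool := l.count (i, true) % q == l.count (i, false) % q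

/-- The case `q = 0`, where `a % 0 = a`, is included: the test then says that the exponent sum
vanishes. -/
theorem dvdExpSum_iff {q i : ℕ} {l : Word} :
    dvdExpSum q i l = true ↔ (q : ℤ) ∣ (expSum i (mk l)).toAdd := by
  rw [dvdExpSum, beq_iff_eq, expSum_mk, ← dvd_neg, neg_sub]
  exact Nat.modEq_iff_dvd

theorem Primrec.list_count [BEq α] [LawfulBEq α] {f : β → α} {g : β → List α} (hf : Primrec f)
    (hg : Primrec g) : Primrec fun x => (g x).count (f x) := by
  have : Primrec fun b => (g b).foldr (fun y n => (bif y == f b then 1 else 0) + n) 0 :=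
    Primrec.list_foldr hg (Primrec.const 0)
      (h := fun b x => (bif x.1 == f b then 1 else 0) + x.2)
      (show Primrec fun z : β × α × ℕ => (bif z.2.1 == f z.1 then 1 else 0) + z.2.2 by fun_prop)
  refine this.of_eq fun b => ?_
  induction g b with
  | nil => rfl
  | cons y l ih => rw [List.foldr_cons, ih, List.count_cons, add_comm]; cases y == f b <;> rfl

@[fun_prop] theorem Primrec.dvdExpSum_comp {q i : β → ℕ} {f : β → Word} (hq : Primrec q)
    (hi : Primrec i) (hf : Primrec f) : Primrec fun x => dvdExpSum (q x) (i x) (f x) := by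
  have h1 : Primrec fun x => (f x).count (i x, true) := Primrec.list_count (hi.pair (Primrec.const _)) hf
  have h2 : Primrec fun x => (f x).count (i x, false) := Primrec.list_count (hi.pair (Primrec.const _)) hf
  unfold dvdExpSum
  fun_prop

end Words

/-! ### Words from codes of terms -/

section TermWords

open FreeGroup (mk invRev)

/-- The word in the constants to which a term, given by its Gödel number, expands. -/
def termWord : ℕ → Word
  | 0 => []
  | n + 1 =>
    have : n / 3 < n + 1 := by omega
    have : (n / 3).unpair.1 < n + 1 := (Nat.unpair_left_le _).trans_lt this
    have : (n / 3).unpair.2 < n + 1 := (Nat.unpair_right_le _).trans_lt ‹_›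
    bif n % 3 == 0 then [(n / 3, true)]
    else bif n % 3 == 1 then invRev (termWord (n / 3))
    else termWord (n / 3).unpair.1 ++ termWord (n / 3).unpair.2

theorem termWord_zero : termWord 0 = [] := by rw [termWord]

theorem termWord_const (x : ℕ) : termWord (3 * x + 1) = [(x, true)] := by
  rw [termWord]; simp

theorem termWord_inv (c : ℕ) : termWord (3 * c + 2) = invRev (termWord c) := by
  rw [termWord]
  simp [show (3 * c + 1) % 3 = 1 by omega, show (3 * c + 1) / 3 = c by omega]

theorem termWord_mul (a b : ℕ) :
    termWord (3 * Nat.pair a b + 3) = termWord a ++ termWord b := by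
  rw [termWord]
  simp [show (3 * Nat.pair a b + 2) % 3 = 2 by omega,
    show (3 * Nat.pair a b + 2) / 3 = Nat.pair a b by omega]

/-- The recursion step in the computation of `termWord`, from the list of the previous values. -/
def termWordStep (l : List Word) : Word :=
  -- The list holds the values at all arguments below `l.length`, so `l.length` is the current
  -- argument and `l.length - 1` the `n` of the clause for `n + 1`.
  bif l.length == 0 then [] else
    bif (l.length - 1) % 3 == 0 then [((l.length - 1) / 3, true)]
    else bif (l.length - 1) % 3 == 1 then invRev (l.getD ((l.length - 1) / 3) [])
    else l.getD ((l.length - 1) / 3).unpair.1 [] ++ l.getD ((l.length - 1) / 3).unpair.2 []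

theorem primrec_termWord : Primrec termWord := by
  have h : Primrec₂ fun (_ : Unit) n => termWord n := by
    refine Primrec.nat_strong_rec (fun _ n => termWord n) (g := fun _ l => some (termWordStep l))
      (show Primrec fun x : Unit × List Word => some (termWordStep x.2) by
        unfold termWordStep; fun_prop) ?_
    rintro - n
    simp only [termWordStep, List.length_map, List.length_range, Option.some.injEq]
    cases n with
    | zero => simp [termWord_zero]
    | succ n =>
      have h0 : n / 3 < n + 1 := by omega
      have h1 : (n / 3).unpair.1 < n + 1 := (Nat.unpair_left_le _).trans_lt h0
      have h2 : (n / 3).unpair.2 < n + 1 := (Nat.unpair_right_le _).trans_lt h0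
      rw [termWord]
      simp [h0, h1, h2]
  exact Primrec₂.comp h (Primrec.const ()) Primrec.id

/-- Case distinction for Gödel numbers of terms. -/
theorem codeCases {P : ℕ → Prop} (one : P 0) (const : ∀ x, P (3 * x + 1))
    (inv : ∀ c, P c → P (3 * c + 2)) (mul : ∀ a b, P a → P b → P (3 * Nat.pair a b + 3)) (n : ℕ) :
    P n := by
  induction n using Nat.strong_induction_on with
  | _ n ih =>
    rcases Nat.eq_zero_or_pos n with rfl | hn
    · exact one
    · have h0 : (n - 1) / 3 < n := by omega
      have h3 : (n - 1) % 3 = 0 ∨ (n - 1) % 3 = 1 ∨ (n - 1) % 3 = 2 := by omega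
      rcases h3 with h3 | h3 | h3
      · have : n = 3 * ((n - 1) / 3) + 1 := by omega
        rw [this]; exact const _
      · have : n = 3 * ((n - 1) / 3) + 2 := by omega
        rw [this]; exact inv _ (ih _ h0)
      · have h := mul ((n - 1) / 3).unpair.1 ((n - 1) / 3).unpair.2
          (ih _ ((Nat.unpair_left_le _).trans_lt h0)) (ih _ ((Nat.unpair_right_le _).trans_lt h0))
        rw [Nat.pair_unpair] at h
        have : n = 3 * ((n - 1) / 3) + 3 := by omega
        rw [this]; exact h

theorem GroupTerm.mem_of_mem_termWord {D : Set ℕ} (t : GroupTerm D) :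
    ∀ x ∈ termWord t.code, x.1 ∈ D := by
  induction t with
  | const x => simp [code, termWord_const]
  | one => simp [code, termWord_zero]
  | inv t ih =>
    intro x hx
    simp only [code, termWord_inv, invRev, List.mem_reverse, List.mem_map] at hx
    obtain ⟨y, hy, rfl⟩ := hx
    exact ih y hy
  | mul t s iht ihs =>
    intro x hx
    rw [code, termWord_mul, List.mem_append] at hx
    exact hx.elim (iht x) (ihs x)

/-- The numbering by `0` and the residues modulo `3` is onto if all constants are allowed, so only
the constants that occur can keep a number from being a code. -/
theorem GroupTerm.exists_code_eq {D : Set ℕ} (c : ℕ) :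
    (∀ x ∈ termWord c, x.1 ∈ D) → ∃ t : GroupTerm D, t.code = c := by
  induction c using codeCases with
  | one => exact fun _ => ⟨one, rfl⟩
  | const x => exact fun h => ⟨const ⟨x, h (x, true) (by simp [termWord_const])⟩, rfl⟩
  | inv c ih =>
    intro h
    obtain ⟨t, rfl⟩ := ih fun x hx => h (x.1, !x.2) (by
      rw [termWord_inv, invRev, List.mem_reverse, List.mem_map]
      exact ⟨x, hx, rfl⟩)
    exact ⟨inv t, rfl⟩
  | mul a b iha ihb =>
    intro h
    rw [termWord_mul] at h
    obtain ⟨t, rfl⟩ := iha fun x hx => h x (List.mem_append_left _ hx)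
    obtain ⟨s, rfl⟩ := ihb fun x hx => h x (List.mem_append_right _ hx)
    exact ⟨mul t s, rfl⟩

theorem GroupTerm.code_injective {D : Set ℕ} :
    Function.Injective (code : GroupTerm D → ℕ) := by
  intro t
  induction t with
  | const x =>
    intro s h
    cases s <;> simp only [code] at h <;> first | omega | skip
    congr 1; exact Subtype.ext (by omega)
  | one => intro s h; cases s <;> simp only [code] at h <;> first | omega | rfl
  | inv t ih =>
    intro s h
    cases s <;> simp only [code] at h <;> first | omega | skip
    rename_i s
    rw [ih (show t.code = s.code by omega)]
  | mul t s iht ihs =>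
    intro r h
    cases r <;> simp only [code] at h <;> first | omega | skip
    rename_i t' s'
    have h' := Nat.pair_eq_pair.1
      (show Nat.pair t.code s.code = Nat.pair t'.code s'.code by omega)
    rw [iht h'.1, ihs h'.2]

/-- Extending `φ` arbitrarily to a function `a` on `ℕ` lets terms be evaluated through the free
group on all numbers, whatever the universe is. -/
theorem GroupTerm.map_eval {D : Set ℕ} [Group D] {G : Type*} [Group G] (φ : D →* G) (a : ℕ → G)
    (ha : ∀ x : D, φ x = a x) (t : GroupTerm D) :
    φ t.eval = FreeGroup.lift a (mk (termWord t.code)) := by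
  induction t with
  | const x => simp [eval, code, termWord_const, ha]
  | one => simp [eval, code, termWord_zero]
  | inv t ih => rw [eval, code, termWord_inv, ← FreeGroup.inv_mk, map_inv, map_inv, ih]
  | mul t s iht ihs => rw [eval, code, termWord_mul, ← FreeGroup.mul_mk, map_mul, map_mul, iht, ihs]

theorem codeEq_mem_atomicDiagram {D : Set ℕ} [Group D] {t s : GroupTerm D} :
    codeEq t s ∈ atomicDiagram D ↔ t.eval = s.eval := by
  refine ⟨?_, fun h => ⟨t, s, Or.inl ⟨h, rfl⟩⟩⟩
  rintro ⟨t', s', ⟨h, h'⟩ | ⟨-, h'⟩⟩ <;> simp only [codeEq, codeNe] at h'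
  · have h' := Nat.pair_eq_pair.1
      (show Nat.pair t.code s.code = Nat.pair t'.code s'.code by omega)
    rwa [GroupTerm.code_injective h'.1, GroupTerm.code_injective h'.2]
  · omega

theorem codeNe_mem_atomicDiagram {D : Set ℕ} [Group D] {t s : GroupTerm D} :
    codeNe t s ∈ atomicDiagram D ↔ t.eval ≠ s.eval := by
  refine ⟨?_, fun h => ⟨t, s, Or.inr ⟨h, rfl⟩⟩⟩
  rintro ⟨t', s', ⟨-, h'⟩ | ⟨h, h'⟩⟩ <;> simp only [codeEq, codeNe] at h'
  · omega
  · have h' := Nat.pair_eq_pair.1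
      (show Nat.pair t.code s.code = Nat.pair t'.code s'.code by omega)
    rwa [GroupTerm.code_injective h'.1, GroupTerm.code_injective h'.2]

theorem mem_atomicDiagram_iff {D : Set ℕ} [Group D] {n : ℕ} :
    n ∈ atomicDiagram D ↔ ∃ t s : GroupTerm D, t.code = (n / 2).unpair.1 ∧
      s.code = (n / 2).unpair.2 ∧ (n % 2 = 0 ↔ t.eval = s.eval) := by
  constructor
  · rintro ⟨t, s, ⟨h, rfl⟩ | ⟨h, rfl⟩⟩
    · exact ⟨t, s, by simp [codeEq], by simp [codeEq], by simp [codeEq, h]⟩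
    · have : (2 * Nat.pair t.code s.code + 1) / 2 = Nat.pair t.code s.code := by omega
      exact ⟨t, s, by simp [codeNe, this], by simp [codeNe, this], by simp [codeNe, h, Nat.add_mod]⟩
  · rintro ⟨t, s, ht, hs, h⟩
    have h1 : Nat.pair t.code s.code = n / 2 := by rw [ht, hs, Nat.pair_unpair]
    rcases Nat.mod_two_eq_zero_or_one n with h2 | h2
    · exact ⟨t, s, Or.inl ⟨h.1 h2, by rw [codeEq]; omega⟩⟩
    · exact ⟨t, s, Or.inr ⟨fun h3 => by have := h.2 h3; omega, by rw [codeNe]; omega⟩⟩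

end TermWords

/-! ### Uniformly computable presentations have computable diagrams -/

section Presentations

open FreeGroup (mk invRev)

/-- The word with a given number. -/
def wordOf (k : ℕ) : Word := (Encodable.decode (α := Word) k).getD []

theorem wordOf_encode (l : Word) : wordOf (Encodable.encode l) = l := by simp [wordOf]

@[fun_prop] theorem Primrec.wordOf_comp {α : Type*} [Primcodable α] {f : α → ℕ} (hf : Primrec f) :
    Primrec fun x => wordOf (f x) :=
  (Primrec.option_getD.comp Primrec.decode (Primrec.const [])).comp hf

@[fun_prop] theorem Computable.wordOf_comp {α : Type*} [Primcodable α] {f : α → ℕ}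
    (hf : Computable f) : Computable fun x => wordOf (f x) :=
  (Primrec.wordOf_comp Primrec.id).to_comp.comp hf

variable (K : Subgroup (FreeGroup ℕ))

/-- The numbers of those words that are first in their coset. -/
def leastWords : Set ℕ :=
  {k | ∀ j < k, (mk (wordOf j) : FreeGroup ℕ ⧸ K) ≠ mk (wordOf k)}

/-- Taking the least representative gives every coset exactly one name, so the quotient can be
copied to a set of numbers, a decidable one if the word problem is decidable. -/
theorem leastWords_bijective :
    Function.Bijective fun k : leastWords K => (mk (wordOf k) : FreeGroup ℕ ⧸ K) := by
  classical
  constructor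
  · rintro ⟨j, hj⟩ ⟨k, hk⟩ h
    rcases lt_trichotomy j k with hjk | rfl | hjk
    · exact absurd h (hk j hjk)
    · rfl
    · exact absurd h.symm (hj k hjk)
  · intro x
    have h : ∃ k, (mk (wordOf k) : FreeGroup ℕ ⧸ K) = x := by
      obtain ⟨w, rfl⟩ := QuotientGroup.mk_surjective x
      obtain ⟨l, rfl⟩ := Quot.exists_rep w
      exact ⟨Encodable.encode l, by rw [wordOf_encode]; rfl⟩
    exact ⟨⟨Nat.find h, fun j hj h' => Nat.find_min h hj (h'.trans (Nat.find_spec h))⟩,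
      Nat.find_spec h⟩

variable [K.Normal]

/-- The bijection between the least words and the quotient. -/
noncomputable def leastWordsEquiv : leastWords K ≃ FreeGroup ℕ ⧸ K :=
  Equiv.ofBijective _ (leastWords_bijective K)

noncomputable instance : Group (leastWords K) := (leastWordsEquiv K).group

/-- The group on the numbers of the least words is isomorphic to the quotient. -/
noncomputable def leastWordsMulEquiv : leastWords K ≃* FreeGroup ℕ ⧸ K :=
  (leastWordsEquiv K).mulEquiv

theorem mk_eq_mk_iff {l l' : Word} :
    (mk l : FreeGroup ℕ ⧸ K) = mk l' ↔ mk (l ++ invRev l') ∈ K := by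
  rw [← FreeGroup.mul_mk, ← FreeGroup.inv_mk, QuotientGroup.eq, ← Subgroup.inv_mem_iff]
  rw [mul_inv_rev, inv_inv]
  exact (inferInstance : K.Normal).mem_comm_iff

theorem leastWords_eval_eq_iff {t s : GroupTerm (leastWords K)} :
    t.eval = s.eval ↔ mk (expand wordOf (termWord t.code) ++
      invRev (expand wordOf (termWord s.code))) ∈ K := by
  have h : ∀ t : GroupTerm (leastWords K), leastWordsMulEquiv K t.eval =
      (mk (expand wordOf (termWord t.code)) : FreeGroup ℕ ⧸ K) := by
    intro t
    rw [mk_expand, ← QuotientGroup.mk'_apply, ← MonoidHom.comp_apply]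
    have := GroupTerm.map_eval (leastWordsMulEquiv K).toMonoidHom
      (fun j => (mk (wordOf j) : FreeGroup ℕ ⧸ K)) (fun x => rfl) t
    refine this.trans ?_
    congr 1
    ext j
    simp
  rw [← mk_eq_mk_iff, ← h, ← h, EmbeddingLike.apply_eq_iff_eq]

/-- The test whether a number is the least number of a word in its coset. -/
def isLeastWord (κ : ℕ × Word → Bool) (x : ℕ × ℕ) : Bool :=
  decide (∀ j < x.2, (fun y : (ℕ × ℕ) × ℕ =>
    !κ (y.1.1, wordOf y.2 ++ invRev (wordOf y.1.2))) (x, j) = true)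

/-- The characteristic function of the atomic diagram. -/
def diagramChar (κ : ℕ × Word → Bool) (x : ℕ × ℕ) : Bool :=
  ((termWord (x.2 / 2).unpair.1 ++ termWord (x.2 / 2).unpair.2).all fun y =>
      isLeastWord κ (x.1, y.1)) &&
    (x.2 % 2 == 0) == κ (x.1, expand wordOf (termWord (x.2 / 2).unpair.1) ++
      invRev (expand wordOf (termWord (x.2 / 2).unpair.2)))

theorem computable_diagramChar {κ : ℕ × Word → Bool} (hκ : Computable κ) :
    Computable (diagramChar κ) := by
  have hl : Computable (isLeastWord κ) :=
    Computable.forall_lt (g := fun y : (ℕ × ℕ) × ℕ =>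
      !κ (y.1.1, wordOf y.2 ++ invRev (wordOf y.1.2))) Computable.snd (by fun_prop)
  have ht : Computable termWord := primrec_termWord.to_comp
  have he : Computable fun l : Word => expand wordOf l :=
    (Primrec.expand_comp (s := fun _ => wordOf)
      (show Primrec fun x : Word × ℕ => wordOf x.2 by fun_prop) Primrec.id).to_comp
  unfold diagramChar
  refine Computable.and_comp (Computable.list_all
    (g := fun z : (ℕ × ℕ) × (ℕ × Bool) => isLeastWord κ (z.1.1, z.2.1))
    (by fun_prop) (by fun_prop)) ?_
  have hm : Computable fun x : ℕ × ℕ => x.2 % 2 := (by fun_prop : Primrec _).to_comp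
  fun_prop

/-- A sentence is in the diagram iff its constants are least words and the word test agrees with its
parity. This is decidable uniformly in `n`, and the s-m-n theorem, in the form of `curry`, turns the
uniform algorithm into an index for each `n`. -/
theorem exists_computable_index {κ : ℕ × Word → Bool} (hκ : Computable κ)
    (K : ℕ → Subgroup (FreeGroup ℕ)) [∀ n, (K n).Normal]
    (h : ∀ n l, κ (n, l) = true ↔ mk l ∈ K n) :
    ∃ f : ℕ → ℕ, Computable f ∧
      ∀ n, IsCharIndex (f n) (atomicDiagram (leastWords (K n))) := by
  have hχ : Computable fun x : ℕ => bif diagramChar κ x.unpair then 1 else 0 := by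
    have := computable_diagramChar hκ
    fun_prop
  obtain ⟨c, hc⟩ := Nat.Partrec.Code.exists_code.1 (Partrec.nat_iff.1 hχ.partrec)
  refine ⟨fun n => Encodable.encode (Nat.Partrec.Code.curry c n),
    (Primrec.encode_comp (Nat.Partrec.Code.primrec₂_curry.comp
      (Primrec.const c) Primrec.id)).to_comp, fun n a => ?_⟩
  have hphi : phi (Encodable.encode (Nat.Partrec.Code.curry c n)) a =
      Part.some (bif diagramChar κ (n, a) then 1 else 0) := by
    rw [phi, Denumerable.ofNat_encode, Nat.Partrec.Code.eval_curry, hc]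
    simp
  have hmem : ∀ k, isLeastWord κ (n, k) = true ↔ k ∈ leastWords (K n) := by
    intro k
    rw [isLeastWord, decide_eq_true_eq]
    refine forall₂_congr fun j _ => ?_
    rw [Ne, mk_eq_mk_iff, ← h]
    simp
  have key : diagramChar κ (n, a) = true ↔ a ∈ atomicDiagram (leastWords (K n)) := by
    rw [mem_atomicDiagram_iff, diagramChar, Bool.and_eq_true, List.all_eq_true, beq_iff_eq,
      Bool.eq_iff_iff, h, beq_iff_eq]
    simp only [hmem, List.mem_append]
    constructor
    · rintro ⟨h1, h2⟩
      obtain ⟨t, ht⟩ := GroupTerm.exists_code_eq _ fun x hx => h1 x (Or.inl hx)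
      obtain ⟨s, hs⟩ := GroupTerm.exists_code_eq _ fun x hx => h1 x (Or.inr hx)
      refine ⟨t, s, ht, hs, ?_⟩
      rw [leastWords_eval_eq_iff, ht, hs, h2]
    · rintro ⟨t, s, ht, hs, h2⟩
      rw [leastWords_eval_eq_iff, ht, hs] at h2
      refine ⟨fun x hx => ?_, h2⟩
      rw [← ht, ← hs] at hx
      exact hx.elim (GroupTerm.mem_of_mem_termWord t x) (GroupTerm.mem_of_mem_termWord s x)
  rw [hphi]
  constructor
  · intro ha
    simp [key.2 ha]
  · intro ha
    have : diagramChar κ (n, a) = false := by rwa [← key, Bool.not_eq_true] at ha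
    simp [this]

end Presentations

/-! ### Finitely generated nilpotent groups -/

section NilpotentGroups

open Subgroup
open scoped commutatorElement

variable {G : Type*} [Group G]

/-- The terms of the lower central series, counted from `0`. -/
abbrev lcs (G : Type*) [Group G] (i : ℕ) : Subgroup G := (⊤ : Subgroup G).lowerCentralSeries i

theorem lcs_map_le {H : Type*} [Group H] (f : G →* H) (i : ℕ) : (lcs G i).map f ≤ lcs H i := by
  rw [Subgroup.map_lowerCentralSeries]
  exact Subgroup.lowerCentralSeries_mono i le_top

theorem map_mem_lcs {H : Type*} [Group H] (f : G →* H) {i : ℕ} {g : G} (hg : g ∈ lcs G i) :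
    f g ∈ lcs H i := lcs_map_le f i (mem_map_of_mem f hg)

theorem commutator_mem_lcs {i : ℕ} {g : G} (hg : g ∈ lcs G i) (h : G) : ⁅g, h⁆ ∈ lcs G (i + 1) :=
  commutator_mem_commutator hg (mem_top h)

/-- Commutation with a fixed element is a homomorphism if its values are central. -/
def commutatorRightHom (a : G) (ha : ∀ b, ⁅a, b⁆ ∈ center G) : G →* G where
  toFun b := ⁅a, b⁆
  map_one' := commutatorElement_one_right a
  map_mul' b c := by
    have h := mem_center_iff.1 (ha c) b
    have h2 : b * ⁅a, c⁆ * b⁻¹ = ⁅a, c⁆ := by rw [h]; group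
    calc ⁅a, b * c⁆ = ⁅a, b⁆ * (b * ⁅a, c⁆ * b⁻¹) := by simp only [commutatorElement_def]; group
      _ = _ := by rw [h2]

/-- Commutation with a fixed element is a homomorphism on a subgroup where its values are
central. -/
def commutatorLeftHom (A : Subgroup G) (b : G) (hA : ∀ a ∈ A, ⁅a, b⁆ ∈ center G) : A →* G where
  toFun a := ⁅(a : G), b⁆
  map_one' := commutatorElement_one_left b
  map_mul' a c := by
    have h := mem_center_iff.1 (hA c c.2) a
    have h' := mem_center_iff.1 (hA c c.2) ⁅(a : G), b⁆
    calc ⁅((a * c : A) : G), b⁆ = a * ⁅(c : G), b⁆ * (a : G)⁻¹ * ⁅(a : G), b⁆ := by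
          simp only [commutatorElement_def, coe_mul]; group
      _ = ⁅(c : G), b⁆ * ⁅(a : G), b⁆ := by rw [h]; group
      _ = _ := h'.symm

theorem mk_mem_center_of_mem_lcs {i : ℕ} {g : G} (hg : g ∈ lcs G i) :
    (g : G ⧸ lcs G (i + 1)) ∈ center (G ⧸ lcs G (i + 1)) := by
  rw [mem_center_iff]
  intro x
  obtain ⟨x, rfl⟩ := QuotientGroup.mk_surjective x
  rw [eq_comm, ← commutatorElement_eq_one_iff_mul_comm, ← QuotientGroup.mk'_apply,
    ← QuotientGroup.mk'_apply, ← map_commutatorElement, QuotientGroup.mk'_apply,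
    QuotientGroup.eq_one_iff]
  exact commutator_mem_lcs hg x

/-- The factors of the lower central series of a finitely generated group are finitely
generated. -/
theorem exists_finite_lcs_le_closure_sup [hG : Group.FG G] (i : ℕ) :
    ∃ T : Set G, T.Finite ∧ T ⊆ lcs G i ∧ lcs G i ≤ closure T ⊔ lcs G (i + 1) := by
  obtain ⟨S, hS, hSf⟩ := Group.fg_iff.1 hG
  induction i with
  | zero => exact ⟨S, hSf, fun _ _ => mem_top _, by rw [hS]; exact le_top.trans le_sup_left⟩
  | succ i ih =>
    obtain ⟨T, hTf, hT, hle⟩ := ih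
    -- Modulo the term after next, commutators of elements of `lcs G i` with elements of `G` are
    -- central, hence multiplicative in each argument, so commutators of generators suffice.
    refine ⟨Set.image2 (fun a b => ⁅a, b⁆) T S, hTf.image2 _ hSf, ?_, ?_⟩
    · rintro _ ⟨a, ha, b, -, rfl⟩
      exact commutator_mem_lcs (hT ha) b
    let π := QuotientGroup.mk' (lcs G (i + 1 + 1))
    let U := closure (Set.image2 (fun a b => ⁅a, b⁆) T S)
    have hcen : ∀ a ∈ lcs G i, ∀ b, ⁅π a, b⁆ ∈ center (G ⧸ lcs G (i + 1 + 1)) := by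
      intro a ha b
      obtain ⟨b, rfl⟩ := QuotientGroup.mk'_surjective _ b
      rw [← map_commutatorElement]
      exact mk_mem_center_of_mem_lcs (commutator_mem_lcs ha b)
    have step1 : ∀ a ∈ T, ∀ b : G, ⁅π a, π b⁆ ∈ U.map π := by
      intro a ha b
      have : closure S ≤ (U.map π).comap
          ((commutatorRightHom (π a) (hcen a (hT ha))).comp π) := by
        rw [closure_le]
        intro b hb
        refine ⟨⁅a, b⁆, subset_closure ⟨a, ha, b, hb, rfl⟩, map_commutatorElement π a b⟩
      rw [hS] at this
      exact this (mem_top b)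
    have step2 : ∀ a ∈ lcs G i, ∀ b : G, ⁅π a, π b⁆ ∈ U.map π := by
      intro a ha b
      let A := (lcs G i).map π
      have hA : ∀ x ∈ A, ⁅x, π b⁆ ∈ center (G ⧸ lcs G (i + 1 + 1)) := by
        rintro _ ⟨x, hx, rfl⟩
        exact hcen x hx _
      -- `M` collects the elements whose image lies in `A` and has its commutator with `π b` in the
      -- image of `U`. It contains `lcs G (i + 1)`, whose commutators vanish under `π`.
      let M := (((U.map π).comap (commutatorLeftHom A (π b) hA)).map A.subtype).comap π
      have hM : closure T ⊔ lcs G (i + 1) ≤ M := by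
        refine sup_le ((closure_le _).2 fun x hx => ?_) fun x hx => ?_
        · exact ⟨⟨π x, mem_map_of_mem π (hT hx)⟩, step1 x hx b, rfl⟩
        · refine ⟨⟨π x, mem_map_of_mem π (Subgroup.lowerCentralSeries_antitone _ (Nat.le_succ i) hx)⟩,
            ?_, rfl⟩
          have : ⁅π x, π b⁆ = 1 := by
            rw [← map_commutatorElement]
            exact (QuotientGroup.eq_one_iff _).2 (commutator_mem_lcs hx b)
          exact mem_comap.2 (this.symm ▸ one_mem (U.map π) :)
      obtain ⟨⟨y, hy⟩, hy1, hy2⟩ := hM (hle ha)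
      change y = π a at hy2
      subst hy2
      exact hy1
    refine commutator_le.2 fun a ha b _ => ?_
    have := step2 a ha b
    rw [← map_commutatorElement, ← mem_comap, comap_map_eq, QuotientGroup.ker_mk'] at this
    exact this

/-- Subgroups of finitely generated commutative subgroups are finitely generated. -/
theorem fg_of_le_of_fg_of_comm {A L : Subgroup G} (hA : A.FG)
    (hcomm : ∀ x ∈ A, ∀ y ∈ A, x * y = y * x) (hL : L ≤ A) : L.FG := by
  -- Written additively, `A` becomes a finitely generated module over the noetherian ring `ℤ`.
  let _ : CommGroup A :=
    { (inferInstance : Group A) with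
      mul_comm := fun x y => Subtype.ext (hcomm x x.2 y y.2) }
  have : Group.FG A := (Group.fg_iff_subgroup_fg A).2 hA
  have : Module.Finite ℤ (Additive A) := Module.Finite.iff_addGroup_fg.2 inferInstance
  have h1 : (AddSubgroup.toIntSubmodule (Subgroup.toAddSubgroup (L.subgroupOf A))).FG :=
    IsNoetherian.noetherian _
  have h2 : (L.subgroupOf A).FG :=
    (Subgroup.fg_iff_add_fg _).2 ((Submodule.fg_iff_addSubgroup_fg _).1 h1)
  obtain ⟨S, hS, hSf⟩ := (Subgroup.fg_iff _).1 h2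
  have h3 : ((L.subgroupOf A).map A.subtype).FG :=
    (Subgroup.fg_iff _).2 ⟨A.subtype '' S, by rw [← MonoidHom.map_closure, hS], hSf.image _⟩
  rwa [subgroupOf_map_subtype, inf_eq_left.2 hL] at h3

theorem lcs_map_mk_comm (i : ℕ) :
    ∀ x ∈ (lcs G i).map (QuotientGroup.mk' (lcs G (i + 1))),
      ∀ y ∈ (lcs G i).map (QuotientGroup.mk' (lcs G (i + 1))), x * y = y * x := by
  rintro x - _ ⟨y, hy, rfl⟩
  exact mem_center_iff.1 (mk_mem_center_of_mem_lcs hy) x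

theorem fg_lcs_map_mk [Group.FG G] (i : ℕ) :
    ((lcs G i).map (QuotientGroup.mk' (lcs G (i + 1)))).FG := by
  obtain ⟨T, hTf, hT, hle⟩ := exists_finite_lcs_le_closure_sup (G := G) i
  rw [Subgroup.fg_iff]
  refine ⟨QuotientGroup.mk' (lcs G (i + 1)) '' T, ?_, hTf.image _⟩
  rw [← MonoidHom.map_closure]
  refine le_antisymm (map_mono ((closure_le _).2 hT)) ?_
  refine (map_mono hle).trans ?_
  rw [Subgroup.map_sup, sup_le_iff]
  refine ⟨le_rfl, ?_⟩
  rw [QuotientGroup.map_mk'_self]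
  exact bot_le

/-- Every subgroup of a finitely generated nilpotent group is finitely generated. -/
theorem fg_of_isNilpotent [Group.FG G] {c : ℕ} (hc : lcs G c = ⊥) (L : Subgroup G) : L.FG := by
  -- Descending induction along the lower central series; `d` counts the terms left before the
  -- trivial one.
  have key : ∀ d i, i + d = c → ∀ L : Subgroup G, L ≤ lcs G i → L.FG := by
    intro d
    induction d with
    | zero =>
      rintro i rfl L hL
      rw [Nat.add_zero] at hc
      rw [le_bot_iff.1 (hL.trans_eq hc)]
      exact Subgroup.FG.bot
    | succ d ih =>
      intro i hi L hL
      let π := QuotientGroup.mk' (lcs G (i + 1))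
      have h1 : (L.map π).FG :=
        fg_of_le_of_fg_of_comm (fg_lcs_map_mk i) (lcs_map_mk_comm i) (map_mono hL)
      have h2 : (L ⊓ lcs G (i + 1)).FG := ih (i + 1) (by omega) _ inf_le_right
      obtain ⟨S, hS, hSf⟩ := (Subgroup.fg_iff _).1 h1
      have h3 : S ⊆ π '' L := by
        rw [← coe_map, ← hS]; exact subset_closure
      obtain ⟨T, hT, hTf, rfl⟩ : ∃ T ⊆ (L : Set G), T.Finite ∧ S = π '' T :=
        Set.exists_subset_image_finite_and.1 ⟨S, h3, hSf, rfl⟩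
      -- `L` is generated by lifts of generators of its image in the commutative factor, together
      -- with its part in the next term.
      have h4 : L = closure T ⊔ (L ⊓ lcs G (i + 1)) := by
        refine le_antisymm (fun x hx => ?_) (sup_le ((closure_le _).2 hT) inf_le_left)
        have : π x ∈ (closure T).map π := by
          rw [MonoidHom.map_closure, hS]; exact mem_map_of_mem π hx
        obtain ⟨s, hs, hsx⟩ := this
        have hs' : s ∈ L := (closure_le _).2 hT hs
        have : s⁻¹ * x ∈ L ⊓ lcs G (i + 1) :=
          ⟨L.mul_mem (L.inv_mem hs') hx, QuotientGroup.eq.1 hsx⟩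
        rw [show x = s * (s⁻¹ * x) by group]
        exact mul_mem_sup hs this
      rw [h4]
      exact Subgroup.FG.sup ((Subgroup.fg_iff _).2 ⟨T, rfl, hTf⟩) h2
  exact key c 0 (by omega) L (by simp)

/-- The torsion of a finitely generated commutative subgroup has a finite exponent. -/
theorem exists_torsion_exponent {A : Subgroup G} (hA : A.FG)
    (hcomm : ∀ x ∈ A, ∀ y ∈ A, x * y = y * x) :
    ∃ E, 0 < E ∧ ∀ a ∈ A, ∀ n, 0 < n → a ^ n = 1 → a ^ E = 1 := by
  -- The torsion elements form a subgroup of a finitely generated commutative group, so they have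
  -- finitely many generators; the product of the orders of these is an exponent.
  let T : Subgroup G :=
    { carrier := {a | a ∈ A ∧ IsOfFinOrder a}
      one_mem' := ⟨A.one_mem, IsOfFinOrder.one⟩
      mul_mem' := fun ha hb => ⟨A.mul_mem ha.1 hb.1,
        (show Commute _ _ from hcomm _ ha.1 _ hb.1).isOfFinOrder_mul ha.2 hb.2⟩
      inv_mem' := fun {x} ha => ⟨A.inv_mem ha.1, ha.2.inv⟩ }
  have hT : T.FG := fg_of_le_of_fg_of_comm hA hcomm fun _ h => h.1
  obtain ⟨S, hS⟩ := hT
  have hST : ∀ x ∈ S, x ∈ T := fun x hx => hS ▸ subset_closure hx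
  refine ⟨∏ x ∈ S, orderOf x, Finset.prod_pos fun x hx => (hST x hx).2.orderOf_pos, ?_⟩
  intro a ha n hn han
  have : a ∈ closure (S : Set G) := by
    rw [hS]; exact ⟨ha, isOfFinOrder_iff_pow_eq_one.2 ⟨n, hn, han⟩⟩
  clear ha han
  have key : a ∈ A ∧ a ^ (∏ x ∈ S, orderOf x) = 1 := by
    induction this using closure_induction with
    | mem x hx =>
      exact ⟨(hST x hx).1, orderOf_dvd_iff_pow_eq_one.1 (Finset.dvd_prod_of_mem _ hx)⟩
    | one => exact ⟨one_mem _, one_pow _⟩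
    | mul x y _ _ hx hy =>
      have hxy : Commute x y := hcomm _ hx.1 _ hy.1
      exact ⟨mul_mem hx.1 hy.1, by rw [hxy.mul_pow, hx.2, hy.2, one_mul]⟩
    | inv x _ hx => exact ⟨inv_mem hx.1, by rw [inv_pow, hx.2, inv_one]⟩
  exact key.2

/-- In a nilpotent group, iterated commutators lead from every nontrivial element to a nontrivial
central one. -/
theorem exists_foldl_commutator_mem_center {n : ℕ} :
    ∀ x ∈ Subgroup.upperCentralSeries G n, x ≠ 1 →
      ∃ gs : List G, gs.foldl (fun y g => ⁅y, g⁆) x ∈ center G ∧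
        gs.foldl (fun y g => ⁅y, g⁆) x ≠ 1 := by
  induction n with
  | zero => exact fun x hx hx1 => absurd (mem_bot.1 hx) hx1
  | succ n ih =>
    intro x hx hx1
    by_cases hc : x ∈ center G
    · exact ⟨[], hc, hx1⟩
    · rw [mem_center_iff] at hc
      push Not at hc
      obtain ⟨g, hg⟩ := hc
      obtain ⟨gs, h1, h2⟩ := ih ⁅x, g⁆ (Subgroup.mem_upperCentralSeries_succ_iff.1 hx g)
        (fun h => hg (commutatorElement_eq_one_iff_mul_comm.1 h).symm)
      exact ⟨g :: gs, h1, h2⟩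

/-- If the center has a finite exponent, then so have the terms of the upper central series. -/
theorem pow_eq_one_of_mem_upperCentralSeries {E : ℕ} (hE : ∀ z ∈ center G, z ^ E = 1) (n : ℕ) :
    ∀ x ∈ Subgroup.upperCentralSeries G (n + 1), x ^ E ∈ Subgroup.upperCentralSeries G n := by
  induction n with
  | zero =>
    intro x hx
    rw [zero_add, Subgroup.upperCentralSeries_one] at hx
    exact mem_bot.2 (hE x hx)
  | succ n ih =>
    intro x hx
    rw [Subgroup.mem_upperCentralSeries_succ_iff]
    intro y
    let π := QuotientGroup.mk' (Subgroup.upperCentralSeries G n)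
    have hc : ∀ a ∈ (Subgroup.upperCentralSeries G (n + 1 + 1)).map π, ⁅a, π y⁆ ∈
        center (G ⧸ Subgroup.upperCentralSeries G n) := by
      rintro _ ⟨a, ha, rfl⟩
      rw [mem_center_iff]
      intro z
      obtain ⟨z, rfl⟩ := QuotientGroup.mk'_surjective _ z
      have := Subgroup.mem_upperCentralSeries_succ_iff.1 (Subgroup.mem_upperCentralSeries_succ_iff.1 ha y) z
      rw [← QuotientGroup.eq_one_iff, ← QuotientGroup.mk'_apply, map_commutatorElement,
        map_commutatorElement, commutatorElement_eq_one_iff_mul_comm] at this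
      exact this.symm
    -- Modulo the `n`-th term, commutation with `y` is a homomorphism here. Hence `⁅x ^ E, y⁆`
    -- agrees with `⁅x, y⁆ ^ E`, which is trivial by induction.
    have h1 := map_pow (commutatorLeftHom _ (π y) hc) ⟨π x, mem_map_of_mem π hx⟩ E
    have h2 := ih _ (Subgroup.mem_upperCentralSeries_succ_iff.1 hx y)
    change ⁅π x ^ E, π y⁆ = ⁅π x, π y⁆ ^ E at h1
    rw [← map_commutatorElement, ← map_pow, ← map_pow, ← map_commutatorElement] at h1
    have h3 : π (⁅x, y⁆ ^ E) = 1 := (QuotientGroup.eq_one_iff _).2 h2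
    rw [h3] at h1
    exact (QuotientGroup.eq_one_iff _).1 h1

/-- A finitely generated nilpotent group with an element of infinite order has a central element
of infinite order. -/
theorem exists_mem_center_not_isOfFinOrder [Group.FG G] {c : ℕ} (hc : lcs G c = ⊥) {x : G}
    (hx : ¬ IsOfFinOrder x) : ∃ z ∈ center G, ¬ IsOfFinOrder z := by
  by_contra! h
  obtain ⟨E, hE0, hE⟩ := exists_torsion_exponent (A := center G) (fg_of_isNilpotent hc _)
    fun a _ b hb => mem_center_iff.1 hb a
  have hE' : ∀ z ∈ center G, z ^ E = 1 := fun z hz => by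
    obtain ⟨n, hn, hzn⟩ := isOfFinOrder_iff_pow_eq_one.1 (h z hz)
    exact hE z hz n hn hzn
  -- If the center were torsion, its finite exponent `E` would push `y ^ E` one term down the upper
  -- central series each time, and the whole group would be torsion.
  have key : ∀ n, ∀ y ∈ Subgroup.upperCentralSeries G n, IsOfFinOrder y := by
    intro n
    induction n with
    | zero => intro y hy; rw [mem_bot.1 hy]; exact IsOfFinOrder.one
    | succ n ih =>
      intro y hy
      exact (ih _ (pow_eq_one_of_mem_upperCentralSeries hE' n y hy)).of_pow hE0.ne'
  refine hx (key c x ?_)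
  rw [(Subgroup.lowerCentralSeries_eq_bot_iff_upperCentralSeries_eq_top).1 hc]
  exact mem_top x

/-- An endomorphism that acts as the `k`-th power on the abelianization acts as an iterated `k`-th
power on the factors of the lower central series. -/
theorem mk_map_eq_pow_of_mem_lcs {θ : G →* G} {k : ℕ}
    (hθ : ∀ g, (g ^ k)⁻¹ * θ g ∈ lcs G 1) (i : ℕ) :
    ∀ g ∈ lcs G i, (θ g : G ⧸ lcs G (i + 1)) = (g : G ⧸ lcs G (i + 1)) ^ k ^ (i + 1) := by
  induction i with
  | zero =>
    intro g _
    rw [zero_add, pow_one, ← QuotientGroup.mk_pow]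
    exact (QuotientGroup.eq.2 (hθ g)).symm
  | succ i ih =>
    let π := QuotientGroup.mk' (lcs G (i + 1 + 1))
    let K := k ^ (i + 1)
    have hcen : ∀ a ∈ lcs G i, ∀ b, ⁅π a, b⁆ ∈ center (G ⧸ lcs G (i + 1 + 1)) := by
      intro a ha b
      obtain ⟨b, rfl⟩ := QuotientGroup.mk'_surjective _ b
      rw [← map_commutatorElement]
      exact mk_mem_center_of_mem_lcs (commutator_mem_lcs ha b)
    have key : ∀ a ∈ lcs G i, ∀ b, π (θ ⁅a, b⁆) = π ⁅a, b⁆ ^ k ^ (i + 1 + 1) := by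
      intro a ha b
      have ha' : a ^ K ∈ lcs G i := pow_mem ha K
      have h1 : (a ^ K)⁻¹ * θ a ∈ lcs G (i + 1) := by
        rw [← QuotientGroup.eq, QuotientGroup.mk_pow]
        exact (ih a ha).symm
      obtain ⟨u, hu⟩ : ∃ u, u = (a ^ K)⁻¹ * θ a := ⟨_, rfl⟩
      obtain ⟨v, hv⟩ : ∃ v, v = (b ^ k)⁻¹ * θ b := ⟨_, rfl⟩
      have ha1 : θ a = a ^ K * u := by rw [hu]; group
      have hb1 : θ b = b ^ k * v := by rw [hv]; group
      have hu1 : π u ∈ center _ := mk_mem_center_of_mem_lcs (hu ▸ h1)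
      -- The error `u` of the first argument is central modulo the next term and drops out.
      have e1 : ⁅π (θ a), π (θ b)⁆ = ⁅π (a ^ K), π (θ b)⁆ := by
        rw [ha1, map_mul]
        have := mem_center_iff.1 hu1 (π (θ b))
        have h2 : π u * π (θ b) * (π u)⁻¹ = π (θ b) := by rw [← this]; group
        calc ⁅π (a ^ K) * π u, π (θ b)⁆ =
              π (a ^ K) * (π u * π (θ b) * (π u)⁻¹) * (π (a ^ K))⁻¹ * (π (θ b))⁻¹ := by
              simp only [commutatorElement_def]; group
          _ = _ := by rw [h2]; rfl
      -- The error `v` of the second argument is a product of commutators, and a homomorphism with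
      -- central values kills those.
      have e2 : ⁅π (a ^ K), π v⁆ = 1 := by
        let f := (commutatorRightHom (π (a ^ K)) (hcen _ ha')).comp π
        have : commutator G ≤ f.ker := by
          rw [commutator_def, commutator_le]
          intro x _ y _
          rw [MonoidHom.mem_ker, map_commutatorElement, commutatorElement_eq_one_iff_mul_comm]
          exact (mem_center_iff.1 (hcen _ ha' (π x)) _).symm
        exact this (hv ▸ hθ b)
      have e3 : ⁅π (a ^ K), π (θ b)⁆ = ⁅π (a ^ K), π b⁆ ^ k := by
        have h1 := map_mul (commutatorRightHom (π (a ^ K)) (hcen _ ha')) (π (b ^ k)) (π v)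
        have h2 := map_pow (commutatorRightHom (π (a ^ K)) (hcen _ ha')) (π b) k
        change ⁅π (a ^ K), π (b ^ k) * π v⁆ = ⁅π (a ^ K), π (b ^ k)⁆ * ⁅π (a ^ K), π v⁆ at h1
        change ⁅π (a ^ K), π b ^ k⁆ = ⁅π (a ^ K), π b⁆ ^ k at h2
        rw [hb1, map_mul, h1, e2, mul_one, map_pow π b, h2]
      have e4 : ⁅π (a ^ K), π b⁆ = ⁅π a, π b⁆ ^ K := by
        have hA : ∀ x ∈ (lcs G i).map π, ⁅x, π b⁆ ∈ center (G ⧸ lcs G (i + 1 + 1)) := by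
          rintro _ ⟨x, hx, rfl⟩
          exact hcen x hx _
        have := map_pow (commutatorLeftHom _ (π b) hA) ⟨π a, mem_map_of_mem π ha⟩ K
        rw [map_pow]
        exact this
      rw [map_commutatorElement, map_commutatorElement, e1, e3, e4, map_commutatorElement,
        ← pow_mul, pow_succ k (i + 1)]
    intro g hg
    -- Elements of `lcs G (i + 1)` are central modulo the next term, so powers are multiplicative
    -- there and the claim need only be checked on the generating commutators.
    have hpow : ∀ x y : G, x ∈ lcs G (i + 1) →
        (π (x * y)) ^ k ^ (i + 1 + 1) = π x ^ k ^ (i + 1 + 1) * π y ^ k ^ (i + 1 + 1) := by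
      intro x y hx
      rw [map_mul]
      exact Commute.mul_pow (mem_center_iff.1 (mk_mem_center_of_mem_lcs hx) (π y)).symm _
    change π (θ g) = π g ^ k ^ (i + 1 + 1)
    have hg' : g ∈ closure {x | ∃ a ∈ lcs G i, ∃ b ∈ (⊤ : Subgroup G), ⁅a, b⁆ = x} := hg
    have : closure {x | ∃ a ∈ lcs G i, ∃ b ∈ (⊤ : Subgroup G), ⁅a, b⁆ = x} ≤ lcs G (i + 1) :=
      le_rfl
    induction hg' using closure_induction with
    | mem x hx =>
      obtain ⟨a, ha, b, -, rfl⟩ := hx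
      exact key a ha b
    | one => rw [map_one, map_one, one_pow]
    | mul x y hx hy ihx ihy =>
      rw [map_mul, map_mul, ihx (this hx), ihy (this hy), hpow x y (this hx)]
    | inv x hx ihx => rw [map_inv, map_inv, ihx (this hx), map_inv, inv_pow]

/-- A finitely generated nilpotent group has an exponent `E` such that every endomorphism that acts
on the abelianization as the `k`-th power with `k ≡ 1` modulo `E` is injective. -/
theorem exists_forall_injective [Group.FG G] {c : ℕ} (hc : lcs G c = ⊥) :
    ∃ E, 0 < E ∧ ∀ (θ : G →* G) (j : ℕ), (∀ g, (g ^ (E * j + 1))⁻¹ * θ g ∈ lcs G 1) →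
      Function.Injective θ := by
  have h := fun i => exists_torsion_exponent (fg_lcs_map_mk (G := G) i) (lcs_map_mk_comm i)
  choose E hE0 hE using h
  refine ⟨∏ i ∈ Finset.range c, E i, Finset.prod_pos fun i _ => hE0 i, fun θ j hθ => ?_⟩
  rw [injective_iff_map_eq_one]
  intro g hg
  -- An element `g` of the kernel descends through the series. Its class `a` in the factor satisfies
  -- `a ^ k ^ (i + 1) = 1`, so it is torsion and `a ^ E i = 1`; as `k` is `1` modulo `E i`, that
  -- same power is `a` itself. Torsion-freeness of the factors is not needed.
  have key : ∀ i, i ≤ c → g ∈ lcs G i := by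
    intro i
    induction i with
    | zero => exact fun _ => mem_top g
    | succ i ih =>
      intro hi
      have hgi := ih (by omega)
      have h1 := mk_map_eq_pow_of_mem_lcs hθ i g hgi
      rw [hg, QuotientGroup.mk_one] at h1
      set a : G ⧸ lcs G (i + 1) := (g : G ⧸ lcs G (i + 1)) with ha
      have h2 : a ^ E i = 1 := hE i a (mem_map_of_mem _ hgi) _ (by positivity) h1.symm
      have h3 : E i ∣ (∏ i ∈ Finset.range c, E i) * j :=
        (Finset.dvd_prod_of_mem _ (Finset.mem_range.2 (by omega))).mul_right j
      have h4 : ∀ r, a ^ ((∏ i ∈ Finset.range c, E i) * j + 1) ^ r = a := by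
        intro r
        have : (((∏ i ∈ Finset.range c, E i) * j + 1) ^ r) ≡ 1 [MOD E i] := by
          have : ((∏ i ∈ Finset.range c, E i) * j + 1) ≡ 0 + 1 [MOD E i] :=
            Nat.ModEq.add_right 1 ((Nat.modEq_zero_iff_dvd).2 h3)
          simpa using this.pow r
        have h5 := pow_eq_pow_of_modEq this h2
        rwa [pow_one] at h5
      rw [h4] at h1
      exact (QuotientGroup.eq_one_iff g).1 h1.symm
  have := key c le_rfl
  rwa [hc, mem_bot] at this

end NilpotentGroups

/-! ### The word problem of a free nilpotent group -/

section WordProblem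

open Subgroup
open FreeGroup (mk invRev)
open scoped commutatorElement

/-- An enumeration of words for the elements of the terms of the lower central series. -/
def lcsWord : ℕ → ℕ → Word
  | 0, k => wordOf k
  | i + 1, k => expand (fun j => lcsWord i j.unpair.1 ++ wordOf j.unpair.2 ++
      invRev (lcsWord i j.unpair.1) ++ invRev (wordOf j.unpair.2)) (wordOf k)

theorem primrec_lcsWord (i : ℕ) : Primrec (lcsWord i) := by
  induction i with
  | zero => exact Primrec.wordOf_comp Primrec.id
  | succ i ih =>
    exact Primrec.expand_comp (s := fun _ j => lcsWord i j.unpair.1 ++ wordOf j.unpair.2 ++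
      invRev (lcsWord i j.unpair.1) ++ invRev (wordOf j.unpair.2)) (by fun_prop)
      (Primrec.wordOf_comp Primrec.id)

theorem exists_mk_wordOf (w : FreeGroup ℕ) : ∃ k, mk (wordOf k) = w := by
  obtain ⟨l, rfl⟩ := Quot.exists_rep w
  exact ⟨Encodable.encode l, by rw [wordOf_encode]; rfl⟩

/-- Sending letter `j` to the commutator of the two elements numbered by `j.unpair` meets every
generating commutator, so the image of this endomorphism of the free group is the next term of the
series. -/
theorem mem_lcs_iff_exists_lcsWord (i : ℕ) (w : FreeGroup ℕ) :
    w ∈ lcs (FreeGroup ℕ) i ↔ ∃ k, mk (lcsWord i k) = w := by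
  induction i generalizing w with
  | zero => exact ⟨fun _ => exists_mk_wordOf w, fun _ => mem_top w⟩
  | succ i ih =>
    have h1 : ∀ k, mk (lcsWord (i + 1) k) = FreeGroup.lift
        (fun j : ℕ => ⁅mk (lcsWord i j.unpair.1), mk (wordOf j.unpair.2)⁆) (mk (wordOf k)) := by
      intro k
      rw [lcsWord, mk_expand]
      simp only [commutatorElement_def, FreeGroup.inv_mk, FreeGroup.mul_mk]
    have h2 : lcs (FreeGroup ℕ) (i + 1) = (FreeGroup.lift
        (fun j : ℕ => ⁅mk (lcsWord i j.unpair.1), mk (wordOf j.unpair.2)⁆)).range := by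
      rw [FreeGroup.range_lift_eq_closure]
      change Subgroup.closure _ = _
      congr 1
      ext x
      constructor
      · rintro ⟨a, ha, b, -, rfl⟩
        obtain ⟨k, rfl⟩ := (ih a).1 ha
        obtain ⟨k', rfl⟩ := exists_mk_wordOf b
        exact ⟨Nat.pair k k', by simp⟩
      · rintro ⟨j, rfl⟩
        exact ⟨_, (ih _).2 ⟨_, rfl⟩, _, mem_top _, rfl⟩
    rw [h2]
    simp only [h1]
    constructor
    · rintro ⟨v, rfl⟩
      obtain ⟨k, rfl⟩ := exists_mk_wordOf v
      exact ⟨k, rfl⟩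
    · rintro ⟨k, rfl⟩
      exact ⟨_, rfl⟩

variable (p m : ℕ)

/-- The evaluation of words in a free nilpotent group; letters beyond the rank are trivial. -/
def evalN : FreeGroup ℕ →* FreeNilpotentGroup p m :=
  FreeGroup.lift fun j => if h : j < m then QuotientGroup.mk (FreeGroup.of ⟨j, h⟩) else 1

theorem evalN_of (i : Fin m) : evalN p m (FreeGroup.of (i : ℕ)) = QuotientGroup.mk (FreeGroup.of i) := by
  simp [evalN]

theorem evalN_of_le {j : ℕ} (h : m ≤ j) : evalN p m (FreeGroup.of j) = 1 := by
  simp [evalN, h]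

theorem evalN_comp_map_val :
    (evalN p m).comp (FreeGroup.map Fin.val) = QuotientGroup.mk' _ := by
  ext i
  simp [evalN_of]

theorem evalN_surjective : Function.Surjective (evalN p m) := by
  intro x
  obtain ⟨w, rfl⟩ := QuotientGroup.mk'_surjective _ x
  exact ⟨_, DFunLike.congr_fun (evalN_comp_map_val p m) w⟩

theorem exists_evalN_mk (x : FreeNilpotentGroup p m) : ∃ l : Word, evalN p m (mk l) = x := by
  obtain ⟨w, rfl⟩ := evalN_surjective p m x
  obtain ⟨k, rfl⟩ := exists_mk_wordOf w
  exact ⟨_, rfl⟩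

theorem lcs_freeNilpotentGroup : lcs (FreeNilpotentGroup p m) p = ⊥ := by
  have h := map_lowerCentralSeries (⊤ : Subgroup (FreeGroup (Fin m)))
    (QuotientGroup.mk' (lcs (FreeGroup (Fin m)) p)) p
  rw [map_top_of_surjective _ (QuotientGroup.mk'_surjective _), QuotientGroup.map_mk'_self] at h
  exact h.symm

instance : Group.FG (FreeNilpotentGroup p m) := QuotientGroup.fg _

/-- The word obtained by deleting the letters beyond the rank. -/
def restrictWord (l : Word) : Word := expand (fun j => bif decide (j < m) then [(j, true)] else []) l

theorem primrec_restrictWord : Primrec (restrictWord m) := by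
  have h : Primrec fun x : Word × ℕ => decide (x.2 < m) :=
    Primrec.blt_comp (by fun_prop) (by fun_prop)
  exact Primrec.expand_comp (s := fun _ j => bif decide (j < m) then [(j, true)] else [])
    (by fun_prop) Primrec.id

/-- `FreeGroup (Fin m)` is a retract of the free group on `ℕ`. Inclusion and retraction both respect
the lower central series, so triviality can be tested in the larger group. -/
theorem evalN_eq_one_iff {l : Word} :
    evalN p m (mk l) = 1 ↔ mk (restrictWord m l) ∈ lcs (FreeGroup ℕ) p := by
  let ρ : FreeGroup ℕ →* FreeGroup (Fin m) :=
    FreeGroup.lift fun j => if h : j < m then FreeGroup.of ⟨j, h⟩ else 1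
  have h1 : evalN p m = (QuotientGroup.mk' _).comp ρ := by
    ext j
    by_cases h : j < m <;> simp [evalN, ρ, h]
  have h2 : mk (restrictWord m l) = FreeGroup.map Fin.val (ρ (mk l)) := by
    rw [restrictWord, mk_expand, ← MonoidHom.comp_apply]
    congr 1
    ext j
    by_cases h : j < m
    · simp [ρ, h, FreeGroup.of]
    · simp [ρ, h, ← FreeGroup.one_eq_mk]
  have h3 : ρ.comp (FreeGroup.map Fin.val) = MonoidHom.id _ := by
    ext i
    simp [ρ]
  have h4 : ρ (mk (restrictWord m l)) = ρ (mk l) := by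
    rw [h2]
    exact DFunLike.congr_fun h3 (ρ (mk l))
  rw [h1, MonoidHom.comp_apply, QuotientGroup.mk'_apply, QuotientGroup.eq_one_iff]
  constructor
  · intro h
    rw [h2]
    exact map_mem_lcs _ h
  · intro h
    rw [← h4]
    exact map_mem_lcs _ h

theorem rePred_evalN_eq_one : REPred fun l : Word => evalN p m (mk l) = 1 := by
  have h1 : Primrec fun x : Word × ℕ => freeEq (lcsWord p x.2) (restrictWord m x.1) :=
    Primrec.freeEq_comp ((primrec_lcsWord p).comp Primrec.snd)
      ((primrec_restrictWord m).comp Primrec.fst)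
  refine (REPred.of_bool h1.to_comp).exists_comp.of_eq fun l => ?_
  simp only [freeEq_iff, evalN_eq_one_iff, mem_lcs_iff_exists_lcsWord]

theorem exists_expSum_eq (n : ℕ) (a : Fin n → ℤ) :
    ∃ w : FreeGroup ℕ, ∀ i : Fin n, expSum i w = Multiplicative.ofAdd (a i) := by
  refine ⟨(List.ofFn fun i : Fin n => FreeGroup.of (i : ℕ) ^ a i).prod, fun i => ?_⟩
  rw [map_list_prod, List.map_ofFn, List.prod_ofFn, Finset.prod_eq_single i]
  · simp [expSum, ← ofAdd_zsmul]
  · intro j _ hj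
    simp [expSum, Fin.val_inj, hj]
  · simp

/-- The nontrivial central elements of a free nilpotent group are the values of a recursively
enumerable set of words. -/
theorem exists_rePred_center : ∃ V : Word → Prop, REPred V ∧
    ∀ x : FreeNilpotentGroup p m,
      (x ∈ center (FreeNilpotentGroup p m) ∧ x ≠ 1) ↔ ∃ v, V v ∧ evalN p m (mk v) = x := by
  classical
  let _ : CommGroup (center (FreeNilpotentGroup p m)) :=
    { (inferInstance : Group (center (FreeNilpotentGroup p m))) with
      mul_comm := fun a b => Subtype.ext (mem_center_iff.1 b.2 a) }
  have hfg : Group.FG (center (FreeNilpotentGroup p m)) :=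
    (Group.fg_iff_subgroup_fg _).2 (fg_of_isNilpotent (lcs_freeNilpotentGroup p m) _)
  -- The center is a finitely generated commutative group, hence `ℤ ^ j` times a finite group.
  obtain ⟨ι, j, _, _, q, hq, e, ⟨f⟩⟩ :=
    CommGroup.equiv_free_prod_prod_multiplicative_zmod (center (FreeNilpotentGroup p m))
  have : ∀ i, NeZero (q i ^ e i) := fun i => ⟨pow_ne_zero _ (hq i).ne_zero⟩
  let T := (i : ι) → Multiplicative (ZMod (q i ^ e i))
  have : Fintype T := Fintype.ofFinite _
  obtain ⟨n, ⟨r⟩⟩ : ∃ n, Nonempty (j ≃ Fin n) := ⟨_, ⟨Fintype.equivFin j⟩⟩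
  choose wd hwd using exists_evalN_mk p m
  let s : Fin n → Word := fun i => wd (f.symm (Pi.mulSingle (r.symm i) (Multiplicative.ofAdd 1), 1))
  let S : List Word := List.ofFn s
  -- A finite table: one word for every element of the torsion part, flagged when the element is
  -- nontrivial.
  let tl : List (Word × Bool) := (Finset.univ : Finset T).toList.map
    fun t => (wd (f.symm (1, t)), decide (t ≠ 1))
  let E : FreeGroup ℕ →* (j → Multiplicative ℤ) := MonoidHom.pi fun i => expSum (r i)
  have hS : ∀ l : Word, evalN p m (mk (substList S l)) =
      (f.symm (E (mk l), 1) : FreeNilpotentGroup p m) := by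
    intro l
    rw [substList, hom_mk_expand]
    have : FreeGroup.lift (fun i => evalN p m (mk (S.getD i []))) =
        ((center (FreeNilpotentGroup p m)).subtype.comp f.symm.toMonoidHom).comp
          ((MonoidHom.inl _ _).comp E) := by
      ext i
      by_cases hi : i < n
      · have h1 : S.getD i [] = s ⟨i, hi⟩ := by simp [S, hi]
        have h2 : E (FreeGroup.of i) = Pi.mulSingle (r.symm ⟨i, hi⟩) (Multiplicative.ofAdd 1) := by
          ext b
          have : i = (r b : ℕ) ↔ b = r.symm ⟨i, hi⟩ := by
            rw [Equiv.eq_symm_apply, Fin.ext_iff, eq_comm]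
          by_cases hb : i = (r b : ℕ)
          · rw [this.1 hb]; simp [E, expSum]
          · simp [E, expSum, hb, ← this]
        simp [-List.getD_eq_getElem?_getD, h1, h2, s, hwd]
      · have h1 : S.getD i [] = [] := by simp [S, hi]
        have h2 : E (FreeGroup.of i) = 1 := by
          ext b
          have : i ≠ (r b : ℕ) := fun h => hi (h ▸ (r b).2)
          simp [E, expSum, this]
        simp [-List.getD_eq_getElem?_getD, h1, h2, ← FreeGroup.one_eq_mk, ← Prod.one_eq_mk]
    exact DFunLike.congr_fun this (mk l)
  have hE : ∀ l : Word, E (mk l) ≠ 1 ↔ ∃ i ∈ List.range n, dvdExpSum 0 i l = false := by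
    intro l
    rw [Ne, funext_iff, not_forall]
    have h1 : ∀ i, E (mk l) i ≠ 1 ↔ dvdExpSum 0 (r i) l = false := by
      intro i
      rw [← Bool.not_eq_true, dvdExpSum_iff, Nat.cast_zero, zero_dvd_iff]
      rfl
    constructor
    · rintro ⟨i, hi⟩
      exact ⟨r i, List.mem_range.2 (r i).2, (h1 i).1 hi⟩
    · rintro ⟨i, hi, h⟩
      refine ⟨r.symm ⟨i, List.mem_range.1 hi⟩, (h1 _).2 ?_⟩
      simpa using h
  -- A central element is given by a word `l` whose exponent sums are its integer coordinates and by
  -- an entry of the table. It is nontrivial iff the flag is set or some exponent sum below `n` is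
  -- nonzero.
  refine ⟨fun v => ∃ l : Word, ∃ t : Word × Bool, (tl.contains t && (v == substList S l ++ t.1) &&
    (t.2 || !((List.range n).all fun i => dvdExpSum 0 i l))) = true, ?_, fun x => ?_⟩
  · have h1 : Primrec fun z : (Word × Word) × (Word × Bool) => tl.contains z.2 := by
      have : PrimrecRel fun (l : List (Word × Bool)) b => ∃ a ∈ l, a = b :=
        PrimrecRel.exists_mem_list (R := fun (a : Word × Bool) b => a = b) Primrec.eq
      refine (this.comp (Primrec.const tl) Primrec.snd).decide.of_eq fun z => ?_
      rw [Bool.eq_iff_iff]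
      simp
    have h2 : Primrec fun z : (Word × Word) × (Word × Bool) =>
        (List.range n).all fun i => dvdExpSum 0 i z.1.2 :=
      Primrec.list_all (g := fun (z : (Word × Word) × (Word × Bool)) i => dvdExpSum 0 i z.1.2)
        (by fun_prop) (by fun_prop)
    exact (REPred.of_bool (f := fun z : (Word × Word) × (Word × Bool) =>
      (tl.contains z.2 && (z.1.1 == substList S z.1.2 ++ z.2.1) &&
        (z.2.2 || !((List.range n).all fun i => dvdExpSum 0 i z.1.2))))
      (by fun_prop : Primrec _).to_comp).exists_comp.exists_comp
  · have hval : ∀ (l : Word) (t : T), evalN p m (mk (substList S l ++ wd (f.symm (1, t)))) =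
        (f.symm (E (mk l), t) : FreeNilpotentGroup p m) := by
      intro l t
      rw [← FreeGroup.mul_mk, map_mul, hS, hwd, ← coe_mul, ← map_mul]
      simp
    constructor
    · rintro ⟨hx, hx1⟩
      obtain ⟨⟨a, t⟩, hat⟩ := f.symm.surjective ⟨x, hx⟩
      obtain ⟨w, hw⟩ := exists_expSum_eq n fun i => (a (r.symm i)).toAdd
      obtain ⟨k, rfl⟩ := exists_mk_wordOf w
      have ha : E (mk (wordOf k)) = a := by
        funext i
        have := hw (r i)
        rwa [r.symm_apply_apply, ofAdd_toAdd] at this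
      refine ⟨_, ⟨wordOf k, (wd (f.symm (1, t)), decide (t ≠ 1)), ?_⟩, (hval (wordOf k) t).trans ?_⟩
      · rw [Bool.and_eq_true, Bool.and_eq_true, Bool.or_eq_true]
        refine ⟨⟨?_, beq_self_eq_true _⟩, ?_⟩
        · rw [List.contains_iff_mem]
          exact List.mem_map_of_mem (Finset.mem_toList.2 (Finset.mem_univ t))
        by_cases ht : t = 1
        · right
          have : E (mk (wordOf k)) ≠ 1 := by
            rintro h
            refine hx1 ?_
            have : (f.symm (a, t) : FreeNilpotentGroup p m) = 1 := by
              rw [← ha, h, ht, ← Prod.one_eq_mk, map_one, coe_one]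
            rw [← this, hat]
          simpa using (hE _).1 this
        · simp [ht]
      · rw [ha, hat]
    · rintro ⟨v, ⟨l, ⟨u, b⟩, h⟩, rfl⟩
      rw [Bool.and_eq_true, Bool.and_eq_true, Bool.or_eq_true, List.contains_iff_mem, beq_iff_eq] at h
      obtain ⟨⟨h1, rfl⟩, h2⟩ := h
      obtain ⟨t, -, ht⟩ := List.mem_map.1 h1
      obtain ⟨rfl, rfl⟩ := Prod.mk.inj ht
      dsimp only
      rw [hval]
      refine ⟨(f.symm (E (mk l), t)).2, fun h => ?_⟩
      rw [OneMemClass.coe_eq_one, EmbeddingLike.map_eq_one_iff, Prod.mk_eq_one] at h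
      rcases h2 with h2 | h2
      · exact (of_decide_eq_true h2) h.2
      · exact (hE l).2 (by simpa using h2) h.1

/-- The free nilpotent groups have decidable word problems. -/
theorem exists_computable_evalN : ∃ κ : Word → Bool, Computable κ ∧
    ∀ l, κ l = true ↔ evalN p m (mk l) = 1 := by
  classical
  obtain ⟨V, hV, hV'⟩ := exists_rePred_center p m
  let c : Word → Word → Word := fun y g => y ++ g ++ invRev y ++ invRev g
  have hc : ∀ (gs : List Word) (l : Word), evalN p m (mk (gs.foldl c l)) =
      (gs.map fun g => evalN p m (mk g)).foldl (fun y g => ⁅y, g⁆) (evalN p m (mk l)) := by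
    intro gs
    induction gs with
    | nil => exact fun _ => rfl
    | cons g gs ih =>
      intro l
      rw [List.foldl_cons, ih, List.map_cons, List.foldl_cons]
      congr 1
      simp only [c, commutatorElement_def, ← FreeGroup.mul_mk, ← FreeGroup.inv_mk, map_mul, map_inv]
  -- Nontriviality has a finite certificate: a sequence of commutations that ends in an enumerated
  -- nontrivial central element. Starting from `1`, no such certificate exists, since all iterated
  -- commutators are `1`.
  have h1 : REPred fun l : Word => ∃ z : List Word × Word, V z.2 ∧
      evalN p m (mk (invRev z.2 ++ z.1.foldl c l)) = 1 := by
    have hf : Primrec fun x : Word × List Word × Word => x.2.1.foldl c x.1 :=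
      Primrec.list_foldl (h := fun _ z => c z.1 z.2) (by fun_prop) (by fun_prop)
        (show Primrec fun x : (Word × List Word × Word) × Word × Word => c x.2.1 x.2.2 by
          fun_prop)
    exact REPred.exists_comp (P := fun x : Word × List Word × Word => V x.2.2 ∧
      evalN p m (mk (invRev x.2.2 ++ x.2.1.foldl c x.1)) = 1)
      ((hV.comp (by fun_prop : Primrec _).to_comp).and
        ((rePred_evalN_eq_one p m).comp
          (f := fun x : Word × List Word × Word => invRev x.2.2 ++ x.2.1.foldl c x.1)
          (by fun_prop : Primrec _).to_comp))
  have h2 : REPred fun l : Word => ¬ evalN p m (mk l) = 1 := by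
    refine h1.of_eq fun l => ?_
    have e : ∀ z : List Word × Word, evalN p m (mk (invRev z.2 ++ z.1.foldl c l)) = 1 ↔
        evalN p m (mk z.2) = evalN p m (mk (z.1.foldl c l)) := by
      intro z
      rw [← FreeGroup.mul_mk, ← FreeGroup.inv_mk, map_mul, map_inv, inv_mul_eq_one]
    simp only [e]
    constructor
    · rintro ⟨⟨gs, v⟩, hv, h⟩ hl
      have := ((hV' _).2 ⟨v, hv, rfl⟩).2
      dsimp only at h
      rw [h, hc, hl] at this
      refine this ?_
      clear h this
      generalize gs.map _ = hs
      induction hs with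
      | nil => rfl
      | cons g hs ih => rw [List.foldl_cons, commutatorElement_one_left, ih]
    · intro hl
      have htop : evalN p m (mk l) ∈ Subgroup.upperCentralSeries (FreeNilpotentGroup p m) p := by
        rw [Subgroup.lowerCentralSeries_eq_bot_iff_upperCentralSeries_eq_top.1
          (lcs_freeNilpotentGroup p m)]
        exact mem_top _
      obtain ⟨gs, hg1, hg2⟩ := exists_foldl_commutator_mem_center _ htop hl
      choose wd hwd using exists_evalN_mk p m
      obtain ⟨v, hv, hv'⟩ := (hV' _).1 ⟨hg1, hg2⟩
      refine ⟨⟨gs.map wd, v⟩, hv, ?_⟩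
      rw [hv', hc, List.map_map]
      simp [Function.comp_def, hwd]
  -- Post's theorem: triviality and nontriviality are both r.e.
  have h3 := ComputablePred.computable_iff_re_compl_re.2 ⟨rePred_evalN_eq_one p m, h2⟩
  exact ⟨fun l => decide (evalN p m (mk l) = 1), h3.decide, fun l => decide_eq_true_iff⟩

end WordProblem

/-! ### Homomorphisms from free nilpotent groups -/

section Homomorphisms

open Subgroup
open FreeGroup (mk invRev)
open scoped commutatorElement

variable {p m : ℕ}

/-- The universal property of the free nilpotent group. -/
def liftN {G : Type*} [Group G] (hG : lcs G p = ⊥) (a : ℕ → G) : FreeNilpotentGroup p m →* G :=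
  QuotientGroup.lift _ (FreeGroup.lift fun i : Fin m => a i) fun w hw => by
    have : FreeGroup.lift (fun i : Fin m => a i) w ∈ lcs G p := map_mem_lcs _ hw
    rwa [hG, mem_bot] at this

theorem liftN_evalN_of {G : Type*} [Group G] (hG : lcs G p = ⊥) (a : ℕ → G) {i : ℕ} (hi : i < m) :
    liftN hG a (evalN p m (FreeGroup.of i)) = a i := by
  rw [show i = ((⟨i, hi⟩ : Fin m) : ℕ) from rfl, evalN_of]
  change FreeGroup.lift (fun i : Fin m => a i) (FreeGroup.of ⟨i, hi⟩) = a i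
  simp

theorem evalN_hom_ext {G : Type*} [Group G] {f g : FreeNilpotentGroup p m →* G}
    (h : ∀ i < m, f (evalN p m (FreeGroup.of i)) = g (evalN p m (FreeGroup.of i))) : f = g := by
  rw [← MonoidHom.cancel_right (evalN_surjective p m)]
  ext i
  by_cases hi : i < m
  · exact h i hi
  · simp [evalN_of_le p m (not_lt.1 hi)]

theorem lcs_eq_bot_of_comm {G : Type*} [CommGroup G] (hp : 1 ≤ p) : lcs G p = ⊥ := by
  have h1 : lcs G 1 = ⊥ := (commutator_eq_bot_iff_center_eq_top G).2 CommGroup.center_eq_top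
  exact le_bot_iff.1 ((Subgroup.lowerCentralSeries_antitone _ hp).trans_eq h1)

/-- The exponent sum of a generator. -/
def coordN (hp : 1 ≤ p) (i : ℕ) : FreeNilpotentGroup p m →* Multiplicative ℤ :=
  liftN (lcs_eq_bot_of_comm hp) fun j => if j = i then Multiplicative.ofAdd 1 else 1

theorem coordN_evalN (hp : 1 ≤ p) {i : ℕ} (hi : i < m) (w : FreeGroup ℕ) :
    coordN hp i (evalN p m w) = expSum i w := by
  rw [← MonoidHom.comp_apply]
  congr 1
  ext j
  by_cases hj : j < m
  · simp [coordN, liftN_evalN_of _ _ hj, expSum]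
  · have : j ≠ i := by omega
    simp [evalN_of_le p m (not_lt.1 hj), expSum, this]

theorem coordN_of (hp : 1 ≤ p) (hm : 1 ≤ m) :
    coordN hp 0 (evalN p m (FreeGroup.of 0)) = Multiplicative.ofAdd 1 := by
  rw [coordN_evalN hp hm]; simp [expSum]

/-- The first generator has infinite order because its exponent sum is `1`, and an element of
infinite order forces a central one. -/
theorem exists_mem_center_zpow_injective (hp : 1 ≤ p) (hm : 1 ≤ m) :
    ∃ c ∈ center (FreeNilpotentGroup p m), ∀ k : ℤ, c ^ k = 1 → k = 0 := by
  obtain ⟨c, hc, hc'⟩ := exists_mem_center_not_isOfFinOrder (lcs_freeNilpotentGroup p m)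
    (x := evalN p m (FreeGroup.of 0)) fun h => by
      obtain ⟨n, hn, h1⟩ := isOfFinOrder_iff_pow_eq_one.1 h
      have := congrArg (coordN hp 0) h1
      rw [map_pow, coordN_of hp hm, (coordN (m := m) hp 0).map_one, ← ofAdd_nsmul] at this
      have h2 := Multiplicative.ofAdd.injective (this.trans ofAdd_zero.symm)
      simp at h2
      omega
  exact ⟨c, hc, fun k hk => by
    by_contra h
    exact hc' (isOfFinOrder_iff_zpow_eq_one.2 ⟨k, h, hk⟩)⟩

/-- The endomorphism raising the generators to the `k`-th power. -/
def powN (k : ℕ) : FreeNilpotentGroup p m →* FreeNilpotentGroup p m :=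
  liftN (lcs_freeNilpotentGroup p m) fun j => evalN p m (FreeGroup.of j) ^ k

/-- The map acts on the abelianization as the `k`-th power, so `k = E + 1` works for the exponent
`E` of `exists_forall_injective`. -/
theorem exists_powN_injective (p m : ℕ) : ∃ k, 2 ≤ k ∧
    Function.Injective (powN k : FreeNilpotentGroup p m →* FreeNilpotentGroup p m) := by
  obtain ⟨E, hE, h⟩ := exists_forall_injective (lcs_freeNilpotentGroup p m)
  refine ⟨E * 1 + 1, by omega, h _ 1 fun g => ?_⟩
  have : (powMonoidHom (E * 1 + 1)).comp (Abelianization.of (G := FreeNilpotentGroup p m)) =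
      Abelianization.of.comp (powN (E * 1 + 1)) := by
    refine evalN_hom_ext fun i hi => ?_
    simp only [MonoidHom.comp_apply, powN, liftN_evalN_of _ _ hi, powMonoidHom_apply, map_pow]
  have h1 := DFunLike.congr_fun this g
  rw [MonoidHom.comp_apply, powMonoidHom_apply, ← map_pow] at h1
  exact QuotientGroup.eq.1 h1

theorem not_nonempty_prod_mulEquiv (hp : 1 ≤ p) :
    ¬ Nonempty (FreeNilpotentGroup p m × Multiplicative ℤ ≃* FreeNilpotentGroup p m) := by
  rintro ⟨e⟩
  let C := Multiplicative (ZMod 2)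
  let F : (Fin m → C) × C → FreeNilpotentGroup p m × Multiplicative ℤ →* C := fun x =>
    (liftN (lcs_eq_bot_of_comm hp) fun i => if h : i < m then x.1 ⟨i, h⟩ else 1).coprod
      (zpowersHom C x.2)
  have hF : Function.Injective F := by
    intro x y h
    refine Prod.ext ?_ ?_
    · funext i
      have := DFunLike.congr_fun h (evalN p m (FreeGroup.of (i : ℕ)), 1)
      simpa [F, liftN_evalN_of _ _ i.2] using this
    · have := DFunLike.congr_fun h (1, Multiplicative.ofAdd 1)
      simpa [F] using this
  have hinj : Function.Injective fun x : (Fin m → C) × C =>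
      fun i : Fin m => F x (e.symm (evalN p m (FreeGroup.of (i : ℕ)))) := by
    intro x y h
    apply hF
    have : (F x).comp e.symm.toMonoidHom = (F y).comp e.symm.toMonoidHom :=
      evalN_hom_ext fun i hi => congrFun h ⟨i, hi⟩
    ext1 z
    simpa using DFunLike.congr_fun this (e z)
  have hcard := Fintype.card_le_of_injective _ hinj
  have hC : Fintype.card C = 2 := by simp [C, ZMod.card]
  rw [Fintype.card_prod, hC] at hcard
  have : 0 < Fintype.card (Fin m → C) := Fintype.card_pos
  omega

end Homomorphisms

/-! ### Atomic diagrams determine groups -/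

section Diagrams

theorem IsCharIndex.unique {e : ℕ} {S T : Set ℕ} (hS : IsCharIndex e S) (hT : IsCharIndex e T) :
    S = T := by
  ext n
  by_cases h1 : n ∈ S <;> by_cases h2 : n ∈ T
  · simp [h1, h2]
  · have := Part.mem_unique ((hS n).1 h1) ((hT n).2 h2)
    omega
  · have := Part.mem_unique ((hS n).2 h1) ((hT n).1 h2)
    omega
  · simp [h1, h2]

theorem codeEq_mem_atomicDiagram_of_le {D : Set ℕ} [Group D] {t s : ℕ}
    (h : 2 * Nat.pair t s ∈ atomicDiagram D) :
    ∃ t' s' : GroupTerm D, t'.code = t ∧ s'.code = s ∧ t'.eval = s'.eval := by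
  obtain ⟨t', s', h1, h2, h3⟩ := mem_atomicDiagram_iff.1 h
  rw [Nat.mul_div_cancel_left _ two_pos, Nat.unpair_pair] at h1 h2
  exact ⟨t', s', h1, h2, h3.1 (by omega)⟩

/-- The universe is read off from the sentences `x = x` and the multiplication from the sentences `x
* y = z`. With `IsCharIndex.unique`, an index thus determines its group up to isomorphism. -/
theorem nonempty_mulEquiv_of_atomicDiagram_eq {D E : Set ℕ} [gD : Group D] [gE : Group E]
    (h : atomicDiagram D = atomicDiagram E) : Nonempty (D ≃* E) := by
  have key : ∀ {D E : Set ℕ} [Group D] [Group E], atomicDiagram D = atomicDiagram E → D ⊆ E := by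
    intro D E _ _ h x hx
    have h1 : codeEq (GroupTerm.const (⟨x, hx⟩ : D)) (GroupTerm.const ⟨x, hx⟩) ∈ atomicDiagram D :=
      codeEq_mem_atomicDiagram.2 rfl
    rw [h] at h1
    obtain ⟨t, s, ht, -, -⟩ := codeEq_mem_atomicDiagram_of_le h1
    refine GroupTerm.mem_of_mem_termWord t (x, true) ?_
    rw [ht, GroupTerm.code, termWord_const]
    simp
  have hDE : D = E := (key h).antisymm (key h.symm)
  refine ⟨MulEquiv.mk (Equiv.setCongr hDE) fun x y => ?_⟩
  have h1 := (codeEq_mem_atomicDiagram (t := .mul (.const x) (.const y))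
    (s := .const (x * y))).2 rfl
  rw [h] at h1
  obtain ⟨t, s, ht, hs, h2⟩ := codeEq_mem_atomicDiagram_of_le h1
  obtain rfl : t = .mul (.const (Equiv.setCongr hDE x)) (.const (Equiv.setCongr hDE y)) :=
    GroupTerm.code_injective ht
  obtain rfl : s = .const (Equiv.setCongr hDE (x * y)) := GroupTerm.code_injective hs
  exact h2.symm

end Diagrams

/-! ### Direct limits along sequences of substitutions -/

section Limits

open Subgroup Filter
open FreeGroup (mk invRev)

/-- The list of the first letters, as words. -/
def letters (w : ℕ) : List Word := (List.range w).map fun i => [(i, true)]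

/-- The values at stage `r` of the letters introduced up to stage `r`: at every step the
substitution chosen by `F` is applied to the old values, and `w` new letters are introduced. -/
def stage (w : ℕ) (F : ℕ × List Word → List Word) : ℕ → List Word
  | 0 => letters w
  | r + 1 => (stage w F r).map (substList (F (r, stage w F r))) ++ letters w

theorem length_letters (w : ℕ) : (letters w).length = w := by simp [letters]

theorem getD_letters {w i : ℕ} (hi : i < w) : (letters w).getD i [] = [(i, true)] := by
  simp [letters, hi]

variable {w : ℕ} {F : ℕ × List Word → List Word}

theorem length_stage (r : ℕ) : (stage w F r).length = (r + 1) * w := by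
  induction r with
  | zero => simp [stage, length_letters]
  | succ r ih => rw [stage, List.length_append, List.length_map, ih, length_letters]; ring

theorem getD_stage_succ {r j : ℕ} (hj : j < (r + 1) * w) :
    (stage w F (r + 1)).getD j [] =
      substList (F (r, stage w F r)) ((stage w F r).getD j []) := by
  have h : j < (stage w F r).length := by rwa [length_stage]
  rw [stage, List.getD_append _ _ _ _ (by simpa using h)]
  simp [h]

/-- Letter `r * w + i` is the `i`-th of the letters introduced at stage `r`, where it names the
`i`-th generator. -/
theorem getD_stage_new {r i : ℕ} (hi : i < w) :
    (stage w F r).getD (r * w + i) [] = [(i, true)] := by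
  cases r with
  | zero => rw [zero_mul, zero_add]; exact getD_letters hi
  | succ r =>
    have h : ((stage w F r).map (substList (F (r, stage w F r)))).length = (r + 1) * w := by
      rw [List.length_map, length_stage]
    rw [stage, List.getD_append_right _ _ _ _ (by rw [h]; omega), h, Nat.add_sub_cancel_left]
    exact getD_letters hi

variable {H : Type*} [Group H] (φ : FreeGroup ℕ →* H)

/-- The evaluation at stage `r` of words in the letters introduced so far. -/
def push (w : ℕ) (F : ℕ × List Word → List Word) (r : ℕ) : FreeGroup ℕ →* H :=
  FreeGroup.lift fun j => φ (mk ((stage w F r).getD j []))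

theorem push_mk (r : ℕ) (l : Word) :
    push φ w F r (mk l) = φ (mk (substList (stage w F r) l)) := by
  rw [substList, hom_mk_expand]
  rfl

theorem push_of (r j : ℕ) :
    push φ w F r (FreeGroup.of j) = φ (mk ((stage w F r).getD j [])) := by
  simp [push]

theorem push_of_new {r i : ℕ} (hi : i < w) :
    push φ w F r (FreeGroup.of (r * w + i)) = φ (FreeGroup.of i) := by
  rw [push_of, getD_stage_new hi]
  rfl

/-- The words that become trivial in the limit. -/
def limitKernel (w : ℕ) (F : ℕ × List Word → List Word) : Subgroup (FreeGroup ℕ) where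
  carrier := {x | ∀ᶠ r in atTop, push φ w F r x = 1}
  one_mem' := Eventually.of_forall fun r => map_one _
  mul_mem' := fun {x y} hx hy => by
    filter_upwards [hx, hy] with r h1 h2
    rw [map_mul, h1, h2, one_mul]
  inv_mem' := fun {x} hx => by
    filter_upwards [hx] with r h
    rw [map_inv, h, inv_one]

theorem mem_limitKernel {x : FreeGroup ℕ} :
    x ∈ limitKernel φ w F ↔ ∀ᶠ r in atTop, push φ w F r x = 1 := Iff.rfl

instance : (limitKernel φ w F).Normal where
  conj_mem x hx g := by
    rw [mem_limitKernel] at hx ⊢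
    filter_upwards [hx] with r h
    rw [map_mul, map_mul, h, mul_one, map_inv, mul_inv_cancel]

/-- The limit kernel is the kernel of a homomorphism to which the evaluations converge. -/
theorem limitKernel_eq_ker {G : Type*} [Group G] {ι : G →* H} (hι : Function.Injective ι)
    {ψ : FreeGroup ℕ →* G}
    (h : ∀ j, ∀ᶠ r in atTop, push φ w F r (FreeGroup.of j) = ι (ψ (FreeGroup.of j))) :
    limitKernel φ w F = ψ.ker := by
  have key : ∀ x, ∀ᶠ r in atTop, push φ w F r x = ι (ψ x) := by
    intro x
    induction x using FreeGroup.induction_on with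
    | C1 => simp
    | of j => exact h j
    | inv_of j hj => filter_upwards [h j] with r hr; rw [map_inv, hr, map_inv, map_inv]
    | mul x y hx hy =>
      filter_upwards [hx, hy] with r h1 h2
      rw [map_mul, h1, h2, map_mul, map_mul]
  ext x
  rw [mem_limitKernel, MonoidHom.mem_ker, ← map_eq_one_iff ι hι]
  constructor
  · intro h
    obtain ⟨r, h1, h2⟩ := (h.and (key x)).exists
    rw [← h2, h1]
  · intro h
    filter_upwards [key x] with r hr
    rw [hr, h]

variable {φ} {τ : ℕ → H →* H}
  (hτ : ∀ r l, φ (mk (substList (F (r, stage w F r)) l)) = τ r (φ (mk l)))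

include hτ in
-- The restriction on `x` is essential: a letter not yet introduced has value `1` at stage `r`, by
-- the default of `getD`, but may be nontrivial at stage `r + 1`.
theorem push_succ {r : ℕ} {x : FreeGroup ℕ}
    (hx : x ∈ closure (FreeGroup.of '' Set.Iio ((r + 1) * w))) :
    push φ w F (r + 1) x = τ r (push φ w F r x) := by
  have : closure (FreeGroup.of '' Set.Iio ((r + 1) * w)) ≤
      (push φ w F (r + 1)).eqLocus ((τ r).comp (push φ w F r)) := by
    rw [closure_le]
    rintro _ ⟨j, hj, rfl⟩
    change push φ w F (r + 1) _ = τ r (push φ w F r _)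
    rw [push_of, push_of, getD_stage_succ hj, hτ]
  exact this hx

theorem closure_of_mono {a b : ℕ} (h : a ≤ b) :
    closure (FreeGroup.of '' Set.Iio a) ≤ closure (FreeGroup.of '' Set.Iio b) :=
  closure_mono (Set.image_mono (Set.Iio_subset_Iio h))

include hτ in
theorem push_eq_of_forall {s : ℕ} {x : FreeGroup ℕ} {h : H}
    (hx : x ∈ closure (FreeGroup.of '' Set.Iio ((s + 1) * w))) (h1 : push φ w F s x = h)
    (h2 : ∀ r, s ≤ r → τ r h = h) : ∀ r, s ≤ r → push φ w F r x = h := by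
  intro r hr
  induction r, hr using Nat.le_induction with
  | base => exact h1
  | succ r hr ih =>
    rw [push_succ hτ (closure_of_mono (Nat.mul_le_mul_right w (by omega)) hx), ih, h2 r hr]

/-- Since every stage introduces at least one letter when `w ≥ 1`, all letters of `l` are available
at stage `Encodable.encode l`. -/
theorem letter_le_encode (l : Word) : ∀ x ∈ l, x.1 ≤ Encodable.encode l := by
  induction l with
  | nil => simp
  | cons y l ih =>
    intro x hx
    rw [Encodable.encode_list_cons]
    rcases List.mem_cons.1 hx with rfl | hx
    · have h1 := Nat.left_le_pair (Encodable.encode x) (Encodable.encode l)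
      have h2 := Nat.left_le_pair x.1 (Encodable.encode x.2)
      have h3 : Encodable.encode x = Nat.pair x.1 (Encodable.encode x.2) := rfl
      omega
    · have h1 := Nat.right_le_pair (Encodable.encode y) (Encodable.encode l)
      have h2 := ih x hx
      omega

theorem mk_mem_closure {l : Word} {n : ℕ} (h : ∀ x ∈ l, x.1 < n) :
    mk l ∈ closure (FreeGroup.of '' Set.Iio n) := by
  induction l with
  | nil => exact one_mem _
  | cons x l ih =>
    rw [show x :: l = [x] ++ l from rfl, ← FreeGroup.mul_mk]
    refine mul_mem ?_ (ih fun y hy => h y (List.mem_cons_of_mem _ hy))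
    have hx : FreeGroup.of x.1 ∈ closure (FreeGroup.of '' Set.Iio n) :=
      subset_closure ⟨x.1, h x (by simp), rfl⟩
    rcases x with ⟨j, _ | _⟩
    · rw [show mk [(j, false)] = (FreeGroup.of j)⁻¹ from rfl]
      exact inv_mem hx
    · exact hx

include hτ in
/-- If no inequality that holds at stage `r` between words numbered up to `r` is destroyed, then
membership in the limit kernel is decided at a stage known beforehand. -/
theorem mk_mem_limitKernel_iff (hw : 1 ≤ w)
    (hinj : ∀ r l, Encodable.encode l ≤ r → push φ w F r (mk l) ≠ 1 →
      τ r (push φ w F r (mk l)) ≠ 1) (l : Word) :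
    mk l ∈ limitKernel φ w F ↔ push φ w F (Encodable.encode l) (mk l) = 1 := by
  have hl : mk l ∈ closure (FreeGroup.of '' Set.Iio ((Encodable.encode l + 1) * w)) := by
    refine mk_mem_closure fun x hx => ?_
    have h1 := letter_le_encode l x hx
    have h2 := Nat.le_mul_of_pos_right (Encodable.encode l + 1) hw
    omega
  constructor
  · intro h
    by_contra h1
    have key : ∀ r, Encodable.encode l ≤ r → push φ w F r (mk l) ≠ 1 := by
      intro r hr
      induction r, hr using Nat.le_induction with
      | base => exact h1
      | succ r hr ih =>
        rw [push_succ hτ (closure_of_mono (Nat.mul_le_mul_right w (by omega)) hl)]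
        exact hinj r l hr ih
    obtain ⟨r, h2, h3⟩ := ((mem_limitKernel φ).1 h |>.and
      (eventually_ge_atTop (Encodable.encode l))).exists
    exact key r h3 h2
  · intro h
    exact eventually_atTop.2 ⟨_, push_eq_of_forall hτ hl h fun r _ => map_one _⟩

include hτ in
/-- If infinitely often all values are raised to the `k`-th power, then every homomorphism from the
limit to an abelian group takes only `k`-th powers as values. -/
theorem exists_pow_eq_of_frequently {A : Type*} [CommGroup A] {k : ℕ} (hw : 1 ≤ w)
    (hk : ∀ s, ∃ r, s ≤ r ∧ ∀ h, ∃ l : Word, (∀ x ∈ l, x.1 < w) ∧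
      τ r h = FreeGroup.lift (fun j => φ (FreeGroup.of j) ^ k) (mk l))
    (χ : FreeGroup ℕ →* A) (hχ : limitKernel φ w F ≤ χ.ker) (x : FreeGroup ℕ) :
    ∃ a, χ x = a ^ k := by
  have key : ∀ j, ∃ a, χ (FreeGroup.of j) = a ^ k := by
    intro j
    obtain ⟨r, hr, h⟩ := hk j
    obtain ⟨l, hl, h1⟩ := h (push φ w F r (FreeGroup.of j))
    -- `β` replaces the generators by the `k`-th powers of the letters that name them at stage `r +
    -- 1`.
    let β : FreeGroup ℕ →* FreeGroup ℕ :=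
      FreeGroup.lift fun i => FreeGroup.of ((r + 1) * w + i) ^ k
    have hj : j < (r + 1) * w := by
      have h2 := Nat.le_mul_of_pos_right (r + 1) hw
      omega
    have hxj : FreeGroup.of j ∈ closure (FreeGroup.of '' Set.Iio ((r + 1) * w)) :=
      subset_closure ⟨j, hj, rfl⟩
    have hβ : closure (FreeGroup.of '' Set.Iio w) ≤
        (closure (FreeGroup.of '' Set.Iio ((r + 1 + 1) * w))).comap β ⊓
          ((push φ w F (r + 1)).comp β).eqLocus
            (FreeGroup.lift fun j => φ (FreeGroup.of j) ^ k) := by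
      rw [closure_le]
      rintro _ ⟨i, hi, rfl⟩
      rw [Set.mem_Iio] at hi
      refine ⟨?_, ?_⟩
      · change β (FreeGroup.of i) ∈ closure (FreeGroup.of '' Set.Iio ((r + 1 + 1) * w))
        have : (r + 1) * w + i < (r + 1 + 1) * w := by nlinarith
        simp only [β, FreeGroup.lift_apply_of]
        have hmem : FreeGroup.of ((r + 1) * w + i) ∈
            Subgroup.closure (FreeGroup.of '' Set.Iio ((r + 1 + 1) * w)) :=
          Subgroup.subset_closure ⟨_, this, rfl⟩
        exact pow_mem hmem k
      · change push φ w F (r + 1) (β _) = _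
        simp only [β, FreeGroup.lift_apply_of]
        rw [map_pow, push_of_new φ hi]
    obtain ⟨h2, h3⟩ := hβ (mk_mem_closure hl)
    -- After the `k`-th power map, letter `j` and a word in `k`-th powers of new letters have the
    -- same value, so they agree in the limit. In a commutative group the image of such a word is a
    -- `k`-th power.
    have h4 : FreeGroup.of j * (β (mk l))⁻¹ ∈ limitKernel φ w F := by
      refine eventually_atTop.2 ⟨r + 1, push_eq_of_forall hτ
        (mul_mem (closure_of_mono (Nat.mul_le_mul_right w (by omega)) hxj) (inv_mem h2)) ?_
        fun _ _ => map_one _⟩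
      rw [map_mul, map_inv, push_succ hτ hxj, h1, mul_inv_eq_one]
      exact Eq.symm h3
    have h5 := hχ h4
    rw [MonoidHom.mem_ker, map_mul, map_inv, mul_inv_eq_one] at h5
    refine ⟨FreeGroup.lift (fun i => χ (FreeGroup.of ((r + 1) * w + i))) (mk l), ?_⟩
    rw [h5, ← powMonoidHom_apply, ← MonoidHom.comp_apply, ← MonoidHom.comp_apply]
    congr 1
    ext i
    simp [β]
  have : (⊤ : Subgroup (FreeGroup ℕ)) ≤ (powMonoidHom k : A →* A).range.comap χ := by
    rw [← FreeGroup.closure_range_of, closure_le]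
    rintro _ ⟨j, rfl⟩
    obtain ⟨a, ha⟩ := key j
    exact ⟨a, ha.symm⟩
  obtain ⟨a, ha⟩ := this (mem_top x)
  exact ⟨a, ha.symm⟩

end Limits

/-! ### Limits of free nilpotent groups -/

section Limits

open Subgroup Filter
open FreeGroup (mk invRev)

/-- A list of words realizes an endomorphism if substituting it for the letters has the effect of
the endomorphism on values. -/
def Realizes {H : Type*} [Group H] (φ : FreeGroup ℕ →* H) (T : List Word) (τ : H →* H) : Prop :=
  ∀ l, φ (mk (substList T l)) = τ (φ (mk l))

theorem realizes_of_forall {H : Type*} [Group H] {φ : FreeGroup ℕ →* H} {T : List Word}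
    {τ : H →* H} (h : ∀ j, φ (mk (T.getD j [])) = τ (φ (FreeGroup.of j))) : Realizes φ T τ := by
  intro l
  rw [substList, hom_mk_expand, ← MonoidHom.comp_apply]
  congr 1
  ext j
  simpa using h j

theorem Realizes.comp {H : Type*} [Group H] {φ : FreeGroup ℕ →* H} {T U : List Word}
    {τ σ : H →* H} (hT : Realizes φ T τ) (hU : Realizes φ U σ) :
    Realizes φ (T.map (substList U)) (σ.comp τ) := by
  refine realizes_of_forall fun j => ?_
  have h : (T.map (substList U)).getD j [] = substList U (T.getD j []) := by
    by_cases hj : j < T.length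
    · simp [hj]
    · have hj := not_lt.1 hj
      rw [List.getD_eq_default _ _ (by simpa using hj), List.getD_eq_default _ _ hj]
      rfl
  have h2 := hT [(j, true)]
  have h3 : substList T [(j, true)] = T.getD j [] := by simp [substList, expand]
  rw [h, hU, ← h3, h2]
  rfl

variable {p m : ℕ}

/-- The evaluation of words in the product of the free nilpotent group with `ℤ`. -/
def evalNZ (p m : ℕ) : FreeGroup ℕ →* FreeNilpotentGroup p m × Multiplicative ℤ :=
  (evalN p m).prod (expSum m)

theorem evalNZ_of_lt {j : ℕ} (hj : j < m) :
    evalNZ p m (FreeGroup.of j) = (evalN p m (FreeGroup.of j), 1) := by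
  have : j ≠ m := by omega
  simp [evalNZ, expSum, this]

theorem evalNZ_of_self : evalNZ p m (FreeGroup.of m) = (1, Multiplicative.ofAdd 1) := by
  simp [evalNZ, expSum, evalN_of_le]

theorem evalNZ_of_gt {j : ℕ} (hj : m < j) : evalNZ p m (FreeGroup.of j) = 1 := by
  have : j ≠ m := by omega
  simp [evalNZ, expSum, this, evalN_of_le p m hj.le]

theorem evalNZ_surjective : Function.Surjective (evalNZ p m) := by
  rintro ⟨x, z⟩
  obtain ⟨w, rfl⟩ := evalN_surjective p m x
  refine ⟨w * FreeGroup.of m ^ (z.toAdd - (expSum m w).toAdd), ?_⟩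
  rw [map_mul, map_zpow, evalNZ_of_self]
  refine Prod.ext ?_ ?_
  · simp [evalNZ]
  · apply Multiplicative.toAdd.injective
    simp [evalNZ]

theorem exists_evalNZ_mk (x : FreeNilpotentGroup p m × Multiplicative ℤ) :
    ∃ l : Word, evalNZ p m (mk l) = x := by
  obtain ⟨w, rfl⟩ := evalNZ_surjective x
  obtain ⟨k, rfl⟩ := exists_mk_wordOf w
  exact ⟨_, rfl⟩

theorem realizes_letters : Realizes (evalNZ p m) (letters (m + 1)) (MonoidHom.id _) := by
  refine realizes_of_forall fun j => ?_
  by_cases hj : j < m + 1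
  · rw [getD_letters hj]; rfl
  · rw [List.getD_eq_default _ _ (by rw [length_letters]; omega), evalNZ_of_gt (by omega)]
    rfl

/-- The list of the `k`-th powers of the letters. -/
def powList (m k : ℕ) : List Word := (List.range (m + 1)).map fun i => List.replicate k (i, true)

theorem mk_replicate (i k : ℕ) : mk (List.replicate k (i, true)) = FreeGroup.of i ^ k := by
  induction k with
  | zero => rfl
  | succ k ih =>
    rw [List.replicate_succ, pow_succ', ← ih, FreeGroup.of, FreeGroup.mul_mk]
    rfl

/-- The endomorphism that raises the generators to the `k`-th power. -/
def powNZ (p m k : ℕ) : FreeNilpotentGroup p m × Multiplicative ℤ →*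
    FreeNilpotentGroup p m × Multiplicative ℤ :=
  (powN k).prodMap (powMonoidHom k)

theorem powNZ_evalNZ_of (k j : ℕ) :
    powNZ p m k (evalNZ p m (FreeGroup.of j)) = evalNZ p m (FreeGroup.of j) ^ k := by
  rcases lt_trichotomy j m with hj | rfl | hj
  · rw [evalNZ_of_lt hj]
    simp [powNZ, powN, liftN_evalN_of _ _ hj]
  · rw [evalNZ_of_self]
    simp [powNZ]
  · rw [evalNZ_of_gt hj, map_one, one_pow]

theorem realizes_powList (k : ℕ) : Realizes (evalNZ p m) (powList m k) (powNZ p m k) := by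
  refine realizes_of_forall fun j => ?_
  rw [powNZ_evalNZ_of]
  by_cases hj : j < m + 1
  · have : (powList m k).getD j [] = List.replicate k (j, true) := by simp [powList, hj]
    rw [this, mk_replicate, map_pow]
  · rw [List.getD_eq_default _ _ (by simp [powList]; omega), evalNZ_of_gt (by omega), one_pow]
    rfl

theorem powNZ_injective {k : ℕ} (hk : 2 ≤ k)
    (h : Function.Injective (powN k : FreeNilpotentGroup p m →* FreeNilpotentGroup p m)) :
    Function.Injective (powNZ p m k) := by
  change Function.Injective (Prod.map (powN k) (powMonoidHom k))
  refine Function.Injective.prodMap h fun x y hxy => ?_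
  have := congrArg Multiplicative.toAdd hxy
  simp only [powMonoidHom_apply, toAdd_pow, nsmul_eq_mul] at this
  exact Multiplicative.toAdd.injective (mul_left_cancel₀ (by positivity) this)

/-- The endomorphism that maps the generator of `ℤ` to the `K`-th power of a central element. -/
def collapse {c : FreeNilpotentGroup p m} (hc : c ∈ center (FreeNilpotentGroup p m)) (K : ℕ) :
    FreeNilpotentGroup p m × Multiplicative ℤ →* FreeNilpotentGroup p m × Multiplicative ℤ where
  toFun x := (x.1 * c ^ (K * x.2.toAdd), 1)
  map_one' := by simp
  map_mul' x y := by
    have h := mem_center_iff.1 (zpow_mem hc (K * x.2.toAdd)) y.1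
    refine Prod.ext ?_ (by simp)
    simp only [Prod.fst_mul, Prod.snd_mul, toAdd_mul, mul_add, zpow_add, Prod.mk_mul_mk]
    rw [mul_assoc x.1 y.1, ← mul_assoc y.1, h]
    group

/-- The list of words that realizes the collapse. -/
def collapseList (m : ℕ) (cw : Word) (K : ℕ) : List Word :=
  letters m ++ [(List.range K).flatMap fun _ => cw]

theorem mk_flatMap_range (cw : Word) (K : ℕ) : mk ((List.range K).flatMap fun _ => cw) = mk cw ^ K := by
  induction K with
  | zero => rfl
  | succ K ih =>
    rw [List.range_succ, List.flatMap_append, ← FreeGroup.mul_mk, ih, pow_succ]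
    simp

theorem realizes_collapseList {c : FreeNilpotentGroup p m}
    (hc : c ∈ center (FreeNilpotentGroup p m)) {cw : Word} (hcw : evalNZ p m (mk cw) = (c, 1))
    (K : ℕ) : Realizes (evalNZ p m) (collapseList m cw K) (collapse hc K) := by
  refine realizes_of_forall fun j => ?_
  rcases lt_trichotomy j m with hj | rfl | hj
  · rw [collapseList, List.getD_append _ _ _ _ (by rwa [length_letters]), getD_letters hj]
    change evalNZ p m (FreeGroup.of j) = _
    rw [evalNZ_of_lt hj]
    simp [collapse]
  · rw [collapseList, List.getD_append_right _ _ _ _ (by rw [length_letters]), length_letters,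
      Nat.sub_self, List.getD_cons_zero, mk_flatMap_range, map_pow, hcw, evalNZ_of_self]
    simp [collapse]
  · rw [List.getD_eq_default _ _ (by simp [collapseList, length_letters]; omega), evalNZ_of_gt hj,
      map_one]
    rfl

/-- All but finitely many collapses keep a given element nontrivial. -/
theorem finite_setOf_collapse_eq_one {c : FreeNilpotentGroup p m}
    (hc : c ∈ center (FreeNilpotentGroup p m)) (hc' : ∀ k : ℤ, c ^ k = 1 → k = 0)
    {x : FreeNilpotentGroup p m × Multiplicative ℤ} (hx : x ≠ 1) :
    {K | collapse hc K x = 1}.Finite := by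
  -- At most one parameter kills `x`: two parameters `K` and `L` give `c ^ ((K - L) * z) = 1` for
  -- the integer coordinate `z`, and `z = 0` would force `x = 1`.
  refine Set.Subsingleton.finite fun K hK L hL => ?_
  have h1 : x.1 * c ^ (K * x.2.toAdd) = 1 := congrArg Prod.fst hK
  have h2 : x.1 * c ^ (L * x.2.toAdd) = 1 := congrArg Prod.fst hL
  by_cases hz : x.2.toAdd = 0
  · rw [hz, mul_zero, zpow_zero, mul_one] at h1
    exact absurd (Prod.ext h1 (Multiplicative.toAdd.injective hz)) hx
  · have h3 : c ^ ((K : ℤ) * x.2.toAdd - L * x.2.toAdd) = 1 := by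
      rw [zpow_sub, mul_inv_eq_one]
      exact mul_left_cancel (h1.trans h2.symm)
    have h4 := hc' _ h3
    rw [← sub_mul, mul_eq_zero, or_iff_left hz, sub_eq_zero] at h4
    exact_mod_cast h4

/-- The endomorphism applied at a step: a collapse and a power map, each only if its event takes
place. -/
def stepHom {c : FreeNilpotentGroup p m} (hc : c ∈ center (FreeNilpotentGroup p m)) (k : ℕ)
    (e₁ e₂ : Bool) (K : ℕ) :
    FreeNilpotentGroup p m × Multiplicative ℤ →* FreeNilpotentGroup p m × Multiplicative ℤ :=
  (bif e₁ then powNZ p m k else MonoidHom.id _).comp (bif e₂ then collapse hc K else MonoidHom.id _)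

/-- The limit is the free nilpotent group if and only if there are only finitely many power maps
and infinitely many collapses. -/
theorem nonempty_limit_mulEquiv_iff (hp : 1 ≤ p) (hm : 1 ≤ m) {c : FreeNilpotentGroup p m}
    (hc : c ∈ center (FreeNilpotentGroup p m)) {k : ℕ} (hk : 2 ≤ k) (e₁ e₂ : ℕ → Bool) (K : ℕ → ℕ)
    {F : ℕ × List Word → List Word}
    (hF : ∀ r, Realizes (evalNZ p m) (F (r, stage (m + 1) F r)) (stepHom hc k (e₁ r) (e₂ r) (K r))) :
    Nonempty (FreeGroup ℕ ⧸ limitKernel (evalNZ p m) (m + 1) F ≃* FreeNilpotentGroup p m) ↔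
      (∃ s₀, ∀ s, s₀ ≤ s → e₁ s = false) ∧ ¬ ∃ s₀, ∀ s, s₀ ≤ s → e₂ s = false := by
  have iso : ∀ {G : Type} [Group G] (ψ : FreeGroup ℕ →* G), Function.Surjective ψ →
      limitKernel (evalNZ p m) (m + 1) F = ψ.ker →
      Nonempty (FreeGroup ℕ ⧸ limitKernel (evalNZ p m) (m + 1) F ≃* G) := fun ψ hψ h =>
    ⟨(QuotientGroup.quotientMulEquivOfEq h).trans
      (QuotientGroup.quotientKerEquivOfSurjective ψ hψ)⟩
  by_cases h1 : ∃ s₀, ∀ s, s₀ ≤ s → e₁ s = false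
  · obtain ⟨s₀, hs₀⟩ := h1
    have hof : ∀ j, FreeGroup.of j ∈
        Subgroup.closure (FreeGroup.of '' Set.Iio ((j + 1) * (m + 1))) := fun j =>
      Subgroup.subset_closure ⟨j, by simp only [Set.mem_Iio]; nlinarith, rfl⟩
    have hmono : ∀ j r, j ≤ r → FreeGroup.of j ∈
        Subgroup.closure (FreeGroup.of '' Set.Iio ((r + 1) * (m + 1))) := fun j r h =>
      closure_of_mono (Nat.mul_le_mul_right _ (by omega)) (hof j)
    have hnew : ∀ i < m + 1, FreeGroup.of (s₀ * (m + 1) + i) ∈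
        Subgroup.closure (FreeGroup.of '' Set.Iio ((s₀ + 1) * (m + 1))) := fun i hi =>
      Subgroup.subset_closure ⟨_, by simp only [Set.mem_Iio]; nlinarith, rfl⟩
    by_cases h2 : ∃ s₀, ∀ s, s₀ ≤ s → e₂ s = false
    · refine iff_of_false ?_ fun h => h.2 h2
      rintro ⟨f⟩
      obtain ⟨s₁, hs₁⟩ := h2
      -- With finitely many events of both kinds, all maps are eventually identities and the limit
      -- is `N × ℤ`.
      have hτ : ∀ r, max s₀ s₁ ≤ r → ∀ h, stepHom hc k (e₁ r) (e₂ r) (K r) h = h := by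
        intro r hr h
        rw [hs₀ r (le_of_max_le_left hr), hs₁ r (le_of_max_le_right hr)]
        rfl
      have hconv : ∀ j, ∃ h, ∀ᶠ r in atTop,
          push (evalNZ p m) (m + 1) F r (FreeGroup.of j) = h := fun j =>
        ⟨_, eventually_atTop.2 ⟨max (max s₀ s₁) j, push_eq_of_forall hF
          (hmono j _ (le_max_right _ _)) rfl
          fun r hr => hτ r ((le_max_left _ _).trans hr) _⟩⟩
      choose a ha using hconv
      obtain ⟨g⟩ := iso (FreeGroup.lift a) (by
        rw [← MonoidHom.range_eq_top, eq_top_iff]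
        rintro x -
        obtain ⟨w, rfl⟩ := evalNZ_surjective x
        have : (⊤ : Subgroup (FreeGroup ℕ)) ≤ (FreeGroup.lift a).range.comap (evalNZ p m) := by
          rw [← FreeGroup.closure_range_of, closure_le]
          rintro _ ⟨i, rfl⟩
          by_cases hi : i < m + 1
          · refine ⟨FreeGroup.of (max s₀ s₁ * (m + 1) + i), ?_⟩
            rw [FreeGroup.lift_apply_of]
            obtain ⟨r, h1, h2⟩ := ((ha (max s₀ s₁ * (m + 1) + i)).and
              (eventually_ge_atTop (max s₀ s₁))).exists
            rw [← h1]
            exact push_eq_of_forall hF (Subgroup.subset_closure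
              ⟨_, by simp only [Set.mem_Iio]; nlinarith, rfl⟩) (push_of_new _ hi)
              (fun r hr => hτ r hr _) r h2
          · rw [SetLike.mem_coe, Subgroup.mem_comap, evalNZ_of_gt (by omega)]
            exact one_mem _
        exact this (mem_top w))
        (limitKernel_eq_ker (evalNZ p m) (ι := MonoidHom.id _) (fun _ _ h => h) fun j => by
          simpa using ha j)
      exact not_nonempty_prod_mulEquiv hp ⟨g.symm.trans f⟩
    · refine iff_of_true ?_ ⟨⟨s₀, hs₀⟩, h2⟩
      -- After the last power map only identities and collapses remain, and these fix the factor `N`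
      -- pointwise.
      have hτ : ∀ r, s₀ ≤ r → ∀ g, stepHom hc k (e₁ r) (e₂ r) (K r) (g, 1) = (g, 1) := by
        intro r hr g
        rw [hs₀ r hr]
        cases e₂ r <;> simp [stepHom, collapse]
      push Not at h2
      have hconv : ∀ j, ∃ g, ∀ᶠ r in atTop,
          push (evalNZ p m) (m + 1) F r (FreeGroup.of j) = MonoidHom.inl _ _ g := by
        intro j
        -- The next collapse moves the value of letter `j` into the factor `N`, where it stays
        -- constant.
        obtain ⟨s, hs, hs'⟩ := h2 (max s₀ j)
        have h3 := push_succ hF (hmono j s ((le_max_right _ _).trans hs))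
        rw [hs₀ s ((le_max_left _ _).trans hs), Bool.eq_true_of_not_eq_false hs'] at h3
        refine ⟨_, eventually_atTop.2 ⟨s + 1, push_eq_of_forall hF
          (hmono j _ (((le_max_right _ _).trans hs).trans (Nat.le_succ s))) h3
          fun r hr => hτ r (((le_max_left _ _).trans hs).trans ((Nat.le_succ s).trans hr)) _⟩⟩
      choose a ha using hconv
      refine iso (FreeGroup.lift a) ?_ (limitKernel_eq_ker (evalNZ p m)
        (ι := MonoidHom.inl _ _) (fun _ _ h => congrArg Prod.fst h) fun j => by simpa using ha j)
      rw [← MonoidHom.range_eq_top, eq_top_iff]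
      rintro x -
      obtain ⟨w, rfl⟩ := evalN_surjective p m x
      have : (⊤ : Subgroup (FreeGroup ℕ)) ≤ (FreeGroup.lift a).range.comap (evalN p m) := by
        rw [← FreeGroup.closure_range_of, closure_le]
        rintro _ ⟨i, rfl⟩
        by_cases hi : i < m
        · refine ⟨FreeGroup.of (s₀ * (m + 1) + i), ?_⟩
          rw [FreeGroup.lift_apply_of]
          obtain ⟨r, h1, h3⟩ := ((ha (s₀ * (m + 1) + i)).and (eventually_ge_atTop s₀)).exists
          have h4 := push_eq_of_forall hF (hnew i (by omega))
            ((push_of_new _ (by omega)).trans (evalNZ_of_lt hi)) (fun r hr => hτ r hr _) r h3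
          exact congrArg Prod.fst (h1.symm.trans h4)
        · rw [SetLike.mem_coe, Subgroup.mem_comap, evalN_of_le p m (by omega)]
          exact one_mem _
      exact this (mem_top w)
  · refine iff_of_false ?_ fun h => h1 h.1
    rintro ⟨f⟩
    push Not at h1
    -- Infinitely many power maps make all values of `χ` divisible by `k`, but an isomorphism with
    -- `N` would let the exponent sum of the first generator give the value `1`.
    let χ : FreeGroup ℕ →* Multiplicative ℤ :=
      (coordN hp 0).comp (f.toMonoidHom.comp (QuotientGroup.mk' _))
    obtain ⟨x, hx⟩ := f.surjective (evalN p m (FreeGroup.of 0))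
    obtain ⟨w, rfl⟩ := QuotientGroup.mk'_surjective _ x
    obtain ⟨a, ha⟩ := exists_pow_eq_of_frequently hF (k := k) (by omega) (fun s => by
      obtain ⟨r, hr, hr'⟩ := h1 s
      refine ⟨r, hr, fun h => ?_⟩
      rw [Bool.eq_true_of_not_eq_false hr']
      obtain ⟨l, hl⟩ := exists_evalNZ_mk ((bif e₂ r then collapse hc (K r) else MonoidHom.id _) h)
      -- Letters above `m` have trivial value and may be deleted, so only the `m + 1` letters
      -- introduced at each stage remain.
      let l' := l.filter fun x => decide (x.1 < m + 1)
      refine ⟨l', fun x hx => of_decide_eq_true (List.mem_filter.1 hx).2, ?_⟩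
      change powNZ p m k ((bif e₂ r then collapse hc (K r) else MonoidHom.id _) h) = _
      have h2 : ∀ l : Word, FreeGroup.lift (fun j => evalNZ p m (FreeGroup.of j) ^ k)
          (mk (l.filter fun x => decide (x.1 < m + 1))) =
          FreeGroup.lift (fun j => evalNZ p m (FreeGroup.of j) ^ k) (mk l) := by
        intro l
        induction l with
        | nil => rfl
        | cons x l ih =>
          by_cases hx : x.1 < m + 1
          · rw [List.filter_cons_of_pos (by simpa using hx)]
            simp only [FreeGroup.lift_mk, List.map_cons, List.prod_cons] at ih ⊢
            rw [ih]
          · rw [List.filter_cons_of_neg (by simpa using hx), ih]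
            simp only [FreeGroup.lift_mk, List.map_cons, List.prod_cons]
            rw [evalNZ_of_gt (by omega)]
            cases x.2 <;> simp
      rw [h2, ← hl, ← MonoidHom.comp_apply]
      congr 1
      ext1 j
      simp [powNZ_evalNZ_of]) χ (fun x hx => by
        have : (x : FreeGroup ℕ ⧸ limitKernel (evalNZ p m) (m + 1) F) = 1 :=
          (QuotientGroup.eq_one_iff x).2 hx
        rw [MonoidHom.mem_ker]
        change coordN hp 0 (f (x : FreeGroup ℕ ⧸ limitKernel (evalNZ p m) (m + 1) F)) = 1
        rw [this, map_one, map_one]) w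
    have h2 : χ w = Multiplicative.ofAdd 1 := by
      change coordN hp 0 (f _) = _
      rw [hx, coordN_of hp hm]
    rw [h2] at ha
    have h3 := congrArg Multiplicative.toAdd ha
    rw [toAdd_ofAdd, toAdd_pow, nsmul_eq_mul] at h3
    have h4 := Int.isUnit_iff.1 (IsUnit.of_mul_eq_one _ h3.symm)
    omega

end Limits

/-! ### Completeness -/

section Hardness

open Subgroup
open FreeGroup (mk)

/-- Membership in a `Σ₂` set as the finiteness of a set of events. -/
theorem IsSigma2.exists_events {S : Set ℕ} (hS : IsSigma2 S) : ∃ ev : ℕ × ℕ → Bool,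
    Computable ev ∧ ∀ n, n ∈ S ↔ ∃ s₀, ∀ s, s₀ ≤ s → ev (n, s) = false := by
  obtain ⟨g, hg, h⟩ := hS.exists_primrec
  have hg := hg.to_comp
  -- `A (n, x, y)` says that every candidate up to `x` has been refuted as a witness by a number up
  -- to `y`.
  obtain ⟨A, hA, hA_iff⟩ : ∃ A : ℕ × ℕ × ℕ → Bool, Computable A ∧
      ∀ n x y, A (n, x, y) = true ↔ ∀ x' ≤ x, ∃ y' ≤ y, g (n, x', y') = true := by
    have h1 : Computable fun u : ((ℕ × ℕ × ℕ) × ℕ) × ℕ => !g (u.1.1.1, u.1.2, u.2) :=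
      Computable.not_comp (hg.comp (by fun_prop))
    have h2 := Computable.forall_lt (f := fun z : (ℕ × ℕ × ℕ) × ℕ => z.1.2.2 + 1)
      (by fun_prop) h1
    have h3 := Computable.forall_lt (f := fun a : ℕ × ℕ × ℕ => a.2.1 + 1)
      (by fun_prop) h2.not_comp
    refine ⟨_, h3, fun n x y => ?_⟩
    simp
  -- The pair `(x, y)` is an event iff `y` is the least bound that refutes all candidates up to `x`.
  -- Each `x` causes at most one event, and it causes one iff no witness is `≤ x`; so there are
  -- finitely many events iff there is a witness.
  refine ⟨fun a => A (a.1, a.2.unpair) &&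
    (a.2.unpair.2 == 0 || !A (a.1, a.2.unpair.1, a.2.unpair.2 - 1)), ?_, fun n => ?_⟩
  · have h1 : Computable fun a : ℕ × ℕ => A (a.1, a.2.unpair) := hA.comp (by fun_prop)
    have h2 : Computable fun a : ℕ × ℕ => A (a.1, a.2.unpair.1, a.2.unpair.2 - 1) :=
      hA.comp (by fun_prop : Primrec fun a : ℕ × ℕ =>
        (a.1, a.2.unpair.1, a.2.unpair.2 - 1)).to_comp
    have h3 : Computable fun a : ℕ × ℕ => a.2.unpair.2 == 0 :=
      (by fun_prop : Primrec fun a : ℕ × ℕ => a.2.unpair.2 == 0).to_comp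
    exact h1.and_comp (h3.or_comp h2.not_comp)
  have ev_iff : ∀ x y, (A (n, (Nat.pair x y).unpair) && ((Nat.pair x y).unpair.2 == 0 ||
      !A (n, (Nat.pair x y).unpair.1, (Nat.pair x y).unpair.2 - 1))) = true ↔
      A (n, x, y) = true ∧ ∀ y' < y, A (n, x, y') = false := by
    intro x y
    rw [Nat.unpair_pair, Bool.and_eq_true, Bool.or_eq_true, beq_iff_eq, Bool.not_eq_true']
    refine and_congr_right fun _ => ⟨?_, fun h => ?_⟩
    · rintro h y' hy'
      rcases h with h | h
      · simp only at h; omega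
      · rw [Bool.eq_false_iff, Ne, hA_iff] at h ⊢
        refine fun h' => h fun x' hx' => ?_
        obtain ⟨z, hz, hz'⟩ := h' x' hx'
        exact ⟨z, by simp only; omega, hz'⟩
    · rcases Nat.eq_zero_or_pos y with h0 | h0
      · exact Or.inl h0
      · exact Or.inr (h _ (by omega))
  rw [h n]
  constructor
  · rintro ⟨x₀, hx₀⟩
    have hfin : {s : ℕ | (A (n, s.unpair) && (s.unpair.2 == 0 ||
        !A (n, s.unpair.1, s.unpair.2 - 1))) = true}.Finite := by
      refine Set.Finite.of_finite_image (f := fun s => s.unpair.1)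
        ((Set.finite_Iio x₀).subset ?_) ?_
      · rintro _ ⟨s, hs, rfl⟩
        rw [Set.mem_ofPred_eq, ← Nat.pair_unpair s, ev_iff, hA_iff] at hs
        rw [Set.mem_Iio]
        by_contra hlt
        obtain ⟨y, -, hy⟩ := hs.1 x₀ (not_lt.1 hlt)
        rw [hx₀ y] at hy
        exact Bool.noConfusion hy
      · intro s hs t ht hst
        rw [Set.mem_ofPred_eq, ← Nat.pair_unpair s, ev_iff] at hs
        rw [Set.mem_ofPred_eq, ← Nat.pair_unpair t, ev_iff] at ht
        simp only at hst
        rw [hst] at hs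
        rw [← Nat.pair_unpair s, ← Nat.pair_unpair t, hst]
        rcases lt_trichotomy s.unpair.2 t.unpair.2 with h1 | h1 | h1
        · rw [ht.2 _ h1] at hs; exact Bool.noConfusion hs.1
        · rw [h1]
        · rw [hs.2 _ h1] at ht; exact Bool.noConfusion ht.1
    obtain ⟨b, hb⟩ := hfin.bddAbove
    refine ⟨b + 1, fun s hs => Bool.eq_false_iff.2 fun hs' => ?_⟩
    have := hb hs'
    omega
  · rintro ⟨s₀, hs₀⟩
    by_contra hcon
    push Not at hcon
    have hex : ∃ y, A (n, s₀, y) = true := by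
      choose y hy using hcon
      refine ⟨(Finset.range (s₀ + 1)).sup y, (hA_iff _ _ _).2 fun x' hx' =>
        ⟨y x', Finset.le_sup (Finset.mem_range.2 (by omega)), Bool.eq_true_of_not_eq_false (hy x')⟩⟩
    have h1 := (ev_iff s₀ (Nat.find hex)).2 ⟨Nat.find_spec hex, fun y hy =>
      Bool.eq_false_iff.2 (Nat.find_min hex hy)⟩
    -- The event belonging to `x = s₀` has number at least `s₀`, which contradicts the choice of
    -- `s₀`.
    have h2 := hs₀ _ (Nat.left_le_pair s₀ (Nat.find hex))
    exact Bool.noConfusion (h2.symm.trans h1)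

theorem Computable.map_substList_comp {α : Type*} [Primcodable α] {P T : α → List Word}
    (hP : Computable P) (hT : Computable T) :
    Computable fun a => (P a).map (substList (T a)) :=
  (Primrec.list_map (f := fun a : List Word × List Word => a.1)
    (g := fun a l => substList a.2 l) (by fun_prop) (by
      unfold Primrec₂; fun_prop)).to_comp.comp (hP.pair hT)

theorem primrec_collapseList (m : ℕ) (cw : Word) : Primrec (collapseList m cw) := by
  have : Primrec fun K => (List.range K).flatMap fun _ => cw :=
    Primrec.list_flatMap (by fun_prop) (by unfold Primrec₂; fun_prop)
  unfold collapseList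
  fun_prop

variable {p m : ℕ}

theorem exists_computable_evalNZ (p m : ℕ) : ∃ κ : Word → Bool, Computable κ ∧
    ∀ l, κ l = true ↔ evalNZ p m (mk l) = 1 := by
  obtain ⟨κ, hκ, h⟩ := exists_computable_evalN p m
  refine ⟨fun l => κ l && dvdExpSum 0 m l, hκ.and_comp (by fun_prop : Primrec _).to_comp,
    fun l => ?_⟩
  rw [Bool.and_eq_true, h, dvdExpSum_iff, Nat.cast_zero, zero_dvd_iff, evalNZ,
    MonoidHom.prod_apply, Prod.mk_eq_one]
  rfl

/-- A parameter can be computed for which the collapse destroys no inequality, at the values `P`,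
between words numbered up to `r`. -/
theorem exists_computable_collapse {c : FreeNilpotentGroup p m}
    (hc : c ∈ center (FreeNilpotentGroup p m)) (hc' : ∀ k : ℤ, c ^ k = 1 → k = 0) {cw : Word}
    (hcw : evalNZ p m (mk cw) = (c, 1)) : ∃ K : ℕ × List Word → ℕ, Computable K ∧
      ∀ r P k, k ≤ r → evalNZ p m (mk (substList P (wordOf k))) ≠ 1 →
        collapse hc (K (r, P)) (evalNZ p m (mk (substList P (wordOf k)))) ≠ 1 := by
  obtain ⟨κ, hκ, hκ'⟩ := exists_computable_evalNZ p m
  have h1 : Computable fun y : ((ℕ × List Word) × ℕ) × ℕ =>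
      κ (substList y.1.1.2 (wordOf y.2)) :=
    hκ.comp (by fun_prop)
  have h2 : Computable fun y : ((ℕ × List Word) × ℕ) × ℕ => collapseList m cw y.1.2 :=
    (primrec_collapseList m cw).to_comp.comp (by fun_prop)
  have h3 : Computable fun y : ((ℕ × List Word) × ℕ) × ℕ =>
      κ (substList (collapseList m cw y.1.2) (substList y.1.1.2 (wordOf y.2))) :=
    hκ.comp (h2.substList_comp (by fun_prop))
  obtain ⟨good, hgood, good_iff⟩ : ∃ good : (ℕ × List Word) × ℕ → Bool, Computable good ∧
      ∀ r P K, good ((r, P), K) = true ↔ ∀ k < r + 1,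
        evalNZ p m (mk (substList P (wordOf k))) ≠ 1 →
          collapse hc K (evalNZ p m (mk (substList P (wordOf k)))) ≠ 1 := by
    refine ⟨_, Computable.forall_lt (f := fun x : (ℕ × List Word) × ℕ => x.1.1 + 1) (by fun_prop)
      (h1.or_comp h3.not_comp), fun r P K => ?_⟩
    rw [decide_eq_true_eq]
    refine forall₂_congr fun k _ => ?_
    rw [Bool.or_eq_true, Bool.not_eq_true', Bool.eq_false_iff, Ne, hκ', hκ',
      realizes_collapseList hc hcw]
    tauto
  -- Each of the `r + 1` words excludes only finitely many parameters, so the search for a good one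
  -- ends.
  have hex : ∀ x, ∃ K, good (x, K) = true := by
    rintro ⟨r, P⟩
    have hfin : (⋃ k ∈ Set.Iio (r + 1), {K | evalNZ p m (mk (substList P (wordOf k))) ≠ 1 ∧
        collapse hc K (evalNZ p m (mk (substList P (wordOf k)))) = 1}).Finite := by
      refine (Set.finite_Iio _).biUnion fun k _ => ?_
      by_cases h : evalNZ p m (mk (substList P (wordOf k))) = 1
      · simp [h]
      · exact (finite_setOf_collapse_eq_one hc hc' h).subset fun K hK => hK.2
    obtain ⟨K, hK⟩ := hfin.exists_notMem
    exact ⟨K, (good_iff r P K).2 fun k hk h h' =>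
      hK (Set.mem_biUnion (Set.mem_Iio.2 hk) ⟨h, h'⟩)⟩
  exact ⟨_, Computable.nat_find hgood hex, fun r P k hk =>
    (good_iff r P _).1 (Nat.find_spec (hex (r, P))) k (Nat.lt_succ_of_le hk)⟩

/-- The substitution chosen at a step. -/
def stepList (m : ℕ) (cw : Word) (k : ℕ) (e₁ e₂ : Bool) (K : ℕ) : List Word :=
  bif e₁ then (bif e₂ then collapseList m cw K else letters (m + 1)).map (substList (powList m k))
  else bif e₂ then collapseList m cw K else letters (m + 1)

theorem realizes_stepList {c : FreeNilpotentGroup p m}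
    (hc : c ∈ center (FreeNilpotentGroup p m)) {cw : Word} (hcw : evalNZ p m (mk cw) = (c, 1))
    (k : ℕ) (e₁ e₂ : Bool) (K : ℕ) :
    Realizes (evalNZ p m) (stepList m cw k e₁ e₂ K) (stepHom hc k e₁ e₂ K) := by
  have h : Realizes (evalNZ p m) (bif e₂ then collapseList m cw K else letters (m + 1))
      (bif e₂ then collapse hc K else MonoidHom.id _) := by
    cases e₂
    · exact realizes_letters
    · exact realizes_collapseList hc hcw K
  cases e₁
  · exact h
  · exact h.comp (realizes_powList k)

theorem stage_eq_rec (w : ℕ) (F : ℕ × List Word → List Word) (r : ℕ) :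
    stage w F r = Nat.rec (motive := fun _ => List Word) (letters w)
      (fun y P => P.map (substList (F (y, P))) ++ letters w) r := by
  induction r with
  | zero => rfl
  | succ r ih => rw [stage, ih]

theorem computable_stage (w : ℕ) {F : ℕ → ℕ × List Word → List Word}
    (hF : Computable fun x : ℕ × ℕ × List Word => F x.1 x.2) :
    Computable fun x : ℕ × ℕ => stage w (F x.1) x.2 := by
  have h0 : Computable fun x : (ℕ × ℕ) × ℕ × List Word => (x.1.1, x.2) := by fun_prop
  have h1 : Computable fun x : (ℕ × ℕ) × ℕ × List Word => F x.1.1 x.2 := by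
    simpa using hF.comp h0
  have h2 : Computable fun x : (ℕ × ℕ) × ℕ × List Word =>
      x.2.2.map (substList (F x.1.1 x.2)) ++ letters w := by
    have h := Computable.map_substList_comp (P := fun x : (ℕ × ℕ) × ℕ × List Word => x.2.2)
      (by fun_prop) h1
    have h' := h.append_comp (Computable.const (letters w))
    exact h'
  have h3 := Computable.nat_rec (f := fun x : ℕ × ℕ => x.2) (g := fun _ => letters w)
    (h := fun x y => y.2.map (substList (F x.1 y)) ++ letters w)
    (by fun_prop) (.const _) h2
  simpa only [stage_eq_rec] using h3

/-- Power maps are triggered by events that are finitely many iff `n ∈ A`, collapses by events that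
are finitely many iff `n ∉ B`. The limit is therefore `N` exactly for `n ∈ A ∩ B`. -/
theorem IsDSigma2.manyOneReducible (hp : 1 ≤ p) (hm : 1 ≤ m) {T : Set ℕ} (hT : IsDSigma2 T) :
    ManyOneReducible (fun n => n ∈ T) (fun n => n ∈ indexSet (FreeNilpotentGroup p m)) := by
  obtain ⟨A, B, hA, hB, rfl⟩ := hT
  obtain ⟨ev₁, hev₁, h₁⟩ := hA.exists_events
  obtain ⟨ev₂, hev₂, h₂⟩ := IsSigma2.exists_events hB
  obtain ⟨c, hc, hc'⟩ := exists_mem_center_zpow_injective (p := p) (m := m) hp hm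
  obtain ⟨k, hk, hk'⟩ := exists_powN_injective p m
  obtain ⟨cw, hcw⟩ := exists_evalNZ_mk ((c, 1) : FreeNilpotentGroup p m × Multiplicative ℤ)
  obtain ⟨κ, hκ, hκ'⟩ := exists_computable_evalNZ p m
  obtain ⟨K, hK, hK'⟩ := exists_computable_collapse hc hc' hcw
  obtain ⟨F, hF, F_eq⟩ : ∃ F : ℕ → ℕ × List Word → List Word,
      (Computable fun x : ℕ × ℕ × List Word => F x.1 x.2) ∧
        ∀ n x, F n x = stepList m cw k (ev₁ (n, x.1)) (ev₂ (n, x.1)) (K x) := by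
    have e1 : Computable fun x : ℕ × ℕ × List Word => ev₁ (x.1, x.2.1) := hev₁.comp (by fun_prop)
    have e2 : Computable fun x : ℕ × ℕ × List Word => ev₂ (x.1, x.2.1) := hev₂.comp (by fun_prop)
    have e3 : Computable fun x : ℕ × ℕ × List Word => collapseList m cw (K x.2) :=
      (primrec_collapseList m cw).to_comp.comp (hK.comp (by fun_prop))
    have e4 := e2.cond_comp e3 (.const (letters (m + 1)))
    have e5 := e1.cond_comp (e4.map_substList_comp (.const (powList m k))) e4
    exact ⟨fun n x => stepList m cw k (ev₁ (n, x.1)) (ev₂ (n, x.1)) (K x), e5, fun _ _ => rfl⟩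
  have hstage := computable_stage (m + 1) hF
  have hreal : ∀ n r, Realizes (evalNZ p m) (F n (r, stage (m + 1) (F n) r))
      (stepHom hc k (ev₁ (n, r)) (ev₂ (n, r)) (K (r, stage (m + 1) (F n) r))) := fun n r =>
    F_eq n _ ▸ realizes_stepList hc hcw k _ _ _
  have hmem : ∀ n l, κ (substList (stage (m + 1) (F n) (Encodable.encode l)) l) = true ↔
      mk l ∈ limitKernel (evalNZ p m) (m + 1) (F n) := by
    intro n l
    -- No inequality between early words is ever destroyed: the collapse by the choice of `K`, the
    -- power map by injectivity. So a word is trivial in the limit iff it is trivial at the stage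
    -- given by its own number.
    rw [mk_mem_limitKernel_iff (hreal n) (by omega), hκ', push_mk]
    intro r l hl h
    rw [push_mk] at h ⊢
    rw [stepHom, MonoidHom.comp_apply]
    have h1 : (bif ev₂ (n, r) then collapse hc (K (r, stage (m + 1) (F n) r)) else
        MonoidHom.id _) (evalNZ p m (mk (substList (stage (m + 1) (F n) r) l))) ≠ 1 := by
      cases ev₂ (n, r)
      · exact h
      · have := hK' r (stage (m + 1) (F n) r) _ hl
        rw [wordOf_encode] at this
        exact this h
    cases ev₁ (n, r)
    · exact h1
    · exact fun h2 => h1 ((map_eq_one_iff _ (powNZ_injective hk hk')).1 h2)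
  have h0 : Computable fun x : ℕ × Word => (x.1, Encodable.encode x.2) := by fun_prop
  have h1 := hstage.comp h0
  have h2 := hκ.comp (h1.substList_comp (Computable.snd (α := ℕ) (β := Word)))
  obtain ⟨f, hf, hf'⟩ := exists_computable_index h2
    (fun n => limitKernel (evalNZ p m) (m + 1) (F n)) hmem
  refine ⟨f, hf, fun n => ?_⟩
  have hiff := nonempty_limit_mulEquiv_iff hp hm hc hk _ _ _ (hreal n)
  rw [← h₁ n, ← h₂ n, Set.notMem_compl_iff] at hiff
  refine hiff.symm.trans ⟨fun ⟨g⟩ => ?_, ?_⟩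
  · exact ⟨_, inferInstance, ⟨(leastWordsMulEquiv _).trans g⟩, hf' n⟩
  · rintro ⟨D, _, ⟨g⟩, hD⟩
    -- Whatever group has the diagram with this index is isomorphic to the constructed one.
    obtain ⟨i⟩ := nonempty_mulEquiv_of_atomicDiagram_eq ((hf' n).unique hD)
    exact ⟨((leastWordsMulEquiv _).symm.trans i).trans g⟩

end Hardness

/-! ### Indices of atomic diagrams -/

section DiagramIndices

open FreeGroup (mk invRev)

theorem rePred_mem_phi {α : Type*} [Primcodable α] (b : ℕ) {f g : α → ℕ} (hf : Computable f)
    (hg : Computable g) : REPred fun a => b ∈ phi (f a) (g a) := by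
  have h1 : Computable fun x : ℕ × α =>
      ((x.1, Denumerable.ofNat Nat.Partrec.Code (f x.2)), g x.2) :=
    (Computable.fst.pair ((Computable.ofNat _).comp (hf.comp Computable.snd))).pair
      (hg.comp Computable.snd)
  have h2 := (Nat.Partrec.Code.primrec_evaln.to_comp.comp h1).beq_comp (Computable.const (some b))
  refine REPred.of_exists h2 fun a => ?_
  simp only [beq_iff_eq, phi, Nat.Partrec.Code.evaln_complete, Option.mem_def]

/-- `φ_e` affirms the sentence `t = s`, for terms given by their Gödel numbers. -/
def Affirms (e t s : ℕ) : Prop := 1 ∈ phi e (2 * Nat.pair t s)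

/-- `φ_e` denies the sentence `t = s`, for terms given by their Gödel numbers. -/
def Denies (e t s : ℕ) : Prop := 0 ∈ phi e (2 * Nat.pair t s)

theorem rePred_affirms {α : Type*} [Primcodable α] {e t s : α → ℕ} (he : Computable e)
    (ht : Computable t) (hs : Computable s) : REPred fun a => Affirms (e a) (t a) (s a) :=
  rePred_mem_phi 1 he (by fun_prop)

theorem rePred_denies {α : Type*} [Primcodable α] {e t s : α → ℕ} (he : Computable e)
    (ht : Computable t) (hs : Computable s) : REPred fun a => Denies (e a) (t a) (s a) :=
  rePred_mem_phi 0 he (by fun_prop)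

/-- The conditions under which `φ_e` is the characteristic function of the atomic diagram of a
group. Membership of `x` in the universe is expressed by the sentence `x = x`. -/
structure DiagramCondition (e t t' s s' : ℕ) : Prop where
  -- In the conditions below, implications are disjunctions in which the premise is denied instead
  -- of negated. This keeps them r.e., and totality makes the two readings equivalent.
  total : 0 ∈ phi e t ∨ 1 ∈ phi e t
  letters : Denies e t t ∨ ∀ x ∈ termWord t, Affirms e (3 * x.1 + 1) (3 * x.1 + 1)
  one : Affirms e 0 0
  -- The group axioms are contained in this clause: terms whose words agree in the free group must
  -- be affirmed equal.
  freeEq : Denies e t t ∨ Denies e s s ∨ (!freeEq (termWord t) (termWord s)) = true ∨ Affirms e t s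
  dom : Denies e t s ∨ Affirms e t t ∧ Affirms e s s
  trans : Denies e t s ∨ Denies e t' s ∨ Affirms e t t'
  mul : Denies e t t' ∨ Denies e s s' ∨
    Affirms e (3 * Nat.pair t s + 3) (3 * Nat.pair t' s' + 3)
  inv : Denies e t t' ∨ Affirms e (3 * t + 2) (3 * t' + 2)
  const : Denies e t t ∨ ∃ x, Affirms e t (3 * x + 1)
  const_inj : Denies e (3 * t + 1) (3 * s + 1) ∨ (t == s) = true
  of_ne : 0 ∈ phi e (2 * Nat.pair t s + 1) ∨ Affirms e t t ∧ Affirms e s s ∧ Denies e t s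
  ne : Denies e t t ∨ Denies e s s ∨ Affirms e t s ∨ 1 ∈ phi e (2 * Nat.pair t s + 1)

theorem rePred_diagramCondition : REPred fun x : ℕ × ℕ × ℕ × ℕ × ℕ =>
    DiagramCondition x.1 x.2.1 x.2.2.1 x.2.2.2.1 x.2.2.2.2 := by
  have hw : Primrec fun x : ℕ × ℕ × ℕ × ℕ × ℕ => termWord x.2.1 :=
    primrec_termWord.comp (by fun_prop)
  have hw' : Primrec fun x : ℕ × ℕ × ℕ × ℕ × ℕ => termWord x.2.2.2.1 :=
    primrec_termWord.comp (by fun_prop)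
  have h1 : REPred fun x : ℕ × ℕ × Bool => Affirms x.1 (3 * x.2.1 + 1) (3 * x.2.1 + 1) :=
    rePred_affirms (by fun_prop) (by fun_prop) (by fun_prop)
  have h2 : Computable fun x : ℕ × ℕ × ℕ × ℕ × ℕ => (x.1, termWord x.2.1) :=
    Computable.fst.pair hw.to_comp
  have h3 := h1.forall_mem_list.comp h2
  have h4 := (hw.freeEq_comp hw').not_comp
  have h5 : Primrec fun x : ℕ × ℕ × ℕ × ℕ × ℕ => x.2.1 == x.2.2.2.1 := by fun_prop
  have h6 : REPred fun x : (ℕ × ℕ × ℕ × ℕ × ℕ) × ℕ => Affirms x.1.1 x.1.2.1 (3 * x.2 + 1) :=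
    rePred_affirms (by fun_prop) (by fun_prop) (by fun_prop)
  have d : ∀ {t s : ℕ × ℕ × ℕ × ℕ × ℕ → ℕ}, Computable t → Computable s →
    REPred fun x => Denies x.1 (t x) (s x) := fun ht hs => rePred_denies (by fun_prop) ht hs
  have a : ∀ {t s : ℕ × ℕ × ℕ × ℕ × ℕ → ℕ}, Computable t → Computable s →
    REPred fun x => Affirms x.1 (t x) (s x) := fun ht hs => rePred_affirms (by fun_prop) ht hs
  have m : ∀ b {n : ℕ × ℕ × ℕ × ℕ × ℕ → ℕ}, Computable n →
    REPred fun x => b ∈ phi x.1 (n x) := fun b _ hn => rePred_mem_phi b (by fun_prop) hn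
  have ht : Computable fun x : ℕ × ℕ × ℕ × ℕ × ℕ => x.2.1 := by fun_prop
  have ht' : Computable fun x : ℕ × ℕ × ℕ × ℕ × ℕ => x.2.2.1 := by fun_prop
  have hs : Computable fun x : ℕ × ℕ × ℕ × ℕ × ℕ => x.2.2.2.1 := by fun_prop
  have hs' : Computable fun x : ℕ × ℕ × ℕ × ℕ × ℕ => x.2.2.2.2 := by fun_prop
  have hn : Computable fun x : ℕ × ℕ × ℕ × ℕ × ℕ => 2 * Nat.pair x.2.1 x.2.2.2.1 + 1 := by
    fun_prop
  have c1 := (m 0 ht).or (m 1 ht)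
  have c2 := (d ht ht).or h3
  have c3 := a (.const 0) (.const 0)
  have c4 := (d ht ht).or ((d hs hs).or ((REPred.of_bool h4.to_comp).or (a ht hs)))
  have c5 := (d ht hs).or ((a ht ht).and (a hs hs))
  have c6 := (d ht hs).or ((d ht' hs).or (a ht ht'))
  have c7 := (d ht ht').or ((d hs hs').or (a (t := fun x => 3 * Nat.pair x.2.1 x.2.2.2.1 + 3)
    (s := fun x => 3 * Nat.pair x.2.2.1 x.2.2.2.2 + 3) (by fun_prop) (by fun_prop)))
  have c8 := (d ht ht').or (a (t := fun x => 3 * x.2.1 + 2) (s := fun x => 3 * x.2.2.1 + 2)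
    (by fun_prop) (by fun_prop))
  have c9 := (d ht ht).or h6.exists_comp
  have c10 := (d (t := fun x => 3 * x.2.1 + 1) (s := fun x => 3 * x.2.2.2.1 + 1)
    (by fun_prop) (by fun_prop)).or (REPred.of_bool h5.to_comp)
  have c11 := (m 0 hn).or ((a ht ht).and ((a hs hs).and (d ht hs)))
  have c12 := (d ht ht).or ((d hs hs).or ((a ht hs).or (m 1 hn)))
  have hc := c1.and (c2.and (c3.and (c4.and (c5.and (c6.and (c7.and (c8.and (c9.and (c10.and
    (c11.and c12))))))))))
  refine hc.of_eq fun x => ⟨?_, ?_⟩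
  · rintro ⟨h1, h2, h3, h4, h5, h6, h7, h8, h9, h10, h11, h12⟩
    exact ⟨h1, h2, h3, h4, h5, h6, h7, h8, h9, h10, h11, h12⟩
  · rintro ⟨h1, h2, h3, h4, h5, h6, h7, h8, h9, h10, h11, h12⟩
    exact ⟨h1, h2, h3, h4, h5, h6, h7, h8, h9, h10, h11, h12⟩

theorem IsCharIndex.one_mem_iff {e : ℕ} {S : Set ℕ} (h : IsCharIndex e S) {n : ℕ} :
    1 ∈ phi e n ↔ n ∈ S := by
  refine ⟨fun h1 => ?_, (h n).1⟩
  by_contra h2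
  have := Part.mem_unique h1 ((h n).2 h2)
  omega

theorem IsCharIndex.zero_mem_iff {e : ℕ} {S : Set ℕ} (h : IsCharIndex e S) {n : ℕ} :
    0 ∈ phi e n ↔ n ∉ S := by
  refine ⟨fun h1 h2 => ?_, (h n).2⟩
  have := Part.mem_unique h1 ((h n).1 h2)
  omega

theorem IsCharIndex.affirms_iff {e : ℕ} {D : Set ℕ} [Group D]
    (h : IsCharIndex e (atomicDiagram D)) {t s : ℕ} :
    Affirms e t s ↔ ∃ T S : GroupTerm D, T.code = t ∧ S.code = s ∧ T.eval = S.eval := by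
  rw [Affirms, h.one_mem_iff]
  refine ⟨codeEq_mem_atomicDiagram_of_le, ?_⟩
  rintro ⟨T, S, rfl, rfl, h⟩
  exact codeEq_mem_atomicDiagram.2 h

theorem IsCharIndex.denies_iff {e : ℕ} {D : Set ℕ} [Group D]
    (h : IsCharIndex e (atomicDiagram D)) {t s : ℕ} : Denies e t s ↔ ¬ Affirms e t s := by
  rw [Affirms, Denies, h.one_mem_iff, h.zero_mem_iff]

theorem IsCharIndex.affirms_self_iff {e : ℕ} {D : Set ℕ} [Group D]
    (h : IsCharIndex e (atomicDiagram D)) {t : ℕ} :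
    Affirms e t t ↔ ∃ T : GroupTerm D, T.code = t := by
  rw [h.affirms_iff]
  refine ⟨fun ⟨T, _, hT, _⟩ => ⟨T, hT⟩, ?_⟩
  rintro ⟨T, rfl⟩
  exact ⟨T, T, rfl, rfl, rfl⟩

theorem IsCharIndex.affirms_const_iff {e : ℕ} {D : Set ℕ} [Group D]
    (h : IsCharIndex e (atomicDiagram D)) {x : ℕ} :
    Affirms e (3 * x + 1) (3 * x + 1) ↔ x ∈ D := by
  rw [h.affirms_self_iff]
  refine ⟨?_, fun hx => ⟨.const ⟨x, hx⟩, rfl⟩⟩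
  rintro ⟨T, hT⟩
  have := T.mem_of_mem_termWord (x, true)
  rw [hT, termWord_const] at this
  exact this (by simp)

theorem GroupTerm.eval_eq {D : Set ℕ} [Group D] {T S : GroupTerm D}
    (h : mk (termWord T.code) = mk (termWord S.code)) : T.eval = S.eval := by
  classical
  have ha : ∀ x : D, MonoidHom.id D x = (fun j => if hj : j ∈ D then (⟨j, hj⟩ : D) else 1) x := by
    simp
  have h1 := T.map_eval (MonoidHom.id D) (fun j => if hj : j ∈ D then (⟨j, hj⟩ : D) else 1) ha
  have h2 := S.map_eval (MonoidHom.id D) (fun j => if hj : j ∈ D then (⟨j, hj⟩ : D) else 1) ha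
  rw [← h, ← h1] at h2
  exact h2.symm

theorem IsCharIndex.diagramCondition {e : ℕ} {D : Set ℕ} [Group D]
    (h : IsCharIndex e (atomicDiagram D)) (t t' s s' : ℕ) : DiagramCondition e t t' s s' where
  total := by rw [h.one_mem_iff, h.zero_mem_iff]; exact (em _).symm
  letters := by
    rw [h.denies_iff, ← imp_iff_not_or, h.affirms_self_iff]
    rintro ⟨T, rfl⟩ x hx
    exact h.affirms_const_iff.2 (T.mem_of_mem_termWord x hx)
  one := h.affirms_self_iff.2 ⟨.one, rfl⟩
  freeEq := by
    rw [h.denies_iff, h.denies_iff, ← imp_iff_not_or, ← imp_iff_not_or, h.affirms_self_iff,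
      h.affirms_self_iff]
    rintro ⟨T, rfl⟩ ⟨S, rfl⟩
    rw [Bool.not_eq_true', Bool.eq_false_iff, ← imp_iff_not_or, freeEq_iff]
    exact fun h1 => h.affirms_iff.2 ⟨T, S, rfl, rfl, GroupTerm.eval_eq h1⟩
  dom := by
    rw [h.denies_iff, ← imp_iff_not_or, h.affirms_iff, h.affirms_self_iff, h.affirms_self_iff]
    rintro ⟨T, S, hT, hS, -⟩
    exact ⟨⟨T, hT⟩, S, hS⟩
  trans := by
    simp only [h.denies_iff, ← imp_iff_not_or, h.affirms_iff]
    rintro ⟨T, S, rfl, rfl, h1⟩ ⟨T', S', rfl, h2, h3⟩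
    rw [GroupTerm.code_injective h2] at h3
    exact ⟨T, T', rfl, rfl, h1.trans h3.symm⟩
  mul := by
    simp only [h.denies_iff, ← imp_iff_not_or, h.affirms_iff]
    rintro ⟨T, T', rfl, rfl, h1⟩ ⟨S, S', rfl, rfl, h2⟩
    exact ⟨.mul T S, .mul T' S', rfl, rfl, congrArg₂ (· * ·) h1 h2⟩
  inv := by
    simp only [h.denies_iff, ← imp_iff_not_or, h.affirms_iff]
    rintro ⟨T, T', rfl, rfl, h1⟩
    exact ⟨.inv T, .inv T', rfl, rfl, congrArg (·⁻¹) h1⟩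
  const := by
    rw [h.denies_iff, ← imp_iff_not_or, h.affirms_self_iff]
    rintro ⟨T, rfl⟩
    exact ⟨T.eval, h.affirms_iff.2 ⟨T, .const T.eval, rfl, rfl, rfl⟩⟩
  const_inj := by
    rw [h.denies_iff, ← imp_iff_not_or, beq_iff_eq]
    intro h1
    obtain ⟨T, S, hT, hS, h2⟩ := h.affirms_iff.1 h1
    cases T <;> simp only [GroupTerm.code] at hT <;> first | omega | skip
    cases S <;> simp only [GroupTerm.code] at hS <;> first | omega | skip
    have := congrArg Subtype.val h2
    simp only [GroupTerm.eval] at this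
    omega
  of_ne := by
    rw [h.zero_mem_iff, h.affirms_self_iff, h.affirms_self_iff, h.denies_iff, ← imp_iff_not_or,
      h.affirms_iff]
    rintro ⟨T, S, ⟨-, h1⟩ | ⟨h1, h2⟩⟩
    · rw [codeEq] at h1; omega
    · rw [codeNe] at h2
      obtain ⟨rfl, rfl⟩ := Nat.pair_eq_pair.1
        (show Nat.pair t s = Nat.pair T.code S.code by omega)
      refine ⟨⟨T, rfl⟩, ⟨S, rfl⟩, ?_⟩
      rintro ⟨T', S', hT, hS, h3⟩
      rw [GroupTerm.code_injective hT, GroupTerm.code_injective hS] at h3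
      exact h1 h3
  ne := by
    rw [h.denies_iff, h.denies_iff, ← imp_iff_not_or, ← imp_iff_not_or, h.affirms_self_iff,
      h.affirms_self_iff, h.one_mem_iff]
    rintro ⟨T, rfl⟩ ⟨S, rfl⟩
    by_cases h1 : T.eval = S.eval
    · exact Or.inl (h.affirms_iff.2 ⟨T, S, rfl, rfl, h1⟩)
    · exact Or.inr (codeNe_mem_atomicDiagram.2 h1)

/-- A term model: closed terms modulo affirmed equality form a group in which every element is named
by exactly one constant, so the structure can be carried over to the set of constants. -/
theorem exists_isCharIndex_of_diagramCondition {e : ℕ}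
    (h : ∀ t t' s s', DiagramCondition e t t' s s') :
    ∃ (D : Set ℕ) (_ : Group D), IsCharIndex e (atomicDiagram D) := by
  have hzero : ∀ n, 0 ∈ phi e n ↔ ¬ 1 ∈ phi e n := fun n =>
    ⟨fun h0 h1 => absurd (Part.mem_unique h0 h1) (by omega), (h n 0 0 0).total.resolve_right⟩
  have hden : ∀ t s, Denies e t s ↔ ¬ Affirms e t s := fun t s => hzero _
  let D : Set ℕ := {x | Affirms e (3 * x + 1) (3 * x + 1)}
  have hmul : ∀ t t' s s', Affirms e t t' → Affirms e s s' →
      Affirms e (3 * Nat.pair t s + 3) (3 * Nat.pair t' s' + 3) := by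
    intro t t' s s'
    have := (h t t' s s').mul
    rw [hden, hden] at this
    tauto
  have hinv : ∀ t t', Affirms e t t' → Affirms e (3 * t + 2) (3 * t' + 2) := by
    intro t t'
    have := (h t t' 0 0).inv
    rw [hden] at this
    tauto
  have htrans : ∀ t t' s, Affirms e t s → Affirms e t' s → Affirms e t t' := by
    intro t t' s
    have := (h t t' s 0).trans
    rw [hden, hden] at this
    tauto
  have hrefl : ∀ T : GroupTerm D, Affirms e T.code T.code := by
    intro T
    induction T with
    | const x => exact x.2
    | one => exact (h 0 0 0 0).one
    | inv T ih => exact hinv _ _ ih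
    | mul T S ihT ihS => exact hmul _ _ _ _ ihT ihS
  have hsymm : ∀ T S : GroupTerm D, Affirms e T.code S.code → Affirms e S.code T.code :=
    fun T S h1 => htrans _ _ _ (hrefl S) h1
  have hfree : ∀ T S : GroupTerm D, mk (termWord T.code) = mk (termWord S.code) →
      Affirms e T.code S.code := by
    intro T S h1
    have := (h T.code 0 S.code 0).freeEq
    rw [hden, hden, freeEq_iff.2 h1] at this
    have h2 := hrefl T
    have h3 := hrefl S
    simp only [Bool.not_true, Bool.false_eq_true, false_or] at this
    tauto
  have hterm : ∀ t, Affirms e t t → ∃ T : GroupTerm D, T.code = t := by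
    intro t h1
    have := (h t 0 0 0).letters
    rw [hden] at this
    exact GroupTerm.exists_code_eq t (this.resolve_left (not_not.2 h1))
  let st : Setoid (GroupTerm D) := ⟨fun T S => Affirms e T.code S.code, hrefl,
    fun {T S} => hsymm T S, fun {T S R} h1 h2 => htrans _ _ _ h1 (hsymm _ _ h2)⟩
  let _ : Mul (Quotient st) := ⟨Quotient.map₂ .mul fun _ _ h1 _ _ h2 => hmul _ _ _ _ h1 h2⟩
  let _ : One (Quotient st) := ⟨⟦.one⟧⟩
  let _ : Inv (Quotient st) := ⟨Quotient.map .inv fun _ _ h1 => hinv _ _ h1⟩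
  -- Each axiom equates two terms whose words are equal in the free group.
  let _ : Group (Quotient st) := Group.ofLeftAxioms
    (by
      rintro ⟨a⟩ ⟨b⟩ ⟨c⟩
      exact Quotient.sound (hfree _ _ (by simp [GroupTerm.code, termWord_mul])))
    (by
      rintro ⟨a⟩
      exact Quotient.sound (hfree _ _ (by simp [GroupTerm.code, termWord_mul, termWord_zero])))
    (by
      rintro ⟨a⟩
      refine Quotient.sound (hfree _ _ ?_)
      rw [GroupTerm.code, GroupTerm.code, GroupTerm.code, termWord_mul, termWord_inv, termWord_zero,
        ← FreeGroup.mul_mk, ← FreeGroup.inv_mk, inv_mul_cancel]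
      rfl)
  have hbij : Function.Bijective fun x : D => (⟦.const x⟧ : Quotient st) := by
    constructor
    · intro x y hxy
      have h1 : Affirms e (3 * x + 1) (3 * y + 1) := Quotient.exact hxy
      have h2 := (h x 0 y 0).const_inj
      rw [hden, beq_iff_eq] at h2
      exact Subtype.ext (h2.resolve_left (not_not.2 h1))
    · rintro ⟨T⟩
      have h1 := (h T.code 0 0 0).const
      rw [hden] at h1
      obtain ⟨x, hx⟩ := h1.resolve_left (not_not.2 (hrefl T))
      have h2 := (h T.code 0 (3 * x + 1) 0).dom
      rw [hden] at h2
      have h3 := (h2.resolve_left (not_not.2 hx)).2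
      exact ⟨⟨x, h3⟩, Quotient.sound (hsymm T (.const ⟨x, h3⟩) hx)⟩
  let E := Equiv.ofBijective _ hbij
  let _ : Group D := E.group
  let f : D ≃* Quotient st := E.mulEquiv
  have heval : ∀ T : GroupTerm D, f T.eval = ⟦T⟧ := by
    intro T
    induction T with
    | const x => rfl
    | one => exact map_one f
    | inv T ih => rw [GroupTerm.eval, map_inv, ih]; rfl
    | mul T S ihT ihS => rw [GroupTerm.eval, map_mul, ihT, ihS]; rfl
  have heq : ∀ T S : GroupTerm D, T.eval = S.eval ↔ Affirms e T.code S.code := by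
    intro T S
    rw [← f.injective.eq_iff, heval, heval]
    exact Quotient.eq
  refine ⟨D, inferInstance, fun n => ?_⟩
  rw [hzero]
  suffices 1 ∈ phi e n ↔ n ∈ atomicDiagram D from ⟨this.2, fun h1 h2 => h1 (this.1 h2)⟩
  have hn : 2 * Nat.pair (n / 2).unpair.1 (n / 2).unpair.2 + n % 2 = n := by
    rw [Nat.pair_unpair, Nat.div_add_mod]
  rw [mem_atomicDiagram_iff]
  generalize (n / 2).unpair.1 = t at hn ⊢
  generalize (n / 2).unpair.2 = s at hn ⊢
  have h1 := (h t 0 s 0).dom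
  have h2 := (h t 0 s 0).of_ne
  have h3 := (h t 0 s 0).ne
  rw [hden] at h1
  rw [hzero, hden] at h2
  rw [hden, hden] at h3
  constructor
  · intro h4
    rcases Nat.mod_two_eq_zero_or_one n with h5 | h5 <;> rw [h5] at hn <;> rw [← hn] at h4
    · obtain ⟨h6, h7⟩ := h1.resolve_left (not_not.2 h4)
      obtain ⟨T, rfl⟩ := hterm t h6
      obtain ⟨S, rfl⟩ := hterm s h7
      exact ⟨T, S, rfl, rfl, iff_of_true h5 ((heq T S).2 h4)⟩
    · obtain ⟨h6, h7, h8⟩ := h2.resolve_left (not_not.2 h4)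
      obtain ⟨T, rfl⟩ := hterm t h6
      obtain ⟨S, rfl⟩ := hterm s h7
      exact ⟨T, S, rfl, rfl, iff_of_false (by omega) fun h9 => h8 ((heq T S).1 h9)⟩
  · rintro ⟨T, S, rfl, rfl, h4⟩
    rw [heq] at h4
    rcases Nat.mod_two_eq_zero_or_one n with h5 | h5 <;> rw [h5] at hn <;> rw [← hn]
    · exact h4.1 h5
    · have h6 : ¬ Affirms e T.code S.code := fun h6 => by have := h4.2 h6; omega
      exact ((h3.resolve_left (not_not.2 (hrefl T))).resolve_left
        (not_not.2 (hrefl S))).resolve_left h6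

theorem isPi2_setOf_exists_isCharIndex :
    IsPi2 {e | ∃ (D : Set ℕ) (_ : Group D), IsCharIndex e (atomicDiagram D)} :=
  isPi2_of_forall_re (P := fun x : ℕ × ℕ × ℕ × ℕ × ℕ =>
    DiagramCondition x.1 x.2.1 x.2.2.1 x.2.2.2.1 x.2.2.2.2) rePred_diagramCondition fun _ =>
    ⟨fun ⟨_, _, h⟩ _ => h.diagramCondition _ _ _ _, fun h =>
      exists_isCharIndex_of_diagramCondition fun t t' s s' => h (t, t', s, s')⟩

end DiagramIndices

/-! ### Recognizing free nilpotent groups -/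

section Recognition

open Subgroup
open FreeGroup (mk)
open scoped commutatorElement

theorem commutator_mul_center_left {G : Type*} [Group G] {z : G} (hz : z ∈ center G) (x g : G) :
    ⁅x * z, g⁆ = ⁅x, g⁆ := by
  have h := mem_center_iff.1 hz g
  calc ⁅x * z, g⁆ = x * (z * g) * z⁻¹ * x⁻¹ * g⁻¹ := by rw [commutatorElement_def]; group
    _ = ⁅x, g⁆ := by rw [← h, commutatorElement_def]; group

/-- A subgroup that generates a nilpotent group modulo commutators is the whole group. -/
theorem eq_top_of_sup_commutator_eq_top {G : Type*} [Group G] [Group.IsNilpotent G]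
    {X : Subgroup G} (h : X ⊔ commutator G = ⊤) : X = ⊤ := by
  revert X
  refine Group.nilpotent_center_quotient_ind
    (P := fun G _ _ => ∀ {X : Subgroup G}, X ⊔ commutator G = ⊤ → X = ⊤) G ?_ ?_
  · intro G _ _ X _
    exact Subsingleton.elim _ _
  · intro G _ _ ih X h
    have h1 : X.map (QuotientGroup.mk' (center G)) = ⊤ := by
      refine ih (top_le_iff.1 ?_)
      rw [← map_top_of_surjective _ (QuotientGroup.mk'_surjective (center G)), ← h, Subgroup.map_sup]
      refine sup_le_sup_left ?_ _
      rw [_root_.commutator_def, map_commutator]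
      exact commutator_mono le_top le_top
    have h2 : X ⊔ center G = ⊤ := by
      have h3 := comap_map_eq (QuotientGroup.mk' (center G)) X
      rwa [h1, comap_top, QuotientGroup.ker_mk', eq_comm] at h3
    -- By induction `X` and the center generate `G`. Central factors drop out of commutators, so all
    -- commutators are commutators of elements of `X`.
    have h3 : commutator G ≤ X := by
      rw [_root_.commutator_def, commutator_le]
      intro g _ k _
      obtain ⟨x, hx, z, hz, rfl⟩ := mem_sup_of_normal_right.1 (h2 ▸ mem_top g)
      obtain ⟨y, hy, w, hw, rfl⟩ := mem_sup_of_normal_right.1 (h2 ▸ mem_top k)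
      rw [commutator_mul_center_left hz, ← commutatorElement_inv, commutator_mul_center_left hw,
        commutatorElement_inv]
      exact mul_mem (mul_mem (mul_mem hx hy) (inv_mem hx)) (inv_mem hy)
    rwa [sup_eq_left.2 h3] at h

theorem expSum_of (i j : ℕ) :
    expSum i (FreeGroup.of j) = if j = i then Multiplicative.ofAdd 1 else 1 := by
  simp [expSum]

/-- Homomorphisms to abelian groups in terms of the exponent sums. -/
theorem map_eq_prod_zpow {A : Type*} [CommGroup A] (h : FreeGroup ℕ →* A) {n : ℕ}
    (hn : ∀ j, n ≤ j → h (FreeGroup.of j) = 1) (w : FreeGroup ℕ) :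
    h w = ∏ j ∈ Finset.range n, h (FreeGroup.of j) ^ (expSum j w).toAdd := by
  have : h = ∏ j ∈ Finset.range n, (zpowersHom A (h (FreeGroup.of j))).comp (expSum j) := by
    ext i
    simp only [MonoidHom.finsetProd_apply, MonoidHom.comp_apply, expSum_of, zpowersHom_apply]
    by_cases hi : i < n
    · rw [Finset.prod_eq_single i]
      · simp
      · intro j _ hj
        simp [hj.symm]
      · simp [hi]
    · rw [hn i (not_lt.1 hi), Finset.prod_eq_one]
      intro j hj
      have : i ≠ j := by have := Finset.mem_range.1 hj; omega
      simp [this]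
  conv_lhs => rw [this]
  simp only [MonoidHom.finsetProd_apply, MonoidHom.comp_apply, zpowersHom_apply]

/-- The evaluation of words at a tuple. -/
def evalAt {B : Type*} [Group B] (xs : List B) : FreeGroup ℕ →* B :=
  FreeGroup.lift fun j => xs.getD j 1

variable {B : Type*} [Group B] {p m : ℕ}

theorem evalAt_of (xs : List B) (j : ℕ) : evalAt xs (FreeGroup.of j) = xs.getD j 1 := by
  simp [evalAt]

theorem evalAt_of_le {xs : List B} {j : ℕ} (hj : xs.length ≤ j) :
    evalAt xs (FreeGroup.of j) = 1 := by
  rw [evalAt_of, List.getD_eq_default _ _ hj]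

theorem liftN_comp_evalN (hB : lcs B p = ⊥) {xs : List B} (h : xs.length ≤ m) :
    (liftN hB fun j => xs.getD j 1).comp (evalN p m) = evalAt xs := by
  ext j
  rw [MonoidHom.comp_apply]
  by_cases hj : j < m
  · rw [liftN_evalN_of _ _ hj, evalAt_of]
  · rw [evalN_of_le p m (not_lt.1 hj), map_one, evalAt_of_le (by omega)]

/-- Every finite set of elements lies in a subgroup that is generated by at most `m` elements. -/
def LocallyGenerated (m : ℕ) (B : Type*) [Group B] : Prop :=
  ∀ xs : List B, ∃ zs : List B, zs.length ≤ m ∧ ∀ x ∈ xs, ∃ l : Word, evalAt zs (mk l) = x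

/-- The elements of the tuple satisfy no relations beyond those of the free nilpotent group, and
they are linearly independent modulo commutators and `q`-th powers. -/
structure IsIndependent (p m : ℕ) (xs : List B) : Prop where
  evalN_eq_one : ∀ l : Word, evalAt xs (mk l) = 1 → evalN p m (mk l) = 1
  dvd : ∀ (zs : List B) (l : Word) (q : ℕ), evalAt (xs ++ zs) (mk l) = 1 →
    (∀ j < zs.length, (q : ℤ) ∣ (expSum (m + j) (mk l)).toAdd) →
      ∀ i < m, (q : ℤ) ∣ (expSum i (mk l)).toAdd

/-! ### The change of tuples and its matrix of exponent sums -/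

section Basis

variable (xs zs : List B) (l : ℕ → Word)

/-- The relation that expresses a product of powers of the tuple `xs` in the tuple `zs`. -/
def relator (m : ℕ) (l : ℕ → Word) (w : FreeGroup ℕ) : FreeGroup ℕ :=
  FreeGroup.lift (fun i => if i < m then FreeGroup.of i else 1) w *
    (FreeGroup.lift (fun j => if j < m then FreeGroup.of (m + j) else 1)
      (FreeGroup.lift (fun i => if i < m then mk (l i) else 1) w))⁻¹

variable {xs zs l}

/-- Letters below `m` stand for `xs` and letters `m + j` for `zs`; both factors of the relator then
compute the value of `w` at `xs`. -/
theorem evalAt_relator (hx : xs.length = m) (hz : zs.length ≤ m)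
    (hl : ∀ i < m, evalAt zs (mk (l i)) = xs.getD i 1) (w : FreeGroup ℕ) :
    evalAt (xs ++ zs) (relator m l w) = 1 := by
  have h1 : ∀ w, evalAt (xs ++ zs)
      (FreeGroup.lift (fun j => if j < m then FreeGroup.of (m + j) else 1) w) = evalAt zs w := by
    intro w
    rw [← MonoidHom.comp_apply]
    congr 1
    ext j
    rw [MonoidHom.comp_apply, FreeGroup.lift_apply_of]
    by_cases hj : j < m
    · rw [if_pos hj, evalAt_of, evalAt_of, List.getD_append_right _ _ _ _ (by omega), hx,
        Nat.add_sub_cancel_left]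
    · rw [if_neg hj, map_one, evalAt_of_le (by omega)]
  rw [relator, map_mul, map_inv, h1, mul_inv_eq_one, ← MonoidHom.comp_apply, ← MonoidHom.comp_apply]
  congr 1
  ext i
  rw [MonoidHom.comp_apply, MonoidHom.comp_apply, FreeGroup.lift_apply_of, FreeGroup.lift_apply_of]
  by_cases hi : i < m
  · rw [if_pos hi, if_pos hi, evalAt_of, hl i hi, List.getD_append _ _ _ _ (by omega)]
  · rw [if_neg hi, if_neg hi, map_one, map_one]

theorem expSum_relator_of_lt {i : ℕ} (hi : i < m) (w : FreeGroup ℕ) :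
    expSum i (relator m l w) = expSum i w := by
  have h1 : ∀ w, expSum i
      (FreeGroup.lift (fun j => if j < m then FreeGroup.of (m + j) else 1) w) = 1 := by
    refine DFunLike.congr_fun (f := (expSum i).comp (FreeGroup.lift _)) (g := 1) ?_
    ext j
    rw [MonoidHom.comp_apply, FreeGroup.lift_apply_of]
    by_cases hj : j < m
    · have : m + j ≠ i := by omega
      simp [hj, expSum_of, this]
    · simp [hj]
  rw [relator, map_mul, map_inv, h1, inv_one, mul_one, ← MonoidHom.comp_apply]
  congr 1
  ext j
  rw [MonoidHom.comp_apply, FreeGroup.lift_apply_of]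
  by_cases hj : j < m
  · rw [if_pos hj]
  · have : j ≠ i := by omega
    simp [hj, expSum_of, this]

theorem expSum_lift_mk (j : ℕ) (w : FreeGroup ℕ) :
    (expSum j (FreeGroup.lift (fun i => if i < m then mk (l i) else 1) w)).toAdd =
      ∑ i : Fin m, (expSum i w).toAdd * (expSum j (mk (l i))).toAdd := by
  have h := map_eq_prod_zpow ((expSum j).comp
    (FreeGroup.lift (fun i => if i < m then mk (l i) else 1))) (n := m) (fun i hi => by
      simp [not_lt.2 hi]) w
  rw [MonoidHom.comp_apply] at h
  rw [h, toAdd_prod, Finset.sum_range]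
  refine Finset.sum_congr rfl fun i _ => ?_
  rw [toAdd_zpow, MonoidHom.comp_apply, FreeGroup.lift_apply_of, if_pos i.2, smul_eq_mul]

theorem expSum_relator_add {j : ℕ} (hj : j < m) (w : FreeGroup ℕ) :
    (expSum (m + j) (relator m l w)).toAdd =
      -∑ i : Fin m, (expSum i w).toAdd * (expSum j (mk (l i))).toAdd := by
  have h1 : ∀ w, expSum (m + j)
      (FreeGroup.lift (fun i => if i < m then FreeGroup.of i else 1) w) = 1 := by
    refine DFunLike.congr_fun (f := (expSum (m + j)).comp (FreeGroup.lift _)) (g := 1) ?_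
    ext i
    rw [MonoidHom.comp_apply, FreeGroup.lift_apply_of]
    by_cases hi : i < m
    · have : i ≠ m + j := by omega
      simp [hi, expSum_of, this]
    · simp [hi]
  have h2 : ∀ w, expSum (m + j)
      (FreeGroup.lift (fun j => if j < m then FreeGroup.of (m + j) else 1) w) = expSum j w := by
    intro w
    rw [← MonoidHom.comp_apply]
    congr 1
    ext i
    rw [MonoidHom.comp_apply, FreeGroup.lift_apply_of]
    by_cases hi : i < m
    · simp [hi, expSum_of]
    · have : i ≠ j := by omega
      simp [hi, expSum_of, this]
  rw [relator, map_mul, map_inv, h1, h2, one_mul, toAdd_inv, expSum_lift_mk]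

/-- The exponent sums of an independent tuple in a tuple of the same length form an invertible
matrix. -/
theorem isUnit_det_of_isIndependent (h : IsIndependent p m xs) (hx : xs.length = m)
    (hz : zs.length ≤ m) (hl : ∀ i < m, evalAt zs (mk (l i)) = xs.getD i 1) :
    IsUnit (Matrix.of fun i j : Fin m => (expSum j (mk (l i))).toAdd).det := by
  set W := Matrix.of fun i j : Fin m => (expSum j (mk (l i))).toAdd with hW
  by_contra hdet
  -- A nonunit determinant vanishes modulo some prime `q`, and a nonzero vector `v` is killed by the
  -- matrix modulo `q`. A word with exponent sums lifting `v` has a relator whose sums at `zs` are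
  -- divisible by `q`, so independence makes `v` zero.
  obtain ⟨q, hq, hqd⟩ := Nat.exists_prime_and_dvd fun h => hdet (Int.isUnit_iff_natAbs_eq.2 h)
  have := Fact.mk hq
  have h0 : (W.map (Int.castRingHom (ZMod q))).det = 0 := by
    rw [← RingHom.mapMatrix_apply, ← RingHom.map_det, eq_intCast, ZMod.intCast_zmod_eq_zero_iff_dvd]
    exact Int.natCast_dvd.2 hqd
  obtain ⟨v, hv, hvW⟩ := Matrix.exists_vecMul_eq_zero_iff.2 h0
  choose a ha using fun i => ZMod.intCast_surjective (v i)
  obtain ⟨w, hw⟩ := exists_expSum_eq m a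
  obtain ⟨r, hr⟩ := Quot.exists_rep (relator m l w)
  have hr : mk r = relator m l w := hr
  refine hv (funext fun i => ?_)
  have h1 := h.dvd zs r q (by rw [hr]; exact evalAt_relator hx hz hl w) (fun j hj => by
    rw [hr, expSum_relator_add (by omega), dvd_neg]
    have h2 := congrFun hvW ⟨j, by omega⟩
    simp only [Matrix.vecMul, dotProduct, Matrix.map_apply, hW, Matrix.of_apply, ← ha, eq_intCast,
      Pi.zero_apply] at h2
    rw [← ZMod.intCast_zmod_eq_zero_iff_dvd, Int.cast_sum, ← h2]
    refine Finset.sum_congr rfl fun i _ => ?_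
    rw [hw, toAdd_ofAdd, Int.cast_mul]) i i.2
  rw [hr, expSum_relator_of_lt i.2, hw, toAdd_ofAdd, ← ZMod.intCast_zmod_eq_zero_iff_dvd, ha] at h1
  exact h1

/-- A tuple whose exponent sums form an invertible matrix generates the free nilpotent group. -/
theorem liftN_surjective_of_isUnit_det
    (h : IsUnit (Matrix.of fun i j : Fin m => (expSum j (mk (l i))).toAdd).det) :
    Function.Surjective (liftN (lcs_freeNilpotentGroup p m) (fun i => evalN p m (mk (l i))) :
      FreeNilpotentGroup p m →* FreeNilpotentGroup p m) := by
  set W := Matrix.of fun i j : Fin m => (expSum j (mk (l i))).toAdd with hW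
  set α : FreeNilpotentGroup p m →* FreeNilpotentGroup p m :=
    liftN (lcs_freeNilpotentGroup p m) fun i => evalN p m (mk (l i)) with hα
  have : Group.IsNilpotent (FreeNilpotentGroup p m) :=
    Subgroup.nilpotent_iff_lowerCentralSeries.2 ⟨p, lcs_freeNilpotentGroup p m⟩
  rw [← MonoidHom.range_eq_top]
  -- In a nilpotent group it suffices to generate modulo commutators, where only the exponent sums
  -- matter.
  refine eq_top_of_sup_commutator_eq_top (top_le_iff.1 ?_)
  rw [← Abelianization.ker_of, ← comap_map_eq]
  have hcomp : ∀ w, α (evalN p m w) =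
      evalN p m (FreeGroup.lift (fun i => if i < m then mk (l i) else 1) w) := by
    intro w
    rw [← MonoidHom.comp_apply, ← MonoidHom.comp_apply]
    congr 1
    ext i
    rw [MonoidHom.comp_apply, MonoidHom.comp_apply, FreeGroup.lift_apply_of]
    by_cases hi : i < m
    · rw [if_pos hi, hα, liftN_evalN_of _ _ hi]
    · rw [if_neg hi, evalN_of_le p m (not_lt.1 hi), map_one, map_one]
  have hab := map_eq_prod_zpow (Abelianization.of.comp (evalN p m)) (n := m) fun j hj => by
    simp [evalN_of_le p m hj]
  have key : (⊤ : Subgroup (FreeGroup ℕ)) ≤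
      ((α.range.map Abelianization.of).comap Abelianization.of).comap (evalN p m) := by
    rw [← FreeGroup.closure_range_of, closure_le]
    rintro _ ⟨i, rfl⟩
    by_cases hi : i < m
    · obtain ⟨w, hw⟩ := exists_expSum_eq m (W⁻¹ ⟨i, hi⟩)
      refine ⟨_, ⟨evalN p m w, rfl⟩, ?_⟩
      rw [hcomp]
      refine (hab _).trans (Eq.trans ?_ (hab (FreeGroup.of i)).symm)
      refine Finset.prod_congr rfl fun j hj => ?_
      congr 1
      rw [expSum_lift_mk, expSum_of]
      have hj := Finset.mem_range.1 hj
      have h1 := congrFun (congrFun (Matrix.nonsing_inv_mul W h) ⟨i, hi⟩) ⟨j, hj⟩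
      rw [Matrix.mul_apply, Matrix.one_apply] at h1
      simp only [hw, toAdd_ofAdd]
      refine h1.trans ?_
      by_cases hij : i = j <;> simp [hij]
    · rw [SetLike.mem_coe, mem_comap, evalN_of_le p m (not_lt.1 hi)]
      exact one_mem _
  rintro x -
  obtain ⟨w, rfl⟩ := evalN_surjective p m x
  exact key (mem_top w)

end Basis

/-- The map sending the generators to `xs` is injective by the first clause of independence. For
surjectivity at `y`, a tuple `zs` that generates both `y` and `xs` is taken; the map to `xs` is the
map to `zs` after a surjection of the free nilpotent group, so it also reaches `y`. -/
theorem nonempty_mulEquiv_of_isIndependent (hB : lcs B p = ⊥) (hgen : LocallyGenerated m B)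
    {xs : List B} (hx : xs.length = m) (h : IsIndependent p m xs) :
    Nonempty (B ≃* FreeNilpotentGroup p m) := by
  have hΦ := liftN_comp_evalN (m := m) hB hx.le
  refine ⟨(MulEquiv.ofBijective (liftN hB fun j => xs.getD j 1) ⟨?_, ?_⟩).symm⟩
  · rw [injective_iff_map_eq_one]
    intro n hn
    obtain ⟨l, rfl⟩ := exists_evalN_mk p m n
    rw [← MonoidHom.comp_apply, hΦ] at hn
    exact h.evalN_eq_one l hn
  · intro y
    obtain ⟨zs, hz, hzs⟩ := hgen (y :: xs)
    have hΨ := liftN_comp_evalN (m := m) hB hz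
    have : ∀ i, ∃ l : Word, i < m → evalAt zs (mk l) = xs.getD i 1 := by
      intro i
      by_cases hi : i < m
      · have hi' : i < xs.length := by omega
        obtain ⟨l, hl⟩ := hzs (xs.getD i 1) (List.mem_cons_of_mem _ (by simp [hi']))
        exact ⟨l, fun _ => hl⟩
      · exact ⟨[], fun h => absurd h hi⟩
    choose l hl using this
    have hα := liftN_surjective_of_isUnit_det (p := p) (isUnit_det_of_isIndependent h hx hz hl)
    obtain ⟨r, hr⟩ := hzs y List.mem_cons_self
    obtain ⟨n, hn⟩ := hα (evalN p m (mk r))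
    refine ⟨n, ?_⟩
    have hcomp : (liftN (m := m) hB fun j => xs.getD j 1) = (liftN hB fun j => zs.getD j 1).comp
        (liftN (lcs_freeNilpotentGroup p m) fun i => evalN p m (mk (l i))) := by
      refine evalN_hom_ext fun i hi => ?_
      rw [liftN_evalN_of _ _ hi, MonoidHom.comp_apply, liftN_evalN_of _ _ hi,
        ← MonoidHom.comp_apply, hΨ, hl i hi]
    rw [hcomp, MonoidHom.comp_apply, hn, ← MonoidHom.comp_apply, hΨ, hr]

/-- A characterization of the free nilpotent group. -/
theorem nonempty_mulEquiv_freeNilpotentGroup_iff (hp : 1 ≤ p) :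
    Nonempty (B ≃* FreeNilpotentGroup p m) ↔
      (lcs B p = ⊥ ∧ LocallyGenerated m B) ∧ ∃ xs : List B, xs.length = m ∧ IsIndependent p m xs := by
  refine ⟨?_, fun ⟨⟨hB, hgen⟩, xs, hx, h⟩ => nonempty_mulEquiv_of_isIndependent hB hgen hx h⟩
  rintro ⟨f⟩
  let xs := (List.range m).map fun i => f.symm (evalN p m (FreeGroup.of i))
  have hx : xs.length = m := by simp [xs]
  have heval : ∀ w, f (evalAt xs w) = evalN p m w := by
    intro w
    rw [← MulEquiv.coe_toMonoidHom, ← MonoidHom.comp_apply]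
    congr 1
    ext i
    rw [MonoidHom.comp_apply, evalAt_of]
    by_cases hi : i < m
    · simp [xs, hi]
    · rw [List.getD_eq_default _ _ (by omega), map_one, evalN_of_le p m (not_lt.1 hi)]
  refine ⟨⟨?_, fun ys => ⟨xs, hx.le, fun y _ => ?_⟩⟩, xs, hx, fun l hl => ?_, ?_⟩
  · rw [eq_bot_iff]
    intro x hx
    have h1 := map_mem_lcs f.toMonoidHom hx
    rw [lcs_freeNilpotentGroup, mem_bot] at h1
    exact (map_eq_one_iff f f.injective).1 h1
  · obtain ⟨l, hl⟩ := exists_evalN_mk p m (f y)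
    exact ⟨l, f.injective ((heval _).trans hl)⟩
  · rw [← heval, hl, map_one]
  · intro zs l q hl hq i hi
    -- The `i`-th coordinate of the relation says that the exponent sum of letter `i` plus a
    -- combination of the exponent sums at `zs` is zero; divisibility passes from the latter to the
    -- former.
    have h1 := map_eq_prod_zpow ((coordN hp i).comp (f.toMonoidHom.comp (evalAt (xs ++ zs))))
      (n := m + zs.length) (fun j hj => by
        rw [MonoidHom.comp_apply, MonoidHom.comp_apply, evalAt_of_le (by simp [hx]; omega),
          map_one, map_one]) (mk l)
    rw [MonoidHom.comp_apply, MonoidHom.comp_apply, hl, map_one, map_one] at h1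
    have h2 := congrArg Multiplicative.toAdd h1
    rw [toAdd_one, toAdd_prod, Finset.sum_range_add] at h2
    have h3 : ∀ j < m, ((coordN hp i).comp (f.toMonoidHom.comp (evalAt (xs ++ zs))))
        (FreeGroup.of j) = if j = i then Multiplicative.ofAdd 1 else 1 := by
      intro j hj
      have h4 : evalAt (xs ++ zs) (FreeGroup.of j) = evalAt xs (FreeGroup.of j) := by
        rw [evalAt_of, evalAt_of, List.getD_append _ _ _ _ (by omega)]
      rw [MonoidHom.comp_apply, MonoidHom.comp_apply, h4]
      change coordN hp i (f _) = _
      rw [heval, coordN_evalN hp hi, expSum_of]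
    rw [Finset.sum_eq_single_of_mem i (Finset.mem_range.2 hi) (fun j hj hji => by
      rw [h3 j (Finset.mem_range.1 hj), if_neg hji, one_zpow, toAdd_one]), h3 i hi, if_pos rfl,
      toAdd_zpow, toAdd_ofAdd, smul_eq_mul, mul_one] at h2
    rw [← dvd_add_left (Finset.dvd_sum fun j hj => ?_), ← h2]
    · exact dvd_zero _
    · rw [toAdd_zpow, smul_eq_mul]
      exact Dvd.dvd.mul_right (hq j (Finset.mem_range.1 hj)) _

end Recognition

/-! ### The complexity of the index set -/

section UpperBound

open Subgroup
open FreeGroup (mk invRev)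

/-- The Gödel number of a term that represents a word. -/
def wordCode (l : Word) : ℕ :=
  l.foldr (fun a c => 3 * Nat.pair (bif a.2 then 3 * a.1 + 1 else 3 * (3 * a.1 + 1) + 2) c + 3) 0

theorem termWord_wordCode (l : Word) : termWord (wordCode l) = l := by
  induction l with
  | nil => exact termWord_zero
  | cons a l ih =>
    change termWord (3 * Nat.pair _ (wordCode l) + 3) = _
    rw [termWord_mul, ih]
    rcases a with ⟨x, _ | _⟩
    · rw [cond_false, termWord_inv, termWord_const]; rfl
    · rw [cond_true, termWord_const]; rfl

@[fun_prop] theorem Primrec.wordCode_comp {α : Type*} [Primcodable α] {f : α → Word}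
    (hf : Primrec f) : Primrec fun x => wordCode (f x) :=
  Primrec.list_foldr hf (Primrec.const 0) (h := fun _ (x : (ℕ × Bool) × ℕ) =>
    3 * Nat.pair (bif x.1.2 then 3 * x.1.1 + 1 else 3 * (3 * x.1.1 + 1) + 2) x.2 + 3) (by
      unfold Primrec₂; fun_prop)

/-- The word obtained by replacing the letters by the constants in a list. -/
def instantiate (xs : List ℕ) (l : Word) : Word := substList (xs.map fun x => [(x, true)]) l

@[fun_prop] theorem Primrec.instantiate_comp {α : Type*} [Primcodable α] {f : α → List ℕ}
    {g : α → Word} (hf : Primrec f) (hg : Primrec g) :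
    Primrec fun x => instantiate (f x) (g x) := by
  have : Primrec fun x => (f x).map fun x => [(x, true)] :=
    Primrec.list_map hf (g := fun _ x => [(x, true)]) (by unfold Primrec₂; fun_prop)
  exact this.substList_comp hg

/-- `φ_e` affirms that a word has the value `1` at a tuple. -/
def Holds (e : ℕ) (xs : List ℕ) (l : Word) : Prop := Affirms e (wordCode (instantiate xs l)) 0

theorem rePred_holds {α : Type*} [Primcodable α] {e : α → ℕ} {f : α → List ℕ} {g : α → Word}
    (he : Primrec e) (hf : Primrec f) (hg : Primrec g) :
    REPred fun x => Holds (e x) (f x) (g x) :=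
  rePred_affirms he.to_comp (by fun_prop : Primrec _).to_comp (Computable.const 0)

/-- `φ_e` affirms that the entries of a list belong to the universe. -/
def Valid (e : ℕ) (xs : List ℕ) : Prop := ∀ x ∈ xs, Affirms e (3 * x + 1) (3 * x + 1)

/-- `φ_e` denies that all entries of a list belong to the universe. -/
def Invalid (e : ℕ) (xs : List ℕ) : Prop :=
  ∃ y : List ℕ × ℕ × List ℕ, (xs == y.1 ++ y.2.1 :: y.2.2) = true ∧
    Denies e (3 * y.2.1 + 1) (3 * y.2.1 + 1)

theorem rePred_valid {α : Type*} [Primcodable α] {e : α → ℕ} {f : α → List ℕ}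
    (he : Primrec e) (hf : Primrec f) : REPred fun x => Valid (e x) (f x) := by
  have h1 : REPred fun x : ℕ × ℕ => Affirms x.1 (3 * x.2 + 1) (3 * x.2 + 1) :=
    rePred_affirms (by fun_prop) (by fun_prop) (by fun_prop)
  exact h1.forall_mem_list.comp (he.to_comp.pair hf.to_comp)

theorem rePred_invalid : REPred fun x : ℕ × List ℕ => Invalid x.1 x.2 := by
  have h1 : Primrec fun z : (ℕ × List ℕ) × List ℕ × ℕ × List ℕ =>
      z.1.2 == z.2.1 ++ z.2.2.1 :: z.2.2.2 := by fun_prop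
  have h2 : REPred fun z : (ℕ × List ℕ) × List ℕ × ℕ × List ℕ =>
      Denies z.1.1 (3 * z.2.2.1 + 1) (3 * z.2.2.1 + 1) :=
    rePred_denies (by fun_prop) (by fun_prop) (by fun_prop)
  exact ((REPred.of_bool h1.to_comp).and h2).exists_comp

/-! ### The meaning of the r.e. conditions in the group that is described -/

section Semantics

variable {e : ℕ} {D : Set ℕ} [Group D] (h : IsCharIndex e (atomicDiagram D))
include h

theorem valid_iff {xs : List ℕ} : Valid e xs ↔ ∃ ys : List D, ys.map (↑) = xs := by
  simp only [Valid, h.affirms_const_iff]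
  constructor
  · intro h1
    lift xs to List D using h1
    exact ⟨xs, rfl⟩
  · rintro ⟨ys, rfl⟩ x hx
    obtain ⟨y, -, rfl⟩ := List.mem_map.1 hx
    exact y.2

theorem invalid_iff {xs : List ℕ} : Invalid e xs ↔ ¬ ∃ ys : List D, ys.map (↑) = xs := by
  rw [← valid_iff h]
  simp only [Invalid, Valid, h.denies_iff, beq_iff_eq]
  push Not
  constructor
  · rintro ⟨⟨as, x, bs⟩, rfl, hx⟩
    exact ⟨x, by simp, hx⟩
  · rintro ⟨x, hx, hx'⟩
    obtain ⟨as, bs, rfl⟩ := List.append_of_mem hx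
    exact ⟨⟨as, x, bs⟩, rfl, hx'⟩

theorem holds_iff (ys : List D) (l : Word) :
    Holds e (ys.map (↑)) l ↔ evalAt ys (mk l) = 1 := by
  classical
  let a : ℕ → D := fun j => if hj : j ∈ D then ⟨j, hj⟩ else 1
  have ha : ∀ x : D, MonoidHom.id D x = a x := by simp [a]
  have hget : ∀ j, ((ys.map ((↑) : D → ℕ)).map fun x => [(x, true)]).getD j [] =
      if hj : j < ys.length then [((ys[j] : ℕ), true)] else [] := by
    intro j
    by_cases hj : j < ys.length
    · simp [hj]
    · rw [dif_neg hj, List.getD_eq_default _ _ (by simpa using hj)]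
  -- Letters beyond the tuple become the empty word, so no constant outside `D` occurs and the
  -- number codes a term over `D`.
  have hlet : ∀ x ∈ termWord (wordCode (instantiate (ys.map (↑)) l)), x.1 ∈ D := by
    rw [termWord_wordCode]
    intro x hx
    obtain ⟨b, -, hb⟩ := List.mem_flatMap.1 hx
    beta_reduce at hb
    rw [hget] at hb
    by_cases hj : b.1 < ys.length
    · rw [dif_pos hj] at hb
      rcases b with ⟨j, _ | _⟩ <;> simp [invRev] at hb <;> rw [hb] <;> exact (ys[j]).2
    · rw [dif_neg hj] at hb
      rcases b with ⟨j, _ | _⟩ <;> simp [invRev] at hb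
  obtain ⟨T, hT⟩ := GroupTerm.exists_code_eq _ hlet
  have heval : T.eval = evalAt ys (mk l) := by
    refine (T.map_eval (MonoidHom.id D) a ha).trans ?_
    rw [hT, termWord_wordCode, instantiate, substList, hom_mk_expand, evalAt]
    congr 2
    funext j
    rw [hget]
    by_cases hj : j < ys.length
    · rw [dif_pos hj]
      simp [a, hj]
    · rw [dif_neg hj, List.getD_eq_default _ _ (by simpa using hj)]
      exact map_one _
  rw [Holds, h.affirms_iff, ← heval]
  constructor
  · rintro ⟨T', S, hT', hS, hTS⟩
    rw [GroupTerm.code_injective (hT'.trans hT.symm),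
      GroupTerm.code_injective (hS.trans (show 0 = (GroupTerm.one : GroupTerm D).code from rfl))]
      at hTS
    exact hTS
  · exact fun h1 => ⟨T, .one, hT, rfl, h1⟩

/-- Relativizes a universal quantifier to tuples of the universe while keeping the matrix r.e.,
which a plain negation of `Valid` would not show. -/
theorem forall_invalid_or_iff {Q : List ℕ → Prop} :
    (∀ xs, Invalid e xs ∨ Q xs) ↔ ∀ ys : List D, Q (ys.map (↑)) := by
  simp only [invalid_iff h, ← imp_iff_not_or]
  exact ⟨fun h1 ys => h1 _ ⟨ys, rfl⟩, by rintro h1 _ ⟨ys, rfl⟩; exact h1 ys⟩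

theorem exists_valid_and_iff {Q : List ℕ → Prop} :
    (∃ xs, Valid e xs ∧ Q xs) ↔ ∃ ys : List D, Q (ys.map (↑)) := by
  simp only [valid_iff h]
  exact ⟨by rintro ⟨_, ⟨ys, rfl⟩, h1⟩; exact ⟨ys, h1⟩, fun ⟨ys, h1⟩ => ⟨_, ⟨ys, rfl⟩, h1⟩⟩

end Semantics

/-- A word involves only finitely many letters, so a finite tuple can replace an assignment to all
of them. -/
theorem exists_evalAt_eq {B : Type*} [Group B] (σ : FreeGroup ℕ →* B) (l : Word) :
    ∃ ys : List B, evalAt ys (mk l) = σ (mk l) := by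
  refine ⟨(List.range (Encodable.encode l + 1)).map fun j => σ (FreeGroup.of j), ?_⟩
  have h1 : Subgroup.closure (FreeGroup.of '' Set.Iio (Encodable.encode l + 1)) ≤
      (evalAt ((List.range (Encodable.encode l + 1)).map fun j => σ (FreeGroup.of j))).eqLocus σ := by
    rw [closure_le]
    rintro _ ⟨j, hj, rfl⟩
    rw [Set.mem_Iio] at hj
    change evalAt _ _ = σ _
    rw [evalAt_of]
    simp [hj]
  exact h1 (mk_mem_closure fun x hx => Nat.lt_succ_of_le (letter_le_encode l x hx))

/-- A countable group is a quotient of the free group on `ℕ`, and the enumerated term of the lower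
central series maps onto its counterpart. -/
theorem lcs_eq_bot_iff {B : Type*} [Group B] [Countable B] (p : ℕ) :
    lcs B p = ⊥ ↔ ∀ (ys : List B) (k : ℕ), evalAt ys (mk (lcsWord p k)) = 1 := by
  constructor
  · intro hB ys k
    have h1 := map_mem_lcs (evalAt ys) ((mem_lcs_iff_exists_lcsWord p _).2 ⟨k, rfl⟩)
    rwa [hB, mem_bot] at h1
  · intro h1
    obtain ⟨a, ha⟩ := exists_surjective_nat B
    have hsurj : Function.Surjective (FreeGroup.lift a) := fun b => by
      obtain ⟨j, rfl⟩ := ha b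
      exact ⟨FreeGroup.of j, FreeGroup.lift_apply_of⟩
    rw [eq_bot_iff]
    intro b hb
    have h2 : lcs B p = (lcs (FreeGroup ℕ) p).map (FreeGroup.lift a) := by
      rw [lcs, lcs, map_lowerCentralSeries, map_top_of_surjective _ hsurj]
    rw [h2] at hb
    obtain ⟨w, hw, rfl⟩ := hb
    obtain ⟨k, rfl⟩ := (mem_lcs_iff_exists_lcsWord p w).1 hw
    obtain ⟨ys, hys⟩ := exists_evalAt_eq (FreeGroup.lift a) (lcsWord p k)
    rw [mem_bot, ← hys, h1]

theorem isPi2_lcs (p : ℕ) :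
    IsPi2 {e | ∀ x : List ℕ × ℕ, Invalid e x.1 ∨ Holds e x.1 (lcsWord p x.2)} := by
  have h1 : REPred fun x : ℕ × List ℕ × ℕ => Invalid x.1 x.2.1 :=
    rePred_invalid.comp (f := fun x : ℕ × List ℕ × ℕ => (x.1, x.2.1)) (by fun_prop)
  have hw : Primrec fun x : ℕ × List ℕ × ℕ => lcsWord p x.2.2 :=
    (primrec_lcsWord p).comp (by fun_prop)
  have h2 : REPred fun x : ℕ × List ℕ × ℕ => Holds x.1 x.2.1 (lcsWord p x.2.2) :=
    rePred_holds (by fun_prop) (by fun_prop) hw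
  exact isPi2_of_forall_re (h1.or h2) fun e => Iff.rfl

theorem lcs_iff {e : ℕ} {D : Set ℕ} [Group D] (h : IsCharIndex e (atomicDiagram D)) (p : ℕ) :
    (∀ x : List ℕ × ℕ, Invalid e x.1 ∨ Holds e x.1 (lcsWord p x.2)) ↔ lcs D p = ⊥ := by
  rw [lcs_eq_bot_iff]
  simp only [Prod.forall]
  rw [forall_comm]
  simp only [forall_invalid_or_iff h, holds_iff h]
  exact forall_comm

/-- The word that expresses that the first letter has the value of the given word in the other
letters. -/
def equationWord (l : Word) : Word := (0, false) :: expand (fun j => [(j + 1, true)]) l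

@[fun_prop] theorem Primrec.equationWord_comp {α : Type*} [Primcodable α] {f : α → Word}
    (hf : Primrec f) : Primrec fun x => equationWord (f x) :=
  Primrec.cons_comp (Primrec.const _)
    (Primrec.expand_comp (s := fun _ j => [(j + 1, true)]) (by fun_prop) hf)

theorem evalAt_equationWord {B : Type*} [Group B] (x : B) (zs : List B) (l : Word) :
    evalAt (x :: zs) (mk (equationWord l)) = 1 ↔ evalAt zs (mk l) = x := by
  have h1 : mk (equationWord l) =
      (FreeGroup.of 0)⁻¹ * mk (expand (fun j => [(j + 1, true)]) l) := rfl
  have h2 : evalAt (x :: zs) (mk (expand (fun j => [(j + 1, true)]) l)) = evalAt zs (mk l) := by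
    rw [hom_mk_expand]
    congr 2
    funext j
    exact (evalAt_of (x :: zs) (j + 1)).trans List.getD_cons_succ
  rw [h1, map_mul, map_inv, h2, evalAt_of, List.getD_cons_zero, inv_mul_eq_one, eq_comm]

theorem isPi2_locallyGenerated (m : ℕ) :
    IsPi2 {e | ∀ xs : List ℕ, Invalid e xs ∨ ∃ zs : List ℕ, Valid e zs ∧
      decide (zs.length ≤ m) = true ∧ ∀ x ∈ xs, ∃ l, Holds e (x :: zs) (equationWord l)} := by
  have h1 : REPred fun z : ((ℕ × List ℕ) × ℕ) × Word =>
      Holds z.1.1.1 (z.1.2 :: z.1.1.2) (equationWord z.2) :=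
    rePred_holds (by fun_prop) (by fun_prop) (by fun_prop)
  have h2 : REPred fun z : (ℕ × List ℕ) × List ℕ =>
      ∀ x ∈ z.1.2, ∃ l, Holds z.1.1 (x :: z.2) (equationWord l) :=
    h1.exists_comp.forall_mem_list.comp
      (f := fun z : (ℕ × List ℕ) × List ℕ => ((z.1.1, z.2), z.1.2)) (by fun_prop)
  have h3 : Primrec fun z : (ℕ × List ℕ) × List ℕ => decide (z.2.length ≤ m) :=
    Primrec.ble_comp (by fun_prop) (by fun_prop)
  have h4 : REPred fun z : (ℕ × List ℕ) × List ℕ => Valid z.1.1 z.2 :=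
    rePred_valid (by fun_prop) (by fun_prop)
  have h5 := (h4.and ((REPred.of_bool h3.to_comp).and h2)).exists_comp
  exact isPi2_of_forall_re (rePred_invalid.or h5) fun e => Iff.rfl

theorem locallyGenerated_iff {e : ℕ} {D : Set ℕ} [Group D] (h : IsCharIndex e (atomicDiagram D))
    (m : ℕ) : (∀ xs : List ℕ, Invalid e xs ∨ ∃ zs : List ℕ, Valid e zs ∧
      decide (zs.length ≤ m) = true ∧ ∀ x ∈ xs, ∃ l, Holds e (x :: zs) (equationWord l)) ↔
      LocallyGenerated m D := by
  rw [forall_invalid_or_iff h]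
  simp only [exists_valid_and_iff h, List.length_map, decide_eq_true_eq, List.forall_mem_map,
    ← List.map_cons, holds_iff h, evalAt_equationWord]
  rfl

/-- Every way in which a tuple can fail to be independent is r.e.: it is witnessed by a single
relation. Decidability of the word problem of `N` enters here, as the failure of a relation in `N`
must be recognizable. -/
theorem isSigma2_isIndependent (m : ℕ) {κ : Word → Bool} (hκ : Computable κ) :
    IsSigma2 {e | ∃ xs : List ℕ, ¬ (Invalid e xs ∨ (!(xs.length == m)) = true ∨
      (∃ l, (!κ l) = true ∧ Holds e xs l) ∨
      ∃ zs : List ℕ, Valid e zs ∧ ∃ x : Word × ℕ, Holds e (xs ++ zs) x.1 ∧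
        ((List.range zs.length).all fun j => dvdExpSum x.2 (m + j) x.1) = true ∧
        (!(List.range m).all fun i => dvdExpSum x.2 i x.1) = true)} := by
  have h1 : Primrec fun x : ℕ × List ℕ => !(x.2.length == m) := by fun_prop
  have h2 : Computable fun x : (ℕ × List ℕ) × Word => !κ x.2 :=
    (hκ.comp Computable.snd).not_comp
  have h3 : REPred fun x : (ℕ × List ℕ) × Word => Holds x.1.1 x.1.2 x.2 :=
    rePred_holds (by fun_prop) (by fun_prop) (by fun_prop)
  have h4 : REPred fun x : ((ℕ × List ℕ) × List ℕ) × Word × ℕ =>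
      Holds x.1.1.1 (x.1.1.2 ++ x.1.2) x.2.1 :=
    rePred_holds (by fun_prop) (by fun_prop) (by fun_prop)
  have h5 : Primrec fun x : ((ℕ × List ℕ) × List ℕ) × Word × ℕ =>
      (List.range x.1.2.length).all fun j => dvdExpSum x.2.2 (m + j) x.2.1 :=
    Primrec.list_all (g := fun (x : ((ℕ × List ℕ) × List ℕ) × Word × ℕ) j =>
      dvdExpSum x.2.2 (m + j) x.2.1) (by fun_prop) (by fun_prop)
  have h6 : Primrec fun x : ((ℕ × List ℕ) × List ℕ) × Word × ℕ =>
      (List.range m).all fun i => dvdExpSum x.2.2 i x.2.1 :=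
    Primrec.list_all (g := fun (x : ((ℕ × List ℕ) × List ℕ) × Word × ℕ) i =>
      dvdExpSum x.2.2 i x.2.1) (by fun_prop) (by fun_prop)
  have h7 : REPred fun x : (ℕ × List ℕ) × List ℕ => Valid x.1.1 x.2 :=
    rePred_valid (by fun_prop) (by fun_prop)
  have h8 := (h4.and ((REPred.of_bool h5.to_comp).and
    (REPred.of_bool h6.not_comp.to_comp))).exists_comp
  have h9 := rePred_invalid.or ((REPred.of_bool h1.to_comp).or
    ((((REPred.of_bool h2).and h3).exists_comp).or ((h7.and h8).exists_comp)))
  exact isSigma2_of_exists_not_re h9 fun e => Iff.rfl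

theorem isIndependent_iff {e : ℕ} {D : Set ℕ} [Group D] (h : IsCharIndex e (atomicDiagram D))
    (p m : ℕ) {κ : Word → Bool} (hκ : ∀ l, κ l = true ↔ evalN p m (mk l) = 1) :
    (∃ xs : List ℕ, ¬ (Invalid e xs ∨ (!(xs.length == m)) = true ∨
      (∃ l, (!κ l) = true ∧ Holds e xs l) ∨
      ∃ zs : List ℕ, Valid e zs ∧ ∃ x : Word × ℕ, Holds e (xs ++ zs) x.1 ∧
        ((List.range zs.length).all fun j => dvdExpSum x.2 (m + j) x.1) = true ∧
        (!(List.range m).all fun i => dvdExpSum x.2 i x.1) = true)) ↔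
      ∃ ys : List D, ys.length = m ∧ IsIndependent p m ys := by
  rw [← not_forall, forall_invalid_or_iff h, not_forall]
  refine exists_congr fun ys => ?_
  simp only [exists_valid_and_iff h, List.length_map, ← List.map_append, holds_iff h, not_or,
    Bool.not_eq_true', ne_eq, not_not, Bool.eq_false_iff, beq_iff_eq, hκ, not_exists,
    not_and, List.all_eq_true, List.mem_range, dvdExpSum_iff, Prod.forall]
  refine and_congr_right fun _ => ⟨fun h1 => ⟨fun l h2 => ?_, h1.2⟩, fun h1 =>
    ⟨fun l h2 h3 => h2 (h1.evalN_eq_one l h3), h1.dvd⟩⟩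
  by_contra h3
  exact h1.1 l h3 h2

theorem isDSigma2_indexSet {p : ℕ} (hp : 1 ≤ p) (m : ℕ) :
    IsDSigma2 (indexSet (FreeNilpotentGroup p m)) := by
  obtain ⟨κ, hκ, hκ'⟩ := exists_computable_evalN p m
  refine ⟨_, _, isSigma2_isIndependent m hκ, isPi2_setOf_exists_isCharIndex.inter
    ((isPi2_lcs p).inter (isPi2_locallyGenerated m)), Set.ext fun e => ⟨?_, ?_⟩⟩
  · rintro ⟨D, _, hD, he⟩
    obtain ⟨⟨h1, h2⟩, h3⟩ := (nonempty_mulEquiv_freeNilpotentGroup_iff hp).1 hD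
    exact ⟨(isIndependent_iff he p m hκ').2 h3, ⟨D, _, he⟩, (lcs_iff he p).2 h1,
      (locallyGenerated_iff he m).2 h2⟩
  · rintro ⟨h3, ⟨D, _, he⟩, h1, h2⟩
    exact ⟨D, _, (nonempty_mulEquiv_freeNilpotentGroup_iff hp).2 ⟨⟨(lcs_iff he p).1 h1,
      (locallyGenerated_iff he m).1 h2⟩, (isIndependent_iff he p m hκ').1 h3⟩, he⟩

end UpperBound

theorem mainTheorem12 (p m : ℕ) (hp : 1 ≤ p) (hm : 1 ≤ m) :
    IsMComplete IsDSigma2 (indexSet (FreeNilpotentGroup p m)) :=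
  ⟨isDSigma2_indexSet hp m, fun _ hT => hT.manyOneReducible hp hm⟩
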